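/- For real $1\le D_1<D_2$ and $h:\mathbb{R}\to\mathbb{R}$ vanishing on $(-\infty,0]$, put $$M(D_1,D_2;h)=\sum_{d_1,d_2\ge 1}\frac{\mu(d_1)\mu(d_2)}{[d_1,d_2]}\,\rho(d_1)\rho(d_2),\qquad \rho(t)=h\!\left(\frac{\log (D_2/t)}{\log (D_2/D_1)}\right),$$ where $\mu$ is the Möbius function and $[d_1,d_2]$ is the least common multiple (the sum is finite, since $\rho(d)=0$ for $d\ge D_2$). Let $h_0(x)=0$ for $x<0$, $h_0(x)=x$ for $0\le x\le 1$, $h_0(x)=1$ for $x>1$. Write $|f|_2$ for the $L^2(\mathbb{R})$-norm of an almost everywhere defined function $f$ on $\mathbb{R}$, and $V(f)$ for the infimum of the total variation over $\mathbb{R}$ of all functions $g:\mathbb{R}\to\mathbb{R}$ that are equal to $f$ almost everywhere. All implied constants below are absolute, unless indicated otherwise, and all estimates hold for all $1\le D_1<D_2$. (i) Let $h:\mathbb{R}\to\mathbb{R}$ be absolutely continuous, with $h(x)=0$ for $x\le 0$, $h(x)=1$ for $x\ge 1$, and $V(h')<\infty$. Then $h'\in L^2(\mathbb{R})$ and $$M(D_1,D_2;h)=\frac{|h'|_2^2}{\log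 (D_2/D_1)}+O\!\left(\frac{V(h')^2}{\log^2 (D_2/D_1)}\right).$$ The function $h_0$ is the unique minimizer of the main term: $h_0$ satisfies these hypotheses, $|h_0'|_2=1$, and every such $h$ has $|h'|_2\ge 1$, with equality if and only if $h=h_0$. (ii) Let $h_1:\mathbb{R}\to\mathbb{R}$ be absolutely continuous, with $h_1(x)=0$ for $x\le 0$ and for $x\ge 1$, and $V(h_1')<\infty$. Put $L=\log(D_2/D_1)$, let $g$ be a real-valued function with $g(L)\ge 1$ (for example, any $g:[1,\infty)\to[1,\infty)$ if $L\ge 1$), and set $h=h_0+\frac{1}{g(L)}h_1$. Then $h_1'\in L^2(\mathbb{R})$ and $$M(D_1,D_2;h)=M(D_1,D_2;h_0)+\frac{|h_1'|_2^2}{g(L)^2L}+O\!\left(\frac{V(h_1')+V(h_1')^2}{g(L)\,L^2}\right).$$ Consequently $h_0$ stays optimal to second order, in the following sense. There is an absolute constant $c>0$ such that, for every such $h_1$ that is not identically zero, $M(D_1,D_2;h)>M(D_1,D_2;h_0)$ whenever $g(L)<c\,\frac{|h_1'|_2^2}{V(h_1')+V(h_1')^2}\,L$; and for every $c>0$ and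 every such $h_1$ that is not identically zero, whenever $g(L)\ge c\,\frac{|h_1'|_2^2}{V(h_1')+V(h_1')^2}\,L$, $$M(D_1,D_2;h)=M(D_1,D_2;h_0)+O_c\!\left(\frac{(V(h_1')+V(h_1')^2)^2}{|h_1'|_2^2}\cdot\frac{1}{L^3}\right).$$ -/

import Mathlib

open MeasureTheory

/-- A function on the real line is absolutely continuous (on every compact interval). -/
def AbsCont (f : ℝ → ℝ) : Prop :=
  ∀ a b : ℝ, AbsolutelyContinuousOnInterval f a b

/-- `V(f)`: the infimum of the total variations over `ℝ` of all functions `g : ℝ → ℝ`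
that are equal to `f` almost everywhere. -/
noncomputable def essVariation (f : ℝ → ℝ) : ENNReal :=
  ⨅ (g : ℝ → ℝ) (_ : g =ᵐ[volume] f), eVariationOn g Set.univ

/-- The norm of `f` in `L²(ℝ)`. It is meaningful as soon as `MemLp f 2 volume`. -/
noncomputable def l2Norm (f : ℝ → ℝ) : ℝ :=
  (eLpNorm f 2 volume).toReal

/-- `h` is absolutely continuous, is `0` on `(-∞, 0]` and `c` on `[1, ∞)`, and `V(h') < ∞`.
(The function `deriv h` is a version of the almost everywhere defined derivative of `h`.) -/
structure IsSieveProfile (c : ℝ) (h : ℝ → ℝ) : Prop where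
  absCont : AbsCont h
  eq_zero : ∀ x : ℝ, x ≤ 0 → h x = 0
  eq_const : ∀ x : ℝ, 1 ≤ x → h x = c
  variation_lt_top : essVariation (deriv h) < ⊤

/-- The Barban–Vehov function `h₀`. -/
noncomputable def barbanVehov (x : ℝ) : ℝ :=
  if x < 0 then 0 else if x ≤ 1 then x else 1

/-- The weight `ρ_{D₁,D₂,h}(t) = h (log (D₂ / t) / log (D₂ / D₁))`. -/
noncomputable def sieveWeight (D₁ D₂ : ℝ) (h : ℝ → ℝ) (t : ℝ) : ℝ :=
  h (Real.log (D₂ / t) / Real.log (D₂ / D₁))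

/-- The sum `∑ μ(d₁) μ(d₂) / [d₁, d₂] * ρ(d₁) ρ(d₂)` over all pairs of positive integers. -/
noncomputable def quadraticSieveSum (ρ : ℝ → ℝ) : ℝ :=
  ∑' d : ℕ+ × ℕ+,
    ((ArithmeticFunction.moebius (d.1 : ℕ) : ℝ) * (ArithmeticFunction.moebius (d.2 : ℕ) : ℝ)) /
      (Nat.lcm (d.1 : ℕ) (d.2 : ℕ) : ℝ) * (ρ ((d.1 : ℕ) : ℝ) * ρ ((d.2 : ℕ) : ℝ))

/-- `M(D₁, D₂; h)`. -/
noncomputable def sieveM (D₁ D₂ : ℝ) (h : ℝ → ℝ) : ℝ :=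
  quadraticSieveSum (sieveWeight D₁ D₂ h)

/-- The sum defining `M(D₁, D₂; h)` is finite when `h` vanishes on `(-∞, 0]`. -/
theorem finite_support_sieveWeight {D₁ D₂ : ℝ} (hD₁ : 1 ≤ D₁) (hD : D₁ < D₂) {h : ℝ → ℝ}
    (h0 : ∀ x : ℝ, x ≤ 0 → h x = 0) :
    {d : ℕ+ | sieveWeight D₁ D₂ h ((d : ℕ) : ℝ) ≠ 0}.Finite := by
  have hfin : {n : ℕ | n ≤ ⌊D₂⌋₊}.Finite := Set.finite_le_nat _
  refine (hfin.preimage (f := fun d : ℕ+ => (d : ℕ)) PNat.coe_injective.injOn).subset ?_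
  intro d hd
  by_contra hle
  have hlt : ⌊D₂⌋₊ < (d : ℕ) := not_le.1 hle
  have hlt' : D₂ < ((d : ℕ) : ℝ) := Nat.lt_of_floor_lt hlt
  have hpos : 0 < D₂ := by linarith
  refine hd (h0 _ ?_)
  refine div_nonpos_of_nonpos_of_nonneg ?_ ?_
  · exact Real.log_nonpos (by positivity) ((div_le_one (by linarith)).2 hlt'.le)
  · exact Real.log_nonneg ((one_le_div (by linarith)).2 hD.le)

/-!
The weight `max 0 (x - s)`, with a kink at `s ∈ [0, 1]`, turns into
`log⁺ (D₂ (D₁ / D₂) ^ s / d) / log (D₂ / D₁)`. Everything therefore rests on the estimate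
`∑ μ(d) μ(e) / [d, e] * log⁺ (y / d) log⁺ (z / e) = log (min y z) + O(1)` for `y, z ≥ 1`
(`exists_abs_moebiusLcmForm_posLog_sub_le`).

A profile `h` which is constant beyond `1` and has a slope of variation at most `V` is a limit of
combinations `∑ νᵢ max 0 (x - sᵢ)` with `∑ νᵢ = 0` and `∑ |νᵢ| ≤ V`, where `νᵢ` are the jumps of a
step function approximating `h'`. For two such combinations the error is `O(V V' / log² (D₂ / D₁))`.
The main term has the kernel `log (min y z) = log D₂ - max s t * log (D₂ / D₁)`; as the jumps add up
to `0`, its constant `log D₂` plays no role and may be replaced by `log (D₂ / D₁)`, which gives a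
multiple of the kernel `1 - max s t` of `∫ h' k'` on `[0, 1]`.
So the bilinear form at `h` and `k` is
`(∫ h' k') / log (D₂ / D₁) + O(V V' / log² (D₂ / D₁))`
(`exists_abs_moebiusLcmForm_sieveWeight_sub_le`). The case `h = k` is the first asymptotic formula;
for `h₀ + h₁ / g` the cross term has no main term, as `∫ h₀' h₁' = h₁ 1 - h₁ 0 = 0`. The extremal
property of `h₀` is `∫ (h' - 1)² = |h'|² - 1` on `[0, 1]`.

For the estimate with two logarithms, Selberg's diagonalisation `(d, e) = ∑_{r ∣ d, r ∣ e} φ(r)`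
leads to the sums `∑ μ(m) / m * log (x / m)` over `m ≤ x` coprime to `r`. These are
`∑ E₁(x / k) / k` over the integers `k` composed of the primes dividing `r`, where
`E₁(x) = ∑_{n ≤ x} μ(n) / n * log (x / n) = 1 + E(x)`; the `1` contributes `r / φ(r)`, hence the
main term `∑_{r ≤ y} μ(r)² / φ(r) = log y + O(1)`. In the error terms, summed over `r`, the
products `n = r k` run over the integers whose radical is at most `y`, each once, so they are
controlled by `∑_{n ≤ z} |E(z / n)| / n = O(1)`. By the Lipschitz property of `E` in `log x` that is
the integrability of `E(exp u)` on `(0, ∞)` (`exists_integral_abs_moebiusLogError_le`), a slightly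
quantitative form of the prime number theorem. It is proved by Plancherel's theorem: the
Laplace transform of `(1 + u) E(exp u)` is `F - F'` with `F(s) = 1 / (s² ζ(1 + s)) - 1 / s`, which
is square integrable on vertical lines, uniformly up to the imaginary axis, because `1 / ζ` and
`ζ'` grow at most like small powers of `|im s|` there (`exists_norm_moebiusLaplace_sub_deriv_le`).
-/

/-! ### The Plancherel inequality -/

open scoped FourierTransform in
open FourierTransform in
/-- Half of Plancherel's theorem for functions in `L¹ ∩ L²`, by duality with Schwartz functions. -/
theorem eLpNorm_two_le_eLpNorm_two_fourier {f : ℝ → ℂ} (hf : Integrable f) (hf2 : MemLp f 2)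
    (hF : MemLp (𝓕 f) 2) : eLpNorm f 2 ≤ eLpNorm (𝓕 f) 2 := by
  set u := hf2.toLp f with hu
  set w := hF.toLp (𝓕 f) with hw
  have key : ∀ φ : SchwartzMap ℝ ℂ, ‖inner ℂ u (φ.toLp 2)‖ ≤ ‖w‖ * ‖φ.toLp 2 volume‖ := by
    intro φ
    have h1 : inner ℂ u (φ.toLp 2) = inner ℂ w ((𝓕 φ).toLp 2) := by
      rw [L2.inner_def, L2.inner_def]
      have e1 : ∫ x, inner ℂ ((u : ℝ → ℂ) x) ((φ.toLp 2 volume : ℝ → ℂ) x)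
          = ∫ x, inner ℂ (f x) (φ x) := by
        refine integral_congr_ae ?_
        filter_upwards [hf2.coeFn_toLp, φ.coeFn_toLp 2 volume] with x h1 h2
        rw [h1, h2]
      have e2 : ∫ x, inner ℂ ((w : ℝ → ℂ) x) (((𝓕 φ).toLp 2 volume : ℝ → ℂ) x)
          = ∫ x, inner ℂ (𝓕 f x) (𝓕 φ x) := by
        refine integral_congr_ae ?_
        filter_upwards [hF.coeFn_toLp, (𝓕 φ).coeFn_toLp 2 volume] with x h1 h2
        rw [h1, h2]
      rw [e1, e2]
      have h3 := VectorFourier.integral_sesq_fourierIntegral_eq_neg_flip (innerSL ℂ (E := ℂ))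
        (L := innerₗ ℝ) Real.continuous_fourierChar continuous_inner hf ((𝓕 φ).integrable (μ := volume))
      have h4 : ∀ ψ : SchwartzMap ℝ ℂ, ψ = 𝓕 φ → ∀ x, φ x = 𝓕⁻ (ψ : ℝ → ℂ) x := by
        rintro ψ rfl x
        rw [← SchwartzMap.fourierInv_coe, fourierInv_fourier_eq φ]
      simp_rw [h4 _ rfl]
      simpa using! h3.symm
    rw [h1]
    refine (norm_inner_le_norm _ _).trans ?_
    rw [SchwartzMap.norm_fourier_toL2_eq]
  have key2 : ∀ v : Lp ℂ 2 (volume : Measure ℝ), ‖inner ℂ u v‖ ≤ ‖w‖ * ‖v‖ := by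
    intro v
    refine (SchwartzMap.denseRange_toLpCLM (E := ℝ) (F := ℂ) (p := 2) (μ := volume)
      ENNReal.ofNat_ne_top).induction_on v ?_ ?_
    · exact isClosed_le (by fun_prop) (by fun_prop)
    · intro φ
      exact key φ
  have h6 := key2 u
  rw [inner_self_eq_norm_sq_to_K] at h6
  have h7 : ‖u‖ ≤ ‖w‖ := by
    by_contra hlt
    push Not at hlt
    have hu0 : 0 < ‖u‖ := (norm_nonneg _).trans_lt hlt
    simp at h6
    nlinarith
  rw [hu, hw, Lp.norm_toLp, Lp.norm_toLp] at h7
  exact (ENNReal.toReal_le_toReal hf2.2.ne hF.2.ne).1 h7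

open scoped FourierTransform in
/-- Half of Plancherel's theorem, in terms of integrals. -/
theorem integral_norm_sq_le_integral_norm_sq_fourier {f : ℝ → ℂ} (hf : Integrable f)
    (hf2 : MemLp f 2) (hF : MemLp (𝓕 f) 2) : ∫ x, ‖f x‖ ^ 2 ≤ ∫ x, ‖𝓕 f x‖ ^ 2 := by
  have h := eLpNorm_two_le_eLpNorm_two_fourier hf hf2 hF
  have h' := ENNReal.toReal_mono hF.2.ne h
  have aux : ∀ g : ℝ → ℂ, MemLp g 2 → (eLpNorm g 2).toReal ^ 2 = ∫ x, ‖g x‖ ^ 2 := by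
    intro g hg
    rw [hg.eLpNorm_eq_integral_rpow_norm (by norm_num) (by norm_num),
      ENNReal.toReal_ofReal (by positivity), ← Real.rpow_natCast, ← Real.rpow_mul (by positivity)]
    norm_num
  rw [← aux f hf2, ← aux _ hF]
  gcongr

/-! ### Bounds for the zeta function -/

/-- `(s - 1) ((n + 1)^{-s} - ∫_n^{n+1} x^{-s} dx)`, written as an entire function of `s`. -/
noncomputable def zetaIncrement (n : ℕ) (s : ℂ) : ℂ :=
  (s - 1) * ((n + 1 : ℝ) : ℂ) ^ (-s) + ((n + 1 : ℝ) : ℂ) ^ (1 - s) - ((n : ℝ) : ℂ) ^ (1 - s)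

/-- The function `(s - 1) y^{-s} (y - n) + y^{1 - s} - n^{1 - s}` of `y` vanishes at `y = n`, is the
increment at `y = n + 1`, and has a derivative bounded by that of `y ↦ -2 ‖s‖ ‖s - 1‖ y^{-1/2}`. -/
theorem norm_zetaIncrement_le {n : ℕ} (hn : 1 ≤ n) {s : ℂ} (hs : 1 / 2 ≤ s.re) :
    ‖zetaIncrement n s‖ ≤
      2 * (‖s‖ * ‖s - 1‖) * ((n : ℝ) ^ (-(1 / 2) : ℝ) - ((n : ℝ) + 1) ^ (-(1 / 2) : ℝ)) := by
  have hn' : (1 : ℝ) ≤ n := by exact_mod_cast hn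
  set F : ℝ → ℂ := fun y => (s - 1) * ((y : ℂ) ^ (-s) * ((y : ℂ) - n)) + (y : ℂ) ^ (1 - s)
    - ((n : ℝ) : ℂ) ^ (1 - s) with hF
  set B : ℝ → ℝ := fun y => 2 * (‖s‖ * ‖s - 1‖) * ((n : ℝ) ^ (-(1 / 2) : ℝ) - y ^ (-(1 / 2) : ℝ))
    with hB
  have hFd : ∀ y : ℝ, 0 < y → HasDerivAt F
      (-s * (s - 1) * ((y : ℂ) ^ (-s - 1) * ((y : ℂ) - n))) y := by
    intro y hy
    have h1 : ∀ r : ℂ, HasDerivAt (fun y : ℝ => (y : ℂ) ^ r) (r * (y : ℂ) ^ (r - 1)) y := by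
      intro r
      rcases eq_or_ne r 0 with rfl | hr
      · simpa using hasDerivAt_const y (1 : ℂ)
      · exact hasDerivAt_ofReal_cpow_const hy.ne' hr
    have h2 : HasDerivAt (fun y : ℝ => ((y : ℂ) - n)) 1 y := by
      simpa using! (Complex.ofRealCLM.hasDerivAt (x := y)).sub_const (n : ℂ)
    have h3 := ((((h1 (-s)).mul h2).const_mul (s - 1)).add (h1 (1 - s))).sub_const
      (((n : ℝ) : ℂ) ^ (1 - s))
    refine h3.congr_deriv ?_
    have : (1 - s - 1 : ℂ) = -s := by ring
    rw [this]
    ring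
  have hBd : ∀ y : ℝ, 0 < y → HasDerivAt B (‖s‖ * ‖s - 1‖ * y ^ (-(3 / 2) : ℝ)) y := by
    intro y hy
    have h1 := ((Real.hasDerivAt_rpow_const (p := -(1 / 2)) (Or.inl hy.ne')).const_sub
      ((n : ℝ) ^ (-(1 / 2) : ℝ))).const_mul (2 * (‖s‖ * ‖s - 1‖))
    refine h1.congr_deriv ?_
    norm_num
    ring
  have key := image_norm_le_of_norm_deriv_right_le_deriv_boundary' (f := F) (a := n)
    (b := (n : ℝ) + 1) (B := B)
    (f' := fun y => -s * (s - 1) * ((y : ℂ) ^ (-s - 1) * ((y : ℂ) - n)))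
    (B' := fun y => ‖s‖ * ‖s - 1‖ * y ^ (-(3 / 2) : ℝ))
    (fun y hy => (hFd y (by linarith [hy.1])).continuousAt.continuousWithinAt)
    (fun y hy => (hFd y (by linarith [hy.1])).hasDerivWithinAt)
    (by simp [hF, hB])
    (fun y hy => (hBd y (by linarith [hy.1])).continuousAt.continuousWithinAt)
    (fun y hy => (hBd y (by linarith [hy.1])).hasDerivWithinAt)
    (by
      intro y hy
      have hy0 : 0 < y := by linarith [hy.1]
      have hy1 : 1 ≤ y := by linarith [hy.1]
      rw [norm_mul, norm_mul, norm_mul, norm_neg, Complex.norm_cpow_eq_rpow_re_of_pos hy0]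
      have h1 : ‖(y : ℂ) - n‖ ≤ 1 := by
        have : (y : ℂ) - n = ((y - n : ℝ) : ℂ) := by push_cast; ring
        rw [this, Complex.norm_real, Real.norm_eq_abs, abs_le]
        constructor <;> linarith [hy.1, hy.2]
      have h2 : y ^ (-s - 1).re ≤ y ^ (-(3 / 2) : ℝ) := by
        apply Real.rpow_le_rpow_of_exponent_le hy1
        simp
        linarith
      calc _ ≤ ‖s‖ * ‖s - 1‖ * (y ^ (-(3 / 2) : ℝ) * 1) := by gcongr
        _ = _ := by ring)
    (x := (n : ℝ) + 1) (by constructor <;> linarith)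
  have e : F ((n : ℝ) + 1) = zetaIncrement n s := by
    simp [hF, zetaIncrement]
  rw [e] at key
  exact key

theorem differentiable_zetaIncrement {n : ℕ} (hn : 1 ≤ n) :
    Differentiable ℂ (zetaIncrement n) := by
  have h1 : ((n + 1 : ℝ) : ℂ) ≠ 0 := by
    rw [Complex.ofReal_ne_zero]
    positivity
  have h2 : ((n : ℝ) : ℂ) ≠ 0 := by
    simp
    omega
  intro s
  unfold zetaIncrement
  exact (((by fun_prop : DifferentiableAt ℂ (fun s : ℂ => s - 1) s).mul
    ((by fun_prop : DifferentiableAt ℂ (fun s : ℂ => -s) s).const_cpow (Or.inl h1))).add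
    ((by fun_prop : DifferentiableAt ℂ (fun s : ℂ => 1 - s) s).const_cpow (Or.inl h1))).sub
    ((by fun_prop : DifferentiableAt ℂ (fun s : ℂ => 1 - s) s).const_cpow (Or.inl h2))

/-- A telescoping series. -/
theorem hasSum_rpow_neg_half_increment {N : ℕ} (hN : 1 ≤ N) :
    HasSum (fun m : ℕ => (((N + m : ℕ) : ℝ) ^ (-(1 / 2) : ℝ) -
      (((N + m : ℕ) : ℝ) + 1) ^ (-(1 / 2) : ℝ)))
      ((N : ℝ) ^ (-(1 / 2) : ℝ)) := by
  have hpos : ∀ m : ℕ, (0 : ℝ) < ((N + m : ℕ) : ℝ) := fun m => by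
    exact_mod_cast (by omega : 0 < N + m)
  rw [hasSum_iff_tendsto_nat_of_nonneg]
  · have h1 : ∀ M : ℕ, ∑ m ∈ Finset.range M, (((N + m : ℕ) : ℝ) ^ (-(1 / 2) : ℝ) -
      (((N + m : ℕ) : ℝ) + 1) ^ (-(1 / 2) : ℝ)) =
      (N : ℝ) ^ (-(1 / 2) : ℝ) - ((N + M : ℕ) : ℝ) ^ (-(1 / 2) : ℝ) := by
      intro M
      have := Finset.sum_range_sub' (fun m : ℕ => ((N + m : ℕ) : ℝ) ^ (-(1 / 2) : ℝ)) M
      simp only [add_zero] at this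
      rw [← this]
      refine Finset.sum_congr rfl fun m _ => ?_
      push_cast
      ring_nf
    simp_rw [h1]
    have h2 : Filter.Tendsto (fun M : ℕ => ((N + M : ℕ) : ℝ) ^ (-(1 / 2) : ℝ)) Filter.atTop
        (nhds 0) := by
      refine (tendsto_rpow_neg_atTop (by norm_num : (0 : ℝ) < 1 / 2)).comp ?_
      refine tendsto_natCast_atTop_atTop.comp ?_
      exact Filter.tendsto_atTop_mono (fun M => Nat.le_add_left M N) Filter.tendsto_id
    simpa using h2.const_sub ((N : ℝ) ^ (-(1 / 2) : ℝ))
  · intro m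
    rw [sub_nonneg]
    exact Real.rpow_le_rpow_of_nonpos (hpos m) (by linarith) (by norm_num)

theorem norm_zetaIncrement_add_le {N : ℕ} (hN : 1 ≤ N) {s : ℂ} (hs : 1 / 2 ≤ s.re) (m : ℕ) :
    ‖zetaIncrement (N + m) s‖ ≤ 2 * (‖s‖ * ‖s - 1‖) *
      (((N + m : ℕ) : ℝ) ^ (-(1 / 2) : ℝ) - (((N + m : ℕ) : ℝ) + 1) ^ (-(1 / 2) : ℝ)) :=
  norm_zetaIncrement_le (by omega) hs

theorem riemannZeta₁_eq_of_one_lt_re {N : ℕ} (hN : 1 ≤ N) {s : ℂ} (hs : 1 < s.re) :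
    riemannZeta₁ s = (s - 1) * ∑ n ∈ Finset.range N, ((n + 1 : ℝ) : ℂ) ^ (-s)
      + ((N : ℝ) : ℂ) ^ (1 - s) + ∑' m : ℕ, zetaIncrement (N + m) s := by
  have hs1 : s ≠ 1 := by
    rintro rfl
    simp at hs
  have hsummable : Summable fun m : ℕ => zetaIncrement (N + m) s :=
    Summable.of_norm_bounded ((hasSum_rpow_neg_half_increment hN).summable.mul_left _)
      (norm_zetaIncrement_add_le hN (by linarith))
  have hz : Summable fun n : ℕ => ((n + 1 : ℝ) : ℂ) ^ (-s) := by
    have := (summable_nat_add_iff 1).2 (Complex.summable_one_div_nat_cpow.2 hs)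
    refine this.congr fun n => ?_
    rw [Complex.cpow_neg, one_div]
    push_cast
    rfl
  have hzeta : riemannZeta s = ∑' n : ℕ, ((n + 1 : ℝ) : ℂ) ^ (-s) := by
    rw [zeta_eq_tsum_one_div_nat_add_one_cpow hs]
    refine tsum_congr fun n => ?_
    rw [Complex.cpow_neg, one_div]
    push_cast
    rfl
  have hpart : ∀ M : ℕ, ∑ m ∈ Finset.range M, zetaIncrement (N + m) s =
      (s - 1) * (∑ n ∈ Finset.range (N + M), ((n + 1 : ℝ) : ℂ) ^ (-s)
        - ∑ n ∈ Finset.range N, ((n + 1 : ℝ) : ℂ) ^ (-s))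
      + (((N + M : ℕ) : ℝ) : ℂ) ^ (1 - s) - ((N : ℝ) : ℂ) ^ (1 - s) := by
    intro M
    induction M with
    | zero => simp
    | succ M ih =>
      rw [Finset.sum_range_succ, ih, ← add_assoc N M 1, Finset.sum_range_succ, zetaIncrement]
      push_cast
      ring
  have hlim : Filter.Tendsto (fun M : ℕ => ∑ m ∈ Finset.range M, zetaIncrement (N + m) s)
      Filter.atTop (nhds ((s - 1) * (riemannZeta s
        - ∑ n ∈ Finset.range N, ((n + 1 : ℝ) : ℂ) ^ (-s)) + 0 - ((N : ℝ) : ℂ) ^ (1 - s))) := by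
    simp_rw [hpart]
    have hNM : Filter.Tendsto (fun M : ℕ => N + M) Filter.atTop Filter.atTop :=
      Filter.tendsto_atTop_mono (fun M => Nat.le_add_left M N) Filter.tendsto_id
    refine (((((hzeta ▸ hz.hasSum.tendsto_sum_nat).comp hNM).sub_const _).const_mul _).add
      ?_).sub_const _
    rw [tendsto_zero_iff_norm_tendsto_zero]
    have h2 : Filter.Tendsto (fun M : ℕ => ((N + M : ℕ) : ℝ) ^ (-(s.re - 1) : ℝ)) Filter.atTop
        (nhds 0) :=
      (tendsto_rpow_neg_atTop (by linarith : (0 : ℝ) < s.re - 1)).comp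
        (tendsto_natCast_atTop_atTop.comp hNM)
    refine h2.congr fun M => ?_
    rw [Complex.norm_cpow_eq_rpow_re_of_pos (by exact_mod_cast (by omega : 0 < N + M))]
    simp
  have := tendsto_nhds_unique hsummable.hasSum.tendsto_sum_nat hlim
  rw [this, riemannZeta_eq_inv_sub_mul hs1]
  have h1 : s - 1 ≠ 0 := sub_ne_zero.2 hs1
  field_simp
  ring

/-- The truncated Dirichlet series of `ζ`, continued to `re s > 1 / 2` by the identity theorem. -/
theorem riemannZeta₁_eq {N : ℕ} (hN : 1 ≤ N) {s : ℂ} (hs : 1 / 2 < s.re) :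
    riemannZeta₁ s = (s - 1) * ∑ n ∈ Finset.range N, ((n + 1 : ℝ) : ℂ) ^ (-s)
      + ((N : ℝ) : ℂ) ^ (1 - s) + ∑' m : ℕ, zetaIncrement (N + m) s := by
  set R : ℝ := ‖s‖ + 3 with hR
  have hR0 : 0 ≤ ‖s‖ := norm_nonneg s
  set U : Set ℂ := {z : ℂ | 1 / 2 < z.re} ∩ Metric.ball 0 R with hU
  have hUo : IsOpen U := (isOpen_lt continuous_const Complex.continuous_re).inter Metric.isOpen_ball
  have hUc : IsPreconnected U :=
    ((convex_halfSpace_re_gt (1 / 2)).inter (convex_ball 0 R)).isPreconnected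
  have h2U : (2 : ℂ) ∈ U := by
    refine ⟨by norm_num, ?_⟩
    simp [hR]
    linarith
  have hsU : s ∈ U := ⟨hs, by simp [hR]⟩
  have hD : DifferentiableOn ℂ (fun z => ∑' m : ℕ, zetaIncrement (N + m) z) U := by
    refine Complex.differentiableOn_tsum_of_summable_norm
      ((hasSum_rpow_neg_half_increment hN).summable.mul_left (2 * (R * (R + 1))))
      (fun m => (differentiable_zetaIncrement (by omega)).differentiableOn) hUo ?_
    intro m z hz
    refine (norm_zetaIncrement_add_le hN hz.1.le m).trans ?_
    have hzR : ‖z‖ ≤ R := by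
      have := hz.2
      rw [mem_ball_zero_iff] at this
      exact this.le
    have hz1 : ‖z - 1‖ ≤ R + 1 := by
      refine (norm_sub_le _ _).trans ?_
      simp [hzR]
    have hnn : 0 ≤ (((N + m : ℕ) : ℝ) ^ (-(1 / 2) : ℝ) -
        (((N + m : ℕ) : ℝ) + 1) ^ (-(1 / 2) : ℝ)) := by
      rw [sub_nonneg]
      exact Real.rpow_le_rpow_of_nonpos (by exact_mod_cast (by omega : 0 < N + m)) (by linarith)
        (by norm_num)
    gcongr
  have hfin : Differentiable ℂ fun z : ℂ => (z - 1) * ∑ n ∈ Finset.range N,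
      ((n + 1 : ℝ) : ℂ) ^ (-z) + ((N : ℝ) : ℂ) ^ (1 - z) := by
    intro z
    have hN0 : ((N : ℝ) : ℂ) ≠ 0 := by
      simp
      omega
    refine DifferentiableAt.add (DifferentiableAt.mul (by fun_prop) ?_)
      ((by fun_prop : DifferentiableAt ℂ (fun s : ℂ => 1 - s) z).const_cpow (Or.inl hN0))
    refine DifferentiableAt.fun_sum fun n _ => ?_
    refine (by fun_prop : DifferentiableAt ℂ (fun s : ℂ => -s) z).const_cpow (Or.inl ?_)
    rw [Complex.ofReal_ne_zero]
    positivity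
  have hana : AnalyticOnNhd ℂ (fun z => (z - 1) * ∑ n ∈ Finset.range N, ((n + 1 : ℝ) : ℂ) ^ (-z)
      + ((N : ℝ) : ℂ) ^ (1 - z) + ∑' m : ℕ, zetaIncrement (N + m) z) U :=
    (hfin.differentiableOn.add hD).analyticOnNhd hUo
  refine AnalyticOnNhd.eqOn_of_preconnected_of_eventuallyEq
    (differentiable_riemannZeta₁.differentiableOn.analyticOnNhd hUo) hana hUc h2U ?_ hsU
  filter_upwards [(isOpen_lt continuous_const Complex.continuous_re).mem_nhds
    (show (1 : ℝ) < (2 : ℂ).re by norm_num)] with z hz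
  exact riemannZeta₁_eq_of_one_lt_re hN hz

theorem norm_riemannZeta₁_sub_le {N : ℕ} (hN : 1 ≤ N) {s : ℂ} (hs : 1 / 2 < s.re) :
    ‖riemannZeta₁ s - ((s - 1) * ∑ n ∈ Finset.range N, ((n + 1 : ℝ) : ℂ) ^ (-s)
      + ((N : ℝ) : ℂ) ^ (1 - s))‖ ≤ 2 * (‖s‖ * ‖s - 1‖) * (N : ℝ) ^ (-(1 / 2) : ℝ) := by
  rw [riemannZeta₁_eq hN hs, add_sub_cancel_left]
  exact tsum_of_norm_bounded ((hasSum_rpow_neg_half_increment hN).mul_left _)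
    (norm_zetaIncrement_add_le hN hs.le)

/-- A bound for `ζ` a little to the left of the line `re s = 1`. The exponent `1 / 16` is a
convenient small one: the Dirichlet series is truncated at `N ≈ |im s| ^ 2`, where the tail is
bounded. -/
theorem exists_norm_riemannZeta_le :
    ∃ K : ℝ, 0 < K ∧ ∀ s : ℂ, 63 / 64 ≤ s.re → s.re ≤ 3 → 1 ≤ |s.im| →
      ‖riemannZeta s‖ ≤ K * |s.im| ^ (1 / 16 : ℝ) := by
  refine ⟨140, by norm_num, fun s hs1 hs3 ht => ?_⟩
  set t := |s.im| with htdef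
  have ht0 : 0 < t := by linarith
  set N : ℕ := ⌈t ^ 2⌉₊ with hNdef
  have hNt : t ^ 2 ≤ N := Nat.le_ceil _
  have hN2 : (N : ℝ) ≤ 2 * t ^ 2 := by
    have := Nat.ceil_lt_add_one (sq_nonneg t)
    nlinarith
  have hN1' : (1 : ℝ) ≤ N := by nlinarith
  have hN1 : 1 ≤ N := by exact_mod_cast hN1'
  have hN0 : (0 : ℝ) < N := by linarith
  have hsne : s ≠ 1 := by
    rintro rfl
    simp [htdef] at ht
    linarith
  have hs1t : t ≤ ‖s - 1‖ := by
    have := Complex.abs_im_le_norm (s - 1)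
    simpa using this
  have hst : ‖s‖ ≤ 4 * t := by
    have := Complex.norm_le_abs_re_add_abs_im s
    rw [abs_of_nonneg (by linarith)] at this
    linarith
  have hs10 : 0 < ‖s - 1‖ := by linarith
  -- all the powers of `N` that occur are at most `N ^ (1 / 32)`
  set T : ℝ := t ^ (1 / 16 : ℝ) with hT
  have hT1 : 1 ≤ T := Real.one_le_rpow ht (by norm_num)
  have hNT : (N : ℝ) ^ (1 / 32 : ℝ) ≤ 2 * T := by
    calc (N : ℝ) ^ (1 / 32 : ℝ) ≤ (2 * t ^ 2) ^ (1 / 32 : ℝ) := by gcongr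
      _ = 2 ^ (1 / 32 : ℝ) * T := by
        rw [Real.mul_rpow (by norm_num) (by positivity), ← Real.rpow_natCast t 2,
          ← Real.rpow_mul ht0.le]
        norm_num [hT]
      _ ≤ 2 ^ (1 : ℝ) * T := by
        gcongr <;> norm_num
      _ = 2 * T := by norm_num
  have hN64 : (N : ℝ) ^ (1 / 64 : ℝ) * (N : ℝ) ^ (1 / 64 : ℝ) = (N : ℝ) ^ (1 / 32 : ℝ) := by
    rw [← Real.rpow_add hN0]
    norm_num
  have hN64' : 1 ≤ (N : ℝ) ^ (1 / 64 : ℝ) := Real.one_le_rpow hN1' (by norm_num)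
  have hsum : ‖∑ n ∈ Finset.range N, ((n + 1 : ℝ) : ℂ) ^ (-s)‖ ≤ 65 * (N : ℝ) ^ (1 / 32 : ℝ) := by
    calc ‖∑ n ∈ Finset.range N, ((n + 1 : ℝ) : ℂ) ^ (-s)‖
        ≤ ∑ n ∈ Finset.range N, ‖((n + 1 : ℝ) : ℂ) ^ (-s)‖ := norm_sum_le _ _
      _ ≤ ∑ n ∈ Finset.range N, (N : ℝ) ^ (1 / 64 : ℝ) * ((n : ℝ) + 1)⁻¹ := by
        refine Finset.sum_le_sum fun n hn => ?_
        have hn0 : (0 : ℝ) < (n : ℝ) + 1 := by positivity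
        have hnN : (n : ℝ) + 1 ≤ N := by exact_mod_cast Finset.mem_range.1 hn
        have hn1 : (1 : ℝ) ≤ (n : ℝ) + 1 := by simp
        rw [Complex.norm_cpow_eq_rpow_re_of_pos hn0]
        calc ((n : ℝ) + 1) ^ (-s).re ≤ ((n : ℝ) + 1) ^ (1 / 64 + -1 : ℝ) := by
              apply Real.rpow_le_rpow_of_exponent_le hn1
              simp
              linarith
          _ = ((n : ℝ) + 1) ^ (1 / 64 : ℝ) * ((n : ℝ) + 1)⁻¹ := by
              rw [Real.rpow_add hn0, Real.rpow_neg_one]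
          _ ≤ _ := by gcongr
      _ = (N : ℝ) ^ (1 / 64 : ℝ) * (harmonic N : ℝ) := by
        rw [← Finset.mul_sum, harmonic]
        push_cast
        rfl
      _ ≤ (N : ℝ) ^ (1 / 64 : ℝ) * (1 + Real.log N) := by
        gcongr
        exact harmonic_le_one_add_log N
      _ ≤ (N : ℝ) ^ (1 / 64 : ℝ) * ((N : ℝ) ^ (1 / 64 : ℝ) + 64 * (N : ℝ) ^ (1 / 64 : ℝ)) := by
        have := Real.log_le_rpow_div hN0.le (by norm_num : (0 : ℝ) < 1 / 64)
        gcongr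
        linarith
      _ = _ := by rw [← hN64]; ring
  have hpow : ‖((N : ℝ) : ℂ) ^ (1 - s)‖ ≤ (N : ℝ) ^ (1 / 32 : ℝ) := by
    rw [Complex.norm_cpow_eq_rpow_re_of_pos hN0]
    apply Real.rpow_le_rpow_of_exponent_le hN1'
    simp
    linarith
  have htail : (N : ℝ) ^ (-(1 / 2) : ℝ) ≤ t⁻¹ := by
    calc (N : ℝ) ^ (-(1 / 2) : ℝ) ≤ (t ^ 2) ^ (-(1 / 2) : ℝ) :=
          Real.rpow_le_rpow_of_nonpos (by positivity) hNt (by norm_num)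
      _ = t⁻¹ := by
          rw [← Real.rpow_natCast t 2, ← Real.rpow_mul ht0.le, ← Real.rpow_neg_one]
          norm_num
  have h := norm_riemannZeta₁_sub_le hN1 (s := s) (by linarith)
  have h1 : ‖riemannZeta₁ s‖ ≤ ‖s - 1‖ * (65 * (2 * T)) + ‖s - 1‖ * (2 * T)
      + 8 * ‖s - 1‖ := by
    have e1 := norm_le_norm_add_norm_sub' (riemannZeta₁ s)
      ((s - 1) * ∑ n ∈ Finset.range N, ((n + 1 : ℝ) : ℂ) ^ (-s) + ((N : ℝ) : ℂ) ^ (1 - s))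
    have e2 : ‖(s - 1) * ∑ n ∈ Finset.range N, ((n + 1 : ℝ) : ℂ) ^ (-s)
        + ((N : ℝ) : ℂ) ^ (1 - s)‖ ≤ ‖s - 1‖ * (65 * (2 * T)) + ‖s - 1‖ * (2 * T) := by
      refine (norm_add_le _ _).trans ?_
      rw [norm_mul]
      have : 2 * T ≤ ‖s - 1‖ * (2 * T) := le_mul_of_one_le_left (by positivity) (by linarith)
      gcongr
      · exact hsum.trans (by gcongr)
      · exact hpow.trans (hNT.trans this)
    have e3 : 2 * (‖s‖ * ‖s - 1‖) * (N : ℝ) ^ (-(1 / 2) : ℝ) ≤ 8 * ‖s - 1‖ := by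
      calc 2 * (‖s‖ * ‖s - 1‖) * (N : ℝ) ^ (-(1 / 2) : ℝ)
          ≤ 2 * ((4 * t) * ‖s - 1‖) * t⁻¹ := by gcongr
        _ = 8 * ‖s - 1‖ := by field_simp; ring
    linarith
  rw [riemannZeta_eq_inv_sub_mul hsne, norm_mul, norm_inv, inv_mul_le_iff₀ hs10]
  nlinarith

/-- A bound for `ζ'` on the line `re s = 1` and to its right, from Cauchy's estimate on discs of
radius `1 / 64`. -/
theorem exists_norm_deriv_riemannZeta_le :
    ∃ K : ℝ, 0 < K ∧ ∀ s : ℂ, 1 ≤ s.re → s.re ≤ 2 → 2 ≤ |s.im| →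
      ‖deriv riemannZeta s‖ ≤ K * |s.im| ^ (1 / 16 : ℝ) := by
  obtain ⟨K, hK0, hK⟩ := exists_norm_riemannZeta_le
  refine ⟨K * 2 * 64, by positivity, fun s hs1 hs2 ht => ?_⟩
  have hball : ∀ z ∈ Metric.closedBall s (1 / 64), 63 / 64 ≤ z.re ∧ z.re ≤ 3 ∧ 1 ≤ |z.im| ∧
      |z.im| ≤ 2 * |s.im| := by
    intro z hz
    rw [mem_closedBall_iff_norm] at hz
    have h1 := (Complex.abs_re_le_norm (z - s)).trans hz
    have h2 := (Complex.abs_im_le_norm (z - s)).trans hz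
    rw [Complex.sub_re, abs_le] at h1
    rw [Complex.sub_im] at h2
    have h3 := abs_sub_abs_le_abs_sub z.im s.im
    have h4 := abs_sub_abs_le_abs_sub s.im z.im
    rw [abs_sub_comm] at h4
    refine ⟨?_, ?_, ?_, ?_⟩ <;> linarith
  have hdiff : DifferentiableOn ℂ riemannZeta (Metric.closedBall s (1 / 64)) := by
    intro z hz
    refine (differentiableAt_riemannZeta ?_).differentiableWithinAt
    rintro rfl
    have := (hball 1 hz).2.2.1
    norm_num at this
  have := Complex.norm_deriv_le_of_forall_mem_sphere_norm_le (c := s) (R := 1 / 64)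
    (C := K * (2 * |s.im| ^ (1 / 16 : ℝ))) (by norm_num)
    (hdiff.diffContOnCl_ball subset_rfl)
    (by
      intro z hz
      obtain ⟨h1, h2, h3, h4⟩ := hball z (Metric.sphere_subset_closedBall hz)
      refine (hK z h1 h2 h3).trans ?_
      gcongr
      calc |z.im| ^ (1 / 16 : ℝ) ≤ (2 * |s.im|) ^ (1 / 16 : ℝ) := by gcongr
        _ = 2 ^ (1 / 16 : ℝ) * |s.im| ^ (1 / 16 : ℝ) :=
          Real.mul_rpow (by norm_num) (by positivity)
        _ ≤ 2 ^ (1 : ℝ) * |s.im| ^ (1 / 16 : ℝ) := by gcongr <;> norm_num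
        _ = _ := by norm_num)
  refine this.trans (le_of_eq ?_)
  ring

/-! ### The reciprocal of the zeta function near the line of real part one -/

/-- The inequality `|ζ(1 + x)^3 ζ(1 + x + iy)^4 ζ(1 + x + 2iy)| ≥ 1`, with upper bounds for the
first and the last factor inserted. -/
theorem exists_le_norm_riemannZeta_pow_four :
    ∃ a : ℝ, 0 < a ∧ ∀ x y : ℝ, 0 < x → x ≤ 1 → 2 ≤ |y| →
      a * x ^ 3 / |y| ^ (1 / 16 : ℝ) ≤ ‖riemannZeta (1 + x + Complex.I * y)‖ ^ 4 := by
  obtain ⟨K, hK0, hK⟩ := exists_norm_riemannZeta_le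
  obtain ⟨K₁, hK₁⟩ := (isCompact_closedBall (1 : ℂ) 1).exists_bound_of_continuousOn
    differentiable_riemannZeta₁.continuous.continuousOn
  have hK₁1 : 1 ≤ K₁ := by simpa using hK₁ 1 (by simp)
  have hK₁0 : 0 < K₁ := by linarith
  refine ⟨(K₁ ^ 3 * (K * 2))⁻¹, by positivity, fun x y hx hx1 hy => ?_⟩
  have hT : 0 < |y| ^ (1 / 16 : ℝ) := Real.rpow_pos_of_pos (by linarith) _
  have h341 := DirichletCharacter.norm_LFunction_product_ge_one (N := 1) 1 hx y
  have htriv : DirichletCharacter.LFunctionTrivChar 1 = riemannZeta :=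
    DirichletCharacter.LFunction_modOne_eq
  rw [htriv, DirichletCharacter.LFunction_modOne_eq, DirichletCharacter.LFunction_modOne_eq,
    norm_mul, norm_mul, norm_pow, norm_pow] at h341
  have h1 : ‖riemannZeta (1 + x)‖ ≤ K₁ / x := by
    have hx0 : (x : ℂ) ≠ 0 := by exact_mod_cast hx.ne'
    rw [riemannZeta_eq_inv_sub_mul (by simpa using hx0), norm_mul, norm_inv, add_sub_cancel_left,
      Complex.norm_real, Real.norm_eq_abs, abs_of_pos hx, div_eq_inv_mul]
    gcongr
    refine hK₁ _ ?_
    simp [abs_of_pos hx, hx1]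
  have h2 : ‖riemannZeta (1 + x + 2 * Complex.I * y)‖ ≤ K * (2 * |y| ^ (1 / 16 : ℝ)) := by
    have him : (1 + x + 2 * Complex.I * y : ℂ).im = 2 * y := by simp
    have hre : (1 + x + 2 * Complex.I * y : ℂ).re = 1 + x := by simp
    refine (hK _ (by rw [hre]; linarith) (by rw [hre]; linarith)
      (by rw [him, abs_mul]; norm_num; linarith)).trans ?_
    rw [him, abs_mul, Real.mul_rpow (by positivity) (by positivity)]
    gcongr
    calc |(2 : ℝ)| ^ (1 / 16 : ℝ) ≤ 2 ^ (1 : ℝ) := by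
          rw [abs_two]
          gcongr <;> norm_num
      _ = 2 := by norm_num
  set Z := ‖riemannZeta (1 + x + Complex.I * y)‖ ^ 4
  have hZ : 0 ≤ Z := by positivity
  have h3 : 1 ≤ (K₁ / x) ^ 3 * Z * (K * (2 * |y| ^ (1 / 16 : ℝ))) := by
    refine le_trans h341 ?_
    gcongr
  rw [div_le_iff₀ hT, inv_mul_le_iff₀ (by positivity)]
  calc x ^ 3 = x ^ 3 * 1 := by ring
    _ ≤ x ^ 3 * ((K₁ / x) ^ 3 * Z * (K * (2 * |y| ^ (1 / 16 : ℝ)))) := by gcongr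
    _ = _ := by field_simp

/-- A lower bound for `ζ` to the right of `re s = 1`, with `T = |y|^{1/16}`. For
`x ≥ x₀ = κ ^ 4 / T ^ 5`, with a small constant `κ`, it is the 3-4-1 inequality; for smaller `x` the
mean value inequality compares with the point `x₀`. -/
theorem exists_le_norm_riemannZeta :
    ∃ c : ℝ, 0 < c ∧ ∀ x y : ℝ, 0 < x → x ≤ 1 → 2 ≤ |y| →
      c / (|y| ^ (1 / 16 : ℝ)) ^ 4 ≤ ‖riemannZeta (1 + x + Complex.I * y)‖ := by
  obtain ⟨a, ha, h4⟩ := exists_le_norm_riemannZeta_pow_four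
  obtain ⟨K, hK0, hK⟩ := exists_norm_deriv_riemannZeta_le
  set b : ℝ := a ^ (1 / 4 : ℝ) with hb
  have hb0 : 0 < b := Real.rpow_pos_of_pos ha _
  have hb4 : b ^ 4 = a := by
    rw [hb, ← Real.rpow_natCast, ← Real.rpow_mul ha.le]
    norm_num
  -- with this `κ`, the variation of `ζ` over a segment of length `κ ^ 4 / T ^ 5` is at most half
  -- of the lower bound at its right end
  set κ : ℝ := min 1 (b / (2 * K)) with hκ
  have hκ0 : 0 < κ := lt_min one_pos (by positivity)
  have hκ1 : κ ≤ 1 := min_le_left _ _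
  have hκK : K * κ ≤ b / 2 := by
    have : κ ≤ b / (2 * K) := min_le_right _ _
    rw [le_div_iff₀ (by positivity)] at this
    linarith
  refine ⟨b / 2 * κ ^ 3, by positivity, fun x y hx hx1 hy => ?_⟩
  set T : ℝ := |y| ^ (1 / 16 : ℝ) with hT
  have hT1 : 1 ≤ T := Real.one_le_rpow (by linarith) (by norm_num)
  have hT0 : 0 < T := by linarith
  set x₀ : ℝ := κ ^ 4 / T ^ 5 with hx₀
  have hx₀0 : 0 < x₀ := by positivity
  have hx₀1 : x₀ ≤ 1 := by
    rw [hx₀, div_le_one (by positivity)]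
    exact (pow_le_one₀ hκ0.le hκ1).trans (one_le_pow₀ hT1)
  have hlarge : ∀ x : ℝ, x₀ ≤ x → x ≤ 1 →
      b * κ ^ 3 / T ^ 4 ≤ ‖riemannZeta (1 + x + Complex.I * y)‖ := by
    intro x hx hx1
    refine le_of_pow_le_pow_left₀ (n := 4) (by norm_num) (norm_nonneg _) ?_
    refine le_trans ?_ (h4 x y (by linarith) hx1 hy)
    calc (b * κ ^ 3 / T ^ 4) ^ 4 = a * x₀ ^ 3 / T := by
          rw [hx₀, ← hb4]
          field_simp
      _ ≤ a * x ^ 3 / T := by gcongr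
  rcases le_total x₀ x with hxx | hxx
  · refine le_trans ?_ (hlarge x hxx hx1)
    gcongr
    linarith
  · have h5 := hlarge x₀ le_rfl hx₀1
    set S : Set ℂ := {z : ℂ | 1 ≤ z.re ∧ z.re ≤ 2 ∧ z.im = y} with hS
    have hSc : Convex ℝ S := by
      have e : S = ({z : ℂ | 1 ≤ z.re} ∩ {z : ℂ | z.re ≤ 2}) ∩ {z : ℂ | z.im = y} := by
        ext z
        simp [hS, and_assoc]
      rw [e]
      refine ((convex_halfSpace_re_ge 1).inter (convex_halfSpace_re_le 2)).inter ?_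
      exact convex_hyperplane Complex.imCLM.isLinear y
    have hmem : ∀ x : ℝ, 0 < x → x ≤ 1 → (1 + x + Complex.I * y : ℂ) ∈ S := by
      intro x hx hx1
      simp only [hS, Set.mem_ofPred_eq]
      refine ⟨?_, ?_, ?_⟩ <;> simp <;> linarith
    have h6 := Convex.norm_image_sub_le_of_norm_deriv_le (f := riemannZeta) (s := S)
      (C := K * T) (x := 1 + x + Complex.I * y) (y := 1 + x₀ + Complex.I * y)
      (by
        intro z hz
        refine differentiableAt_riemannZeta ?_
        rintro rfl
        have := hz.2.2
        rw [← this] at hy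
        norm_num at hy)
      (by
        intro z hz
        have := hK z hz.1 hz.2.1 (by rw [hz.2.2]; exact hy)
        rwa [hz.2.2] at this)
      hSc (hmem x hx hx1) (hmem x₀ hx₀0 hx₀1)
    have h7 : ‖(1 + x₀ + Complex.I * y : ℂ) - (1 + x + Complex.I * y)‖ ≤ x₀ := by
      have e : (1 + x₀ + Complex.I * y : ℂ) - (1 + x + Complex.I * y) = ((x₀ - x : ℝ) : ℂ) := by
        push_cast
        ring
      rw [e, Complex.norm_real, Real.norm_eq_abs, abs_of_nonneg (by linarith)]
      linarith
    have h8 := norm_sub_norm_le (riemannZeta (1 + x₀ + Complex.I * y))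
      (riemannZeta (1 + x + Complex.I * y))
    have h9 : K * T * ‖(1 + x₀ + Complex.I * y : ℂ) - (1 + x + Complex.I * y)‖
        ≤ b / 2 * κ ^ 3 / T ^ 4 := by
      calc _ ≤ K * T * x₀ := by gcongr
        _ = (K * κ) * κ ^ 3 / T ^ 4 := by
          rw [hx₀]
          field_simp
        _ ≤ _ := by gcongr
    have e : b * κ ^ 3 / T ^ 4 = b / 2 * κ ^ 3 / T ^ 4 + b / 2 * κ ^ 3 / T ^ 4 := by ring
    linarith

/-- The function `F(s) = 1 / (s² ζ(1 + s)) - 1 / s`, with its removable singularity at `0` filled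
in: it is the Laplace transform of the error term of `∑ μ(n) / n * log (x / n)`. -/
noncomputable def moebiusLaplace (s : ℂ) : ℂ :=
  dslope (fun s => (riemannZeta₁ (1 + s))⁻¹) 0 s

theorem riemannZeta₁_one_add {s : ℂ} (hs : s ≠ 0) :
    riemannZeta₁ (1 + s) = s * riemannZeta (1 + s) := by
  rw [riemannZeta_eq_inv_sub_mul (by simpa using hs), add_sub_cancel_left]
  field_simp

theorem moebiusLaplace_eq {s : ℂ} (hs : s ≠ 0) :
    moebiusLaplace s = ((s * riemannZeta (1 + s))⁻¹ - 1) / s := by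
  rw [moebiusLaplace, dslope_of_ne _ hs, slope_def_field, riemannZeta₁_one_add hs]
  simp

theorem riemannZeta₁_one_add_ne_zero {s : ℂ} (hs : 0 ≤ s.re) : riemannZeta₁ (1 + s) ≠ 0 := by
  rcases eq_or_ne s 0 with rfl | h0
  · simp
  · rw [riemannZeta₁_one_add h0]
    refine mul_ne_zero h0 (riemannZeta_ne_zero_of_one_le_re ?_)
    simpa using hs

theorem isOpen_riemannZeta₁_one_add_ne_zero : IsOpen {s : ℂ | riemannZeta₁ (1 + s) ≠ 0} :=
  isOpen_ne_fun (differentiable_riemannZeta₁.continuous.comp (by fun_prop)) continuous_const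

theorem differentiableOn_moebiusLaplace :
    DifferentiableOn ℂ moebiusLaplace {s | riemannZeta₁ (1 + s) ≠ 0} := by
  have ho := isOpen_riemannZeta₁_one_add_ne_zero
  refine (Complex.differentiableOn_dslope (ho.mem_nhds (by simp))).2 ?_
  intro s hs
  exact ((differentiable_riemannZeta₁.comp (by fun_prop : Differentiable ℂ fun s : ℂ => 1 + s)) s
    |>.inv hs).differentiableWithinAt

/-- `F - F'` is the Laplace transform of the error term multiplied by `1 + u`; this bound makes it
square integrable on vertical lines, uniformly in their distance from the imaginary axis. -/
theorem exists_norm_moebiusLaplace_sub_deriv_le :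
    ∃ K : ℝ, ∀ s : ℂ, 0 < s.re → s.re ≤ 1 →
      ‖moebiusLaplace s - deriv moebiusLaplace s‖ ≤ K / (1 + |s.im|) := by
  have ho := isOpen_riemannZeta₁_one_add_ne_zero
  obtain ⟨K₀, hK₀⟩ := ((isCompact_Icc (a := (0 : ℝ)) (b := 1)).reProdIm
    (isCompact_Icc (a := (-2 : ℝ)) (b := 2))).exists_bound_of_continuousOn
    (f := fun s => moebiusLaplace s - deriv moebiusLaplace s)
    ((differentiableOn_moebiusLaplace.sub
      (differentiableOn_moebiusLaplace.deriv ho)).continuousOn.mono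
      (fun s hs => riemannZeta₁_one_add_ne_zero hs.1.1))
  obtain ⟨c, hc0, hc⟩ := exists_le_norm_riemannZeta
  obtain ⟨K₁, hK₁0, hK₁⟩ := exists_norm_riemannZeta_le
  obtain ⟨K₂, hK₂0, hK₂⟩ := exists_norm_deriv_riemannZeta_le
  set K₃ : ℝ := c⁻¹ + 1 + ((K₁ + K₂) * c⁻¹ ^ 2 + c⁻¹ + 1) with hK₃
  have hK₃0 : 0 < K₃ := by positivity
  refine ⟨3 * |K₀| + 2 * K₃, fun s hs0 hs1 => ?_⟩
  have him : 0 ≤ |s.im| := abs_nonneg _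
  rcases le_total |s.im| 2 with h2 | h2
  · have := hK₀ s ⟨⟨hs0.le, hs1⟩, abs_le.1 h2⟩
    rw [le_div_iff₀ (by linarith)]
    have h3 := this.trans (le_abs_self K₀)
    have h4 : 0 ≤ |K₀| := abs_nonneg _
    nlinarith [norm_nonneg (moebiusLaplace s - deriv moebiusLaplace s)]
  · set t := |s.im| with ht
    set T : ℝ := t ^ (1 / 16 : ℝ) with hT
    have hT1 : 1 ≤ T := Real.one_le_rpow (by linarith) (by norm_num)
    have hT16 : T ^ 16 = t := by
      rw [hT, ← Real.rpow_natCast, ← Real.rpow_mul (by linarith)]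
      norm_num
    have hs : s ≠ 0 := by
      rintro rfl
      simp at hs0
    have hst : t ≤ ‖s‖ := Complex.abs_im_le_norm s
    have hspos : 0 < ‖s‖ := by linarith
    have hsT : T ^ 16 ≤ ‖s‖ := by rwa [hT16]
    have h1s : (1 + s : ℂ) = 1 + (s.re : ℂ) + Complex.I * (s.im : ℂ) := by
      conv_lhs => rw [← Complex.re_add_im s]
      ring
    have h1im : (1 + s : ℂ).im = s.im := by simp
    set z := riemannZeta (1 + s) with hz
    set w := deriv riemannZeta (1 + s) with hw
    have hzlow : c / T ^ 4 ≤ ‖z‖ := by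
      rw [hz, h1s]
      exact hc s.re s.im hs0 hs1 h2
    have hzpos : 0 < ‖z‖ := lt_of_lt_of_le (by positivity) hzlow
    have hz0 : z ≠ 0 := norm_pos_iff.1 hzpos
    have hzinv : ‖z‖⁻¹ ≤ c⁻¹ * T ^ 4 := by
      rw [inv_le_comm₀ hzpos (by positivity)]
      refine le_trans (le_of_eq ?_) hzlow
      field_simp
    have hzup : ‖z‖ ≤ K₁ * T := by
      have := hK₁ (1 + s) (by simp; linarith) (by simp; linarith) (by simp; linarith)
      rwa [h1im] at this
    have hwup : ‖w‖ ≤ K₂ * T := by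
      have := hK₂ (1 + s) (by simp; linarith) (by simp; linarith) (by simpa using h2)
      rwa [h1im] at this
    have hderiv : HasDerivAt moebiusLaplace
        ((-(z + s * w) / (s * z) ^ 2 * s - ((s * z)⁻¹ - 1)) / s ^ 2) s := by
      have hne : (1 + s : ℂ) ≠ 1 := by simpa using hs
      have h1 : HasDerivAt (fun s : ℂ => riemannZeta (1 + s)) w s := by
        have := (differentiableAt_riemannZeta hne).hasDerivAt.comp s
          ((hasDerivAt_id s).const_add 1)
        simpa using! this
      have h2 := ((hasDerivAt_id s).mul h1).inv (mul_ne_zero hs hz0)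
      have h3 := (h2.sub_const 1).div (hasDerivAt_id s) hs
      have h4 : HasDerivAt (fun s => ((s * riemannZeta (1 + s))⁻¹ - 1) / s)
          ((-(z + s * w) / (s * z) ^ 2 * s - ((s * z)⁻¹ - 1)) / s ^ 2) s := by
        refine h3.congr_deriv ?_
        simp [hz]
      refine h4.congr_of_eventuallyEq ?_
      filter_upwards [isOpen_ne.mem_nhds hs] with u hu
      exact moebiusLaplace_eq hu
    rw [hderiv.deriv, moebiusLaplace_eq hs]
    -- every term is `O(1 / ‖s‖)`, because `T ^ 16 ≤ ‖s‖`
    have hTp : ∀ k, k ≤ 16 → T ^ k ≤ ‖s‖ := fun k hk => (pow_le_pow_right₀ hT1 hk).trans hsT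
    have hs1' : 1 ≤ ‖s‖ := by linarith
    have hsz : ‖(s * z)⁻¹‖ ≤ c⁻¹ := by
      rw [norm_inv, norm_mul, mul_inv]
      calc ‖s‖⁻¹ * ‖z‖⁻¹ ≤ ‖s‖⁻¹ * (c⁻¹ * T ^ 4) := by gcongr
        _ ≤ ‖s‖⁻¹ * (c⁻¹ * ‖s‖) := by
          gcongr
          exact hTp 4 (by norm_num)
        _ = c⁻¹ := by field_simp
    have hA : ‖(s * z)⁻¹ - 1‖ ≤ c⁻¹ + 1 := (norm_sub_le _ _).trans (by simpa using hsz)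
    have hB : ‖-(z + s * w) / (s * z) ^ 2 * s‖ ≤ (K₁ + K₂) * c⁻¹ ^ 2 * ‖s‖ := by
      have e1 : ‖z + s * w‖ ≤ (K₁ + K₂) * T * ‖s‖ := by
        refine (norm_add_le _ _).trans ?_
        rw [norm_mul]
        calc ‖z‖ + ‖s‖ * ‖w‖ ≤ K₁ * T * ‖s‖ + ‖s‖ * (K₂ * T) := by
              gcongr
              exact hzup.trans (le_mul_of_one_le_right (by positivity) hs1')
          _ = _ := by ring
      rw [norm_mul, norm_div, norm_neg, norm_pow, norm_mul]
      calc ‖z + s * w‖ / (‖s‖ * ‖z‖) ^ 2 * ‖s‖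
          = ‖z + s * w‖ * ‖z‖⁻¹ ^ 2 * ‖s‖⁻¹ := by field_simp
        _ ≤ (K₁ + K₂) * T * ‖s‖ * (c⁻¹ * T ^ 4) ^ 2 * ‖s‖⁻¹ := by gcongr
        _ = (K₁ + K₂) * c⁻¹ ^ 2 * T ^ 9 := by field_simp
        _ ≤ _ := by
          gcongr
          exact hTp 9 (by norm_num)
    have hC : ‖(-(z + s * w) / (s * z) ^ 2 * s - ((s * z)⁻¹ - 1)) / s ^ 2‖
        ≤ ((K₁ + K₂) * c⁻¹ ^ 2 + c⁻¹ + 1) / ‖s‖ := by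
      rw [norm_div, norm_pow, div_le_div_iff₀ (by positivity) hspos]
      have e1 := (norm_sub_le (-(z + s * w) / (s * z) ^ 2 * s) ((s * z)⁻¹ - 1)).trans
        (add_le_add hB hA)
      have e2 : (K₁ + K₂) * c⁻¹ ^ 2 * ‖s‖ + (c⁻¹ + 1)
          ≤ ((K₁ + K₂) * c⁻¹ ^ 2 + c⁻¹ + 1) * ‖s‖ := by
        have : c⁻¹ + 1 ≤ (c⁻¹ + 1) * ‖s‖ := le_mul_of_one_le_right (by positivity) hs1'
        linarith
      calc _ ≤ (((K₁ + K₂) * c⁻¹ ^ 2 + c⁻¹ + 1) * ‖s‖) * ‖s‖ := by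
            gcongr
            exact e1.trans e2
        _ = _ := by ring
    have hD : ‖((s * z)⁻¹ - 1) / s‖ ≤ (c⁻¹ + 1) / ‖s‖ := by
      rw [norm_div]
      gcongr
    calc _ ≤ (c⁻¹ + 1) / ‖s‖ + ((K₁ + K₂) * c⁻¹ ^ 2 + c⁻¹ + 1) / ‖s‖ :=
          (norm_sub_le _ _).trans (add_le_add hD hC)
      _ = K₃ / ‖s‖ := by rw [← add_div]
      _ ≤ K₃ / t := by gcongr
      _ ≤ (3 * |K₀| + 2 * K₃) / (1 + t) := by
        rw [div_le_div_iff₀ (by linarith) (by linarith)]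
        have : 0 ≤ |K₀| := abs_nonneg _
        nlinarith

/-! ### A logarithmic mean of the Möbius function -/

open ArithmeticFunction in
theorem sum_moebius_mul_div {N : ℕ} (hN : 1 ≤ N) :
    ∑ n ∈ Finset.Ioc 0 N, (moebius n : ℝ) * ((N / n : ℕ) : ℝ) = 1 := by
  have h := sum_Ioc_mul_zeta_eq_sum (moebius) N
  rw [moebius_mul_coe_zeta] at h
  have h1 : ∑ n ∈ Finset.Ioc 0 N, (1 : ArithmeticFunction ℤ) n = 1 := by
    rw [Finset.sum_eq_single_of_mem 1 (by simp; omega)]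
    · simp
    · intro b _ hb
      exact one_apply_ne hb
  rw [h1] at h
  have h' := congrArg (Int.cast : ℤ → ℝ) h.symm
  simpa only [Int.cast_sum, Int.cast_mul, Int.cast_natCast, Int.cast_one] using h'

open ArithmeticFunction in
/-- The partial sums of `∑ μ(n) / n` are bounded by `1`. -/
theorem abs_sum_moebius_div_le_one (N : ℕ) :
    |∑ n ∈ Finset.Icc 1 N, (moebius n : ℝ) / n| ≤ 1 := by
  rcases Nat.eq_zero_or_pos N with rfl | hN
  · simp
  have hN0 : (0 : ℝ) < N := by exact_mod_cast hN
  have hI : Finset.Icc 1 N = Finset.Ioc 0 N := rfl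
  have hμ : ∀ n : ℕ, |(moebius n : ℝ)| ≤ 1 := fun n => by exact_mod_cast abs_moebius_le_one
  have h1 : N * ∑ n ∈ Finset.Icc 1 N, (moebius n : ℝ) / n
      = 1 + ∑ n ∈ Finset.Icc 1 N, (moebius n : ℝ) * ((N : ℝ) / n - ((N / n : ℕ) : ℝ)) := by
    rw [← sum_moebius_mul_div hN, hI, ← Finset.sum_add_distrib, Finset.mul_sum]
    refine Finset.sum_congr rfl fun n _ => ?_
    ring
  have h2 : |∑ n ∈ Finset.Icc 1 N, (moebius n : ℝ) * ((N : ℝ) / n - ((N / n : ℕ) : ℝ))|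
      ≤ N - 1 := by
    calc _ ≤ ∑ n ∈ Finset.Icc 1 N, |(moebius n : ℝ) * ((N : ℝ) / n - ((N / n : ℕ) : ℝ))| :=
          Finset.abs_sum_le_sum_abs _ _
      _ ≤ ∑ n ∈ Finset.Icc 1 N, if n = 1 then (0 : ℝ) else 1 := by
          refine Finset.sum_le_sum fun n hn => ?_
          split_ifs with h
          · simp [h]
          · have e1 : ((N / n : ℕ) : ℝ) ≤ (N : ℝ) / n := Nat.cast_div_le
            have e2 : (N : ℝ) / n < ((N / n : ℕ) : ℝ) + 1 := by
              rw [← Nat.floor_div_eq_div (K := ℝ)]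
              exact Nat.lt_floor_add_one _
            rw [abs_mul]
            have e3 : |(N : ℝ) / n - ((N / n : ℕ) : ℝ)| ≤ 1 := by
              rw [abs_le]
              constructor <;> linarith
            exact mul_le_one₀ (hμ n) (abs_nonneg _) e3
      _ = N - 1 := by
          rw [Finset.sum_ite, Finset.sum_const_zero, zero_add, Finset.sum_const, nsmul_eq_mul,
            mul_one, Finset.filter_not, Finset.card_sdiff_of_subset (Finset.filter_subset _ _),
            Finset.filter_eq', if_pos (by simp; omega)]
          simp [Nat.cast_sub hN]
  rw [← mul_le_mul_iff_right₀ hN0, ← abs_of_pos hN0, ← abs_mul, abs_of_pos hN0, h1]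
  refine (abs_add_le _ _).trans ?_
  rw [abs_one]
  linarith

/-- The sum `∑_{n ≤ x} μ(n) / n * log (x / n)`, which tends to `1`. -/
noncomputable def moebiusLogSum (x : ℝ) : ℝ :=
  ∑ n ∈ Finset.Icc 1 ⌊x⌋₊, (ArithmeticFunction.moebius n : ℝ) / n * Real.log (x / n)

/-- The error term `moebiusLogSum x - 1`. It is `-1`, not `0`, for `x < 1`. -/
noncomputable def moebiusLogError (x : ℝ) : ℝ := moebiusLogSum x - 1

theorem moebiusLogSum_of_lt_one {x : ℝ} (hx : x < 1) : moebiusLogSum x = 0 := by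
  have : ⌊x⌋₊ = 0 := Nat.floor_eq_zero.2 hx
  simp [moebiusLogSum, this]

theorem moebiusLogError_of_lt_one {x : ℝ} (hx : x < 1) : moebiusLogError x = -1 := by
  simp [moebiusLogError, moebiusLogSum_of_lt_one hx]

theorem moebiusLogSum_eq_sum_posLog {x : ℝ} (hx : 0 ≤ x) {N : ℕ} (hN : ⌊x⌋₊ ≤ N) :
    moebiusLogSum x =
      ∑ n ∈ Finset.Icc 1 N, (ArithmeticFunction.moebius n : ℝ) / n * Real.posLog (x / n) := by
  have h1 : ∀ n ∈ Finset.Icc 1 ⌊x⌋₊, Real.posLog (x / n) = Real.log (x / n) := by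
    intro n hn
    rw [Finset.mem_Icc] at hn
    have hn0 : (0 : ℝ) < n := by exact_mod_cast hn.1
    refine Real.posLog_eq_log ?_
    rw [abs_of_nonneg (by positivity), le_div_iff₀ hn0, one_mul]
    exact (Nat.le_floor_iff hx).1 hn.2
  rw [moebiusLogSum]
  calc _ = ∑ n ∈ Finset.Icc 1 ⌊x⌋₊,
        (ArithmeticFunction.moebius n : ℝ) / n * Real.posLog (x / n) :=
        Finset.sum_congr rfl fun n hn => by rw [h1 n hn]
    _ = _ := by
        refine Finset.sum_subset (Finset.Icc_subset_Icc le_rfl hN) fun n hn hn' => ?_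
        rw [Finset.mem_Icc] at hn hn'
        have hlt : ⌊x⌋₊ < n := by omega
        have hxn : x < n := (Nat.floor_lt hx).1 hlt
        have hn0 : (0 : ℝ) < n := by linarith
        rw [(Real.posLog_eq_zero_iff _).2, mul_zero]
        rw [abs_of_nonneg (by positivity), div_le_one hn0]
        exact hxn.le

theorem posLog_exp_div {n : ℕ} (hn : 1 ≤ n) (u : ℝ) :
    Real.posLog (Real.exp u / n) = max 0 (u - Real.log n) := by
  have hn0 : (0 : ℝ) < n := by exact_mod_cast hn
  change max 0 (Real.log (Real.exp u / n)) = _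
  rw [Real.log_div (by positivity) hn0.ne', Real.log_exp]

theorem moebiusLogSum_exp_eq {u : ℝ} {N : ℕ} (hN : ⌊Real.exp u⌋₊ ≤ N) :
    moebiusLogSum (Real.exp u) =
      ∑ n ∈ Finset.Icc 1 N,
        (ArithmeticFunction.moebius n : ℝ) / n * max 0 (u - Real.log n) := by
  rw [moebiusLogSum_eq_sum_posLog (Real.exp_pos u).le hN]
  refine Finset.sum_congr rfl fun n hn => ?_
  rw [posLog_exp_div (Finset.mem_Icc.1 hn).1]

theorem hasDerivWithinAt_max_zero_sub (l u : ℝ) :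
    HasDerivWithinAt (fun u => max 0 (u - l)) (if l ≤ u then 1 else 0) (Set.Ici u) u := by
  split_ifs with h
  · refine (((hasDerivAt_id u).sub_const l).hasDerivWithinAt (s := Set.Ici u)).congr_of_mem ?_
      Set.self_mem_Ici
    intro v hv
    have : u ≤ v := hv
    simp
    linarith
  · push Not at h
    refine HasDerivAt.hasDerivWithinAt ?_
    refine (hasDerivAt_const u (0 : ℝ)).congr_of_eventuallyEq ?_
    filter_upwards [Iio_mem_nhds h] with v hv
    rw [max_eq_left]
    have : v < l := hv
    linarith

/-- `moebiusLogSum` is `1`-Lipschitz in `log x`: its derivative is `∑_{n ≤ x} μ(n) / n`. -/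
theorem abs_moebiusLogSum_exp_sub_le (u v : ℝ) :
    |moebiusLogSum (Real.exp u) - moebiusLogSum (Real.exp v)| ≤ |u - v| := by
  wlog huv : u ≤ v generalizing u v
  · rw [abs_sub_comm, abs_sub_comm u]
    exact this v u (by linarith)
  set N := ⌊Real.exp v⌋₊ with hN
  have hmono : ∀ w ≤ v, ⌊Real.exp w⌋₊ ≤ N := fun w hw =>
    Nat.floor_mono (Real.exp_le_exp.2 hw)
  rw [moebiusLogSum_exp_eq (hmono u huv), moebiusLogSum_exp_eq (hmono v le_rfl)]
  have key := norm_image_sub_le_of_norm_deriv_right_le_segment (a := u) (b := v) (C := 1)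
    (f := fun w => ∑ n ∈ Finset.Icc 1 N,
      (ArithmeticFunction.moebius n : ℝ) / n * max 0 (w - Real.log n))
    (f' := fun w => ∑ n ∈ Finset.Icc 1 N,
      (ArithmeticFunction.moebius n : ℝ) / n * (if Real.log n ≤ w then 1 else 0))
    (by fun_prop)
    (fun w _ => HasDerivWithinAt.fun_sum fun n _ =>
      (hasDerivWithinAt_max_zero_sub (Real.log n) w).const_mul _)
    (by
      intro w hw
      have e : ∑ n ∈ Finset.Icc 1 N,
          (ArithmeticFunction.moebius n : ℝ) / n * (if Real.log n ≤ w then 1 else 0)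
          = ∑ n ∈ Finset.Icc 1 ⌊Real.exp w⌋₊, (ArithmeticFunction.moebius n : ℝ) / n := by
        simp_rw [mul_ite, mul_one, mul_zero]
        rw [← Finset.sum_filter]
        congr 1
        ext n
        simp only [Finset.mem_filter, Finset.mem_Icc]
        constructor
        · rintro ⟨⟨h1, h2⟩, h3⟩
          have hn0 : (0 : ℝ) < n := by exact_mod_cast h1
          exact ⟨h1, Nat.le_floor ((Real.log_le_iff_le_exp hn0).1 h3)⟩
        · rintro ⟨h1, h2⟩
          have hn0 : (0 : ℝ) < n := by exact_mod_cast h1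
          exact ⟨⟨h1, h2.trans (hmono w hw.2.le)⟩, (Real.log_le_iff_le_exp hn0).2
            ((Nat.le_floor_iff (Real.exp_pos w).le).1 h2)⟩
      rw [e]
      exact abs_sum_moebius_div_le_one _)
    v ⟨huv, le_rfl⟩
  rw [abs_sub_comm, abs_sub_comm u, abs_of_nonneg (by linarith : 0 ≤ v - u)]
  simpa using key

theorem continuous_moebiusLogSum_exp : Continuous fun u => moebiusLogSum (Real.exp u) := by
  refine (LipschitzWith.of_dist_le_mul (K := 1) fun u v => ?_).continuous
  simpa [Real.dist_eq] using abs_moebiusLogSum_exp_sub_le u v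

theorem continuous_moebiusLogError_exp : Continuous fun u => moebiusLogError (Real.exp u) :=
  continuous_moebiusLogSum_exp.sub continuous_const

theorem abs_moebiusLogError_exp_sub_le (u v : ℝ) :
    |moebiusLogError (Real.exp u) - moebiusLogError (Real.exp v)| ≤ |u - v| := by
  simpa [moebiusLogError] using abs_moebiusLogSum_exp_sub_le u v

theorem abs_moebiusLogError_exp_le {u : ℝ} (hu : 0 ≤ u) :
    |moebiusLogError (Real.exp u)| ≤ 1 + u := by
  have h1 : moebiusLogError (Real.exp 0) = -1 := by
    simp [moebiusLogError, moebiusLogSum]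
  have h2 := abs_moebiusLogError_exp_sub_le u 0
  rw [h1, sub_zero, abs_of_nonneg hu] at h2
  have h3 := abs_sub_abs_le_abs_sub (moebiusLogError (Real.exp u)) (-1)
  rw [abs_neg, abs_one] at h3
  linarith

theorem integrableOn_one_add_pow_mul_exp_neg (k : ℕ) {b : ℝ} (hb : 0 < b) :
    IntegrableOn (fun u : ℝ => (1 + u) ^ k * Real.exp (-(b * u))) (Set.Ioi 0) := by
  have h1 : ∀ j : ℕ, IntegrableOn (fun u : ℝ => u ^ j * Real.exp (-(b * u))) (Set.Ioi 0) := by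
    intro j
    have := integrableOn_rpow_mul_exp_neg_mul_rpow (p := 1) (s := j) (b := b)
      (by have : (0 : ℝ) ≤ j := by positivity
          linarith) one_pos hb
    refine this.congr_fun (fun u _ => ?_) measurableSet_Ioi
    simp
  have h2 : ∀ u : ℝ, (1 + u) ^ k * Real.exp (-(b * u)) =
      ∑ j ∈ Finset.range (k + 1), (k.choose j : ℝ) * (u ^ j * Real.exp (-(b * u))) := by
    intro u
    rw [add_comm, add_pow, Finset.sum_mul]
    refine Finset.sum_congr rfl fun j _ => ?_
    simp
    ring
  simp_rw [h2]
  exact integrable_finsetSum _ fun j _ => (h1 j).const_mul _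

theorem norm_exp_neg_mul (s : ℂ) (u : ℝ) :
    ‖Complex.exp (-(s * u))‖ = Real.exp (-(s.re * u)) := by
  rw [Complex.norm_exp]
  simp

theorem integral_mul_exp_neg_Ioi {s : ℂ} (hs : 0 < s.re) :
    IntegrableOn (fun u : ℝ => (u : ℂ) * Complex.exp (-(s * u))) (Set.Ioi 0) ∧
      ∫ u : ℝ in Set.Ioi 0, (u : ℂ) * Complex.exp (-(s * u)) = 1 / s ^ 2 := by
  have hs0 : s ≠ 0 := by
    rintro rfl
    simp at hs
  have hint : IntegrableOn (fun u : ℝ => (u : ℂ) * Complex.exp (-(s * u))) (Set.Ioi 0) := by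
    refine Integrable.mono' (integrableOn_one_add_pow_mul_exp_neg 1 hs)
      (by fun_prop) ?_
    refine (ae_restrict_iff' measurableSet_Ioi).2 (.of_forall fun u hu => ?_)
    have hu0 : (0 : ℝ) < u := hu
    rw [norm_mul, norm_exp_neg_mul, Complex.norm_real, Real.norm_eq_abs, abs_of_pos hu0, pow_one]
    gcongr
    linarith
  refine ⟨hint, ?_⟩
  have hlim : ∀ j : ℕ, Filter.Tendsto (fun u : ℝ => (u : ℂ) ^ j * Complex.exp (-(s * u)))
      Filter.atTop (nhds 0) := by
    intro j
    rw [tendsto_zero_iff_norm_tendsto_zero]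
    refine (tendsto_rpow_mul_exp_neg_mul_atTop_nhds_zero j s.re hs).congr' ?_
    filter_upwards [Filter.eventually_ge_atTop 0] with u hu
    rw [norm_mul, norm_exp_neg_mul, norm_pow, Complex.norm_real, Real.norm_eq_abs,
      abs_of_nonneg hu, neg_mul, Real.rpow_natCast]
  have := integral_Ioi_of_hasDerivAt_of_tendsto' (a := 0) (m := 0)
    (f := fun u : ℝ => -((u : ℂ) / s + 1 / s ^ 2) * Complex.exp (-(s * u)))
    (f' := fun u : ℝ => (u : ℂ) * Complex.exp (-(s * u)))
    (by
      intro u _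
      have h0 : HasDerivAt (fun u : ℝ => (u : ℂ)) 1 u := Complex.ofRealCLM.hasDerivAt
      have h1 := ((h0.div_const s).add_const (1 / s ^ 2)).neg
      have h2 := ((h0.const_mul s).neg).cexp
      refine (h1.mul h2).congr_deriv ?_
      simp only [Pi.neg_apply]
      field_simp
      ring)
    hint
    (by
      have h := (((hlim 1).const_mul (1 / s)).add ((hlim 0).const_mul (1 / s ^ 2))).neg
      simp only [mul_zero, add_zero, neg_zero] at h
      refine h.congr fun u => ?_
      ring)
  rw [this]
  simp

/-! ### An integrated bound for the error, through the Laplace transform -/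

theorem integral_max_zero_sub_mul_exp_neg (l : ℝ) {s : ℂ} (hs : 0 < s.re) :
    Integrable (fun u : ℝ => ((max 0 (u - l) : ℝ) : ℂ) * Complex.exp (-(s * u))) ∧
      ∫ u : ℝ, ((max 0 (u - l) : ℝ) : ℂ) * Complex.exp (-(s * u))
        = Complex.exp (-(s * l)) * (1 / s ^ 2) ∧
      ∫ u : ℝ, ‖((max 0 (u - l) : ℝ) : ℂ) * Complex.exp (-(s * u))‖
        = Real.exp (-(s.re * l)) * ∫ u : ℝ, ‖((max 0 u : ℝ) : ℂ) * Complex.exp (-(s * u))‖ := by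
  obtain ⟨h1, h2⟩ := integral_mul_exp_neg_Ioi hs
  have hind : (fun u : ℝ => ((max 0 u : ℝ) : ℂ) * Complex.exp (-(s * u)))
      = (Set.Ioi 0).indicator (fun u : ℝ => (u : ℂ) * Complex.exp (-(s * u))) := by
    ext u
    by_cases hu : (0 : ℝ) < u
    · rw [Set.indicator_of_mem (by exact hu), max_eq_right hu.le]
    · rw [Set.indicator_of_notMem (by exact hu), max_eq_left (by linarith)]
      simp
  have h3 : Integrable (fun u : ℝ => ((max 0 u : ℝ) : ℂ) * Complex.exp (-(s * u))) := by
    rw [hind]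
    exact h1.integrable_indicator measurableSet_Ioi
  have h4 : ∫ u : ℝ, ((max 0 u : ℝ) : ℂ) * Complex.exp (-(s * u)) = 1 / s ^ 2 := by
    rw [hind, integral_indicator measurableSet_Ioi, h2]
  have hsh : (fun u : ℝ => ((max 0 (u - l) : ℝ) : ℂ) * Complex.exp (-(s * u)))
      = fun u : ℝ => Complex.exp (-(s * l)) *
        (((max 0 (u - l) : ℝ) : ℂ) * Complex.exp (-(s * (u - l : ℝ)))) := by
    ext u
    have : Complex.exp (-(s * u)) = Complex.exp (-(s * l)) * Complex.exp (-(s * (u - l : ℝ))) := by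
      rw [← Complex.exp_add]
      push_cast
      congr 1
      ring
    rw [this]
    ring
  refine ⟨?_, ?_, ?_⟩
  · rw [hsh]
    exact (h3.comp_sub_right l).const_mul _
  · rw [hsh, integral_const_mul, integral_sub_right_eq_self
      (fun u : ℝ => ((max 0 u : ℝ) : ℂ) * Complex.exp (-(s * u))) l, h4]
  · simp_rw [congrFun hsh, norm_mul (Complex.exp (-(s * l)))]
    rw [integral_const_mul, integral_sub_right_eq_self
      (fun u : ℝ => ‖((max 0 u : ℝ) : ℂ) * Complex.exp (-(s * u))‖) l, norm_exp_neg_mul]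

open ArithmeticFunction in
theorem hasSum_moebius_cpow {s : ℂ} (hs : 0 < s.re) :
    HasSum (fun n : ℕ => (moebius n : ℂ) / n * Complex.exp (-(s * Real.log n)))
      (riemannZeta (1 + s))⁻¹ := by
  have h1 : 1 < (1 + s).re := by simpa using hs
  have h := (LSeriesSummable_moebius_iff.2 h1).LSeriesHasSum
  have hz := LSeries_zeta_mul_Lseries_moebius h1
  rw [LSeries_zeta_eq_riemannZeta h1] at hz
  rw [eq_inv_of_mul_eq_one_right hz] at h
  have e : (fun n : ℕ => (moebius n : ℂ) / n * Complex.exp (-(s * Real.log n)))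
      = LSeries.term (fun n => (moebius n : ℂ)) (1 + s) := by
    ext n
    rcases eq_or_ne n 0 with rfl | hn
    · simp
    · have hn0 : (n : ℂ) ≠ 0 := by exact_mod_cast hn
      rw [LSeries.term_of_ne_zero hn, Complex.cpow_add _ _ hn0, Complex.cpow_one,
        Complex.cpow_def_of_ne_zero hn0, Complex.exp_neg, Complex.ofReal_log (by positivity),
        Complex.ofReal_natCast, mul_comm s]
      field_simp
  rw [e]
  exact h

theorem tsum_moebius_mul_max_zero_sub (u : ℝ) :
    ∑' n : ℕ, (ArithmeticFunction.moebius n : ℂ) / n * ((max 0 (u - Real.log n) : ℝ) : ℂ)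
      = (moebiusLogSum (Real.exp u) : ℂ) := by
  rw [moebiusLogSum_exp_eq (u := u) le_rfl, tsum_eq_sum (s := Finset.Icc 1 ⌊Real.exp u⌋₊)]
  · push_cast
    rfl
  · intro n hn
    rcases Nat.eq_zero_or_pos n with rfl | hn0
    · simp
    · have h1 : ⌊Real.exp u⌋₊ < n := by
        rw [Finset.mem_Icc] at hn
        omega
      have h2 : Real.exp u < n := (Nat.floor_lt (Real.exp_pos u).le).1 h1
      rw [max_eq_left, Complex.ofReal_zero, mul_zero]
      have := Real.log_le_log (Real.exp_pos u) h2.le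
      rw [Real.log_exp] at this
      linarith

/-- The Laplace transform of `u ↦ moebiusLogSum (exp u)`. -/
theorem integral_moebiusLogSum_exp {s : ℂ} (hs : 0 < s.re) :
    ∫ u : ℝ in Set.Ioi 0, (moebiusLogSum (Real.exp u) : ℂ) * Complex.exp (-(s * u))
      = (riemannZeta (1 + s))⁻¹ * (1 / s ^ 2) := by
  set F : ℕ → ℝ → ℂ := fun n u => ((ArithmeticFunction.moebius n : ℂ) / n) *
    (((max 0 (u - Real.log n) : ℝ) : ℂ) * Complex.exp (-(s * u))) with hF
  have h1 : ∀ n, Integrable (F n) := fun n =>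
    (integral_max_zero_sub_mul_exp_neg (Real.log n) hs).1.const_mul _
  have h2 : Summable fun n => ∫ u, ‖F n u‖ := by
    have h := (hasSum_moebius_cpow hs).summable.norm.mul_right
      (∫ u : ℝ, ‖((max 0 u : ℝ) : ℂ) * Complex.exp (-(s * u))‖)
    refine h.congr fun n => ?_
    simp_rw [hF, norm_mul ((ArithmeticFunction.moebius n : ℂ) / n)]
    rw [integral_const_mul, (integral_max_zero_sub_mul_exp_neg (Real.log n) hs).2.2,
      norm_exp_neg_mul, mul_assoc]
  have h3 := hasSum_integral_of_summable_integral_norm h1 h2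
  have h4 : ∀ u, ∑' n, F n u = (moebiusLogSum (Real.exp u) : ℂ) * Complex.exp (-(s * u)) := by
    intro u
    rw [← tsum_moebius_mul_max_zero_sub, ← tsum_mul_right]
    exact tsum_congr fun n => by simp only [hF, mul_assoc]
  simp_rw [h4] at h3
  have h5 : ∀ n, ∫ u, F n u = (ArithmeticFunction.moebius n : ℂ) / n *
      Complex.exp (-(s * Real.log n)) * (1 / s ^ 2) := by
    intro n
    simp_rw [hF]
    rw [integral_const_mul, (integral_max_zero_sub_mul_exp_neg (Real.log n) hs).2.1, mul_assoc]
  simp_rw [h5] at h3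
  rw [setIntegral_eq_integral_of_forall_compl_eq_zero]
  · exact h3.unique ((hasSum_moebius_cpow hs).mul_right _)
  · intro u hu
    have hu' : ¬ (0 : ℝ) < u := hu
    rcases (not_lt.1 hu').lt_or_eq with h | h
    · rw [moebiusLogSum_of_lt_one (by simpa using h)]
      simp
    · rw [h]
      simp [moebiusLogSum]

theorem norm_moebiusLogError_mul_exp_le (s : ℂ) {u : ℝ} (hu : 0 ≤ u) :
    ‖(moebiusLogError (Real.exp u) : ℂ) * Complex.exp (-(s * u))‖
      ≤ (1 + u) * Real.exp (-(s.re * u)) := by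
  rw [norm_mul, norm_exp_neg_mul, Complex.norm_real, Real.norm_eq_abs]
  gcongr
  exact abs_moebiusLogError_exp_le hu

theorem integrableOn_moebiusLogError_mul_exp (k : ℕ) {s : ℂ} (hs : 0 < s.re) :
    IntegrableOn (fun u : ℝ => (1 + u : ℂ) ^ k *
      ((moebiusLogError (Real.exp u) : ℂ) * Complex.exp (-(s * u)))) (Set.Ioi 0) := by
  refine Integrable.mono' (integrableOn_one_add_pow_mul_exp_neg (k + 1) hs) ?_ ?_
  · have := continuous_moebiusLogError_exp
    exact Continuous.aestronglyMeasurable (by fun_prop)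
  · refine (ae_restrict_iff' measurableSet_Ioi).2 (.of_forall fun u hu => ?_)
    have hu0 : (0 : ℝ) < u := hu
    have e : ‖(1 + u : ℂ)‖ = 1 + u := by
      rw [← Complex.ofReal_one, ← Complex.ofReal_add, Complex.norm_real, Real.norm_eq_abs,
        abs_of_pos (by linarith)]
    rw [norm_mul, norm_pow, e, pow_succ, mul_assoc]
    gcongr
    exact norm_moebiusLogError_mul_exp_le s hu0.le

/-- The Laplace transform of the error term. -/
theorem integral_moebiusLogError_exp {s : ℂ} (hs : 0 < s.re) :
    ∫ u : ℝ in Set.Ioi 0, (moebiusLogError (Real.exp u) : ℂ) * Complex.exp (-(s * u))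
      = moebiusLaplace s := by
  have hs0 : s ≠ 0 := by
    rintro rfl
    simp at hs
  have hz : riemannZeta (1 + s) ≠ 0 := riemannZeta_ne_zero_of_one_le_re (by simpa using hs.le)
  have h1 : ∫ u : ℝ in Set.Ioi 0, Complex.exp (-(s * u)) = 1 / s := by
    have := integral_exp_mul_complex_Ioi (a := -s) (by simpa using hs) 0
    simp only [neg_mul] at this
    rw [this]
    simp
  have h2 : IntegrableOn (fun u : ℝ => Complex.exp (-(s * u))) (Set.Ioi 0) := by
    have := integrableOn_exp_mul_complex_Ioi (a := -s) (by simpa using hs) 0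
    simpa only [neg_mul] using this
  have h3 := integrableOn_moebiusLogError_mul_exp 0 hs
  simp only [pow_zero, one_mul] at h3
  have h4 := integral_moebiusLogSum_exp hs
  have h5 : ∀ u : ℝ, (moebiusLogSum (Real.exp u) : ℂ) * Complex.exp (-(s * u)) =
      (moebiusLogError (Real.exp u) : ℂ) * Complex.exp (-(s * u)) + Complex.exp (-(s * u)) := by
    intro u
    simp only [moebiusLogError]
    push_cast
    ring
  simp_rw [h5] at h4
  rw [integral_add h3 h2, h1] at h4
  rw [eq_sub_of_add_eq h4, moebiusLaplace_eq hs0]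
  field_simp

theorem hasDerivAt_moebiusLaplace {s : ℂ} (hs : 0 < s.re) :
    HasDerivAt moebiusLaplace
      (∫ u : ℝ in Set.Ioi 0, -(u : ℂ) *
        ((moebiusLogError (Real.exp u) : ℂ) * Complex.exp (-(s * u)))) s := by
  have hcont := continuous_moebiusLogError_exp
  have ho : IsOpen {z : ℂ | s.re / 2 < z.re} := isOpen_lt continuous_const Complex.continuous_re
  have hmem : s ∈ {z : ℂ | s.re / 2 < z.re} := by
    change s.re / 2 < s.re
    linarith
  have h := hasDerivAt_integral_of_dominated_loc_of_deriv_le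
    (μ := volume.restrict (Set.Ioi 0)) (s := {z : ℂ | s.re / 2 < z.re}) (x₀ := s)
    (F := fun z u => (moebiusLogError (Real.exp u) : ℂ) * Complex.exp (-(z * u)))
    (F' := fun z u => -(u : ℂ) * ((moebiusLogError (Real.exp u) : ℂ) * Complex.exp (-(z * u))))
    (bound := fun u => (1 + u) ^ 2 * Real.exp (-(s.re / 2 * u)))
    (ho.mem_nhds hmem)
    (.of_forall fun z => Continuous.aestronglyMeasurable (by fun_prop))
    (by simpa using! integrableOn_moebiusLogError_mul_exp 0 hs)
    (Continuous.aestronglyMeasurable (by fun_prop))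
    ((ae_restrict_iff' measurableSet_Ioi).2 (.of_forall fun u hu z hz => by
      have hu0 : (0 : ℝ) < u := hu
      have hz' : s.re / 2 < z.re := hz
      rw [norm_mul, norm_neg, Complex.norm_real, Real.norm_eq_abs, abs_of_pos hu0, sq, mul_assoc]
      gcongr
      · linarith
      · refine (norm_moebiusLogError_mul_exp_le z hu0.le).trans ?_
        gcongr))
    (integrableOn_one_add_pow_mul_exp_neg 2 (by linarith))
    (.of_forall fun u z _ => by
      have h1 := (((hasDerivAt_id z).mul_const (u : ℂ)).neg).cexp.const_mul
        (moebiusLogError (Real.exp u) : ℂ)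
      refine h1.congr_deriv ?_
      simp
      ring)
  refine h.2.congr_of_eventuallyEq ?_
  filter_upwards [ho.mem_nhds hmem] with z hz
  have hz' : s.re / 2 < z.re := hz
  rw [integral_moebiusLogError_exp (by linarith)]

/-- The damped error term `(1 + u) E(exp u) exp (-σ u)` on `(0, ∞)`, with `E = moebiusLogError`. Its
Fourier transform is a restriction of `F - F'` to a vertical line, for `F = moebiusLaplace`. -/
noncomputable def dampedError (σ : ℝ) : ℝ → ℂ :=
  (Set.Ioi 0).indicator fun u =>
    (1 + u : ℂ) * ((moebiusLogError (Real.exp u) : ℂ) * Complex.exp (-(σ * u)))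

open scoped FourierTransform in
theorem fourier_dampedError {σ : ℝ} (hσ : 0 < σ) (ξ : ℝ) :
    𝓕 (dampedError σ) ξ = moebiusLaplace (σ + 2 * Real.pi * ξ * Complex.I) -
      deriv moebiusLaplace (σ + 2 * Real.pi * ξ * Complex.I) := by
  set s : ℂ := σ + 2 * Real.pi * ξ * Complex.I with hs
  have hre : 0 < s.re := by simpa [hs] using hσ
  rw [(hasDerivAt_moebiusLaplace hre).deriv, ← integral_moebiusLogError_exp hre, ← integral_sub,
    Real.fourier_real_eq_integral_exp_smul, ← integral_indicator measurableSet_Ioi]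
  · congr 1
    ext u
    by_cases hu : u ∈ Set.Ioi (0 : ℝ)
    · rw [dampedError, Set.indicator_of_mem hu, Set.indicator_of_mem hu, smul_eq_mul]
      have : Complex.exp (-(s * u)) = Complex.exp (-(σ * u)) *
          Complex.exp (((-2 * Real.pi * u * ξ : ℝ) : ℂ) * Complex.I) := by
        rw [← Complex.exp_add, hs]
        congr 1
        push_cast
        ring
      rw [this]
      ring
    · rw [dampedError, Set.indicator_of_notMem hu, Set.indicator_of_notMem hu, smul_zero]
  · simpa using! integrableOn_moebiusLogError_mul_exp 0 hre
  · have := (integrableOn_moebiusLogError_mul_exp 0 hre).sub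
      (integrableOn_moebiusLogError_mul_exp 1 hre)
    refine this.congr (.of_forall fun u => ?_)
    simp
    ring

theorem norm_dampedError {σ : ℝ} {u : ℝ} (hu : 0 < u) :
    ‖dampedError σ u‖ = (1 + u) * |moebiusLogError (Real.exp u)| * Real.exp (-(σ * u)) := by
  have e : ‖(1 + u : ℂ)‖ = 1 + u := by
    rw [← Complex.ofReal_one, ← Complex.ofReal_add, Complex.norm_real, Real.norm_eq_abs,
      abs_of_pos (by linarith)]
  rw [dampedError, Set.indicator_of_mem (by exact hu), norm_mul, norm_mul, norm_exp_neg_mul, e,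
    Complex.norm_real, Real.norm_eq_abs, Complex.ofReal_re, mul_assoc]

theorem integrable_dampedError {σ : ℝ} (hσ : 0 < σ) : Integrable (dampedError σ) := by
  have := integrableOn_moebiusLogError_mul_exp 1 (s := σ) (by simpa using hσ)
  rw [dampedError, integrable_indicator_iff measurableSet_Ioi]
  simpa using! this

theorem memLp_two_dampedError {σ : ℝ} (hσ : 0 < σ) : MemLp (dampedError σ) 2 := by
  rw [memLp_two_iff_integrable_sq_norm (integrable_dampedError hσ).1]
  have h : IntegrableOn (fun u => ‖dampedError σ u‖ ^ 2) (Set.Ioi 0) := by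
    refine Integrable.mono' (integrableOn_one_add_pow_mul_exp_neg 4
      (by linarith : 0 < 2 * σ)) ((integrable_dampedError hσ).1.norm.pow 2).restrict ?_
    refine (ae_restrict_iff' measurableSet_Ioi).2 (.of_forall fun u hu => ?_)
    have hu0 : (0 : ℝ) < u := hu
    rw [norm_dampedError hu0, Real.norm_eq_abs, abs_of_nonneg (by positivity)]
    calc ((1 + u) * |moebiusLogError (Real.exp u)| * Real.exp (-(σ * u))) ^ 2
        ≤ ((1 + u) * (1 + u) * Real.exp (-(σ * u))) ^ 2 := by
          gcongr
          exact abs_moebiusLogError_exp_le hu0.le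
      _ = (1 + u) ^ 4 * Real.exp (-(2 * σ * u)) := by
          rw [mul_pow, ← Real.exp_nat_mul]
          congr 1
          · ring
          · congr 1
            push_cast
            ring
  refine (integrableOn_iff_integrable_of_support_subset ?_).1 h
  intro u hu
  by_contra hu'
  refine hu ?_
  simp [dampedError, Set.indicator_of_notMem hu']

open scoped FourierTransform in
/-- The damped error terms are bounded in `L²`, uniformly in the damping. -/
theorem exists_integral_norm_sq_dampedError_le :
    ∃ K : ℝ, ∀ σ : ℝ, 0 < σ → σ ≤ 1 → ∫ u, ‖dampedError σ u‖ ^ 2 ≤ K := by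
  obtain ⟨K, hK⟩ := exists_norm_moebiusLaplace_sub_deriv_le
  have hint : Integrable (fun ξ : ℝ => K ^ 2 * (1 + ‖ξ‖) ^ (-2 : ℝ)) :=
    (integrable_one_add_norm (by simp)).const_mul _
  refine ⟨∫ ξ : ℝ, K ^ 2 * (1 + ‖ξ‖) ^ (-2 : ℝ), fun σ hσ hσ1 => ?_⟩
  have hbound : ∀ ξ : ℝ, ‖𝓕 (dampedError σ) ξ‖ ^ 2 ≤ K ^ 2 * (1 + ‖ξ‖) ^ (-2 : ℝ) := by
    intro ξ
    rw [fourier_dampedError hσ]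
    set s : ℂ := σ + 2 * Real.pi * ξ * Complex.I with hs
    have hre : s.re = σ := by simp [hs]
    have him : s.im = 2 * Real.pi * ξ := by simp [hs]
    have h1 := hK s (by rw [hre]; exact hσ) (by rw [hre]; exact hσ1)
    have hK0 : 0 ≤ K := by
      have h2 := (norm_nonneg _).trans h1
      have h3 : 0 < 1 + |s.im| := by positivity
      rw [le_div_iff₀ h3] at h2
      linarith
    have h2 : |ξ| ≤ |s.im| := by
      rw [him, abs_mul]
      refine le_mul_of_one_le_left (abs_nonneg _) ?_
      rw [abs_of_pos (by positivity)]
      linarith [Real.pi_gt_three]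
    have h3 : K / (1 + |s.im|) ≤ K / (1 + |ξ|) := by gcongr
    calc _ ≤ (K / (1 + |ξ|)) ^ 2 := by
          gcongr
          exact h1.trans h3
      _ = _ := by
          rw [Real.rpow_neg (by positivity), Real.norm_eq_abs, div_pow, div_eq_mul_inv]
          norm_num
  have hcont : Continuous (𝓕 (dampedError σ)) :=
    VectorFourier.fourierIntegral_continuous Real.continuous_fourierChar
      (by exact continuous_inner) (integrable_dampedError hσ)
  have hF : MemLp (𝓕 (dampedError σ)) 2 := by
    rw [memLp_two_iff_integrable_sq_norm hcont.aestronglyMeasurable]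
    refine hint.mono' (by fun_prop) (.of_forall fun ξ => ?_)
    rw [Real.norm_eq_abs, abs_of_nonneg (by positivity)]
    exact hbound ξ
  refine (integral_norm_sq_le_integral_norm_sq_fourier (integrable_dampedError hσ)
    (memLp_two_dampedError hσ) hF).trans ?_
  refine integral_mono ?_ hint hbound
  exact (memLp_two_iff_integrable_sq_norm hcont.aestronglyMeasurable).1 hF

/-- The error term is integrable on the logarithmic scale. This is the only input from the theory
of `ζ`, and a quantitative form of the prime number theorem. It follows from the `L²` bound with the
extra factor `1 + u`, by `2 |E| ≤ 1 / (1 + u)² + ((1 + u) |E|)²`. -/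
theorem exists_integral_abs_moebiusLogError_le :
    ∃ C : ℝ, ∀ U : ℝ, 0 ≤ U → ∫ u in (0)..U, |moebiusLogError (Real.exp u)| ≤ C := by
  obtain ⟨K, hK⟩ := exists_integral_norm_sq_dampedError_le
  have hE := continuous_moebiusLogError_exp
  have hmain : ∀ U : ℝ, 1 ≤ U →
      ∫ u in (0)..U, |moebiusLogError (Real.exp u)| ≤ (1 + Real.exp 2 * K) / 2 := by
    intro U hU
    have hU0 : 0 < U := by linarith
    -- on `[0, U]` a damping by `σ = 1 / U` costs only a constant factor
    have h1 : ∫ u in (0)..U, ((1 + u) * |moebiusLogError (Real.exp u)|) ^ 2 ≤ Real.exp 2 * K := by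
      have hsq := (memLp_two_iff_integrable_sq_norm (integrable_dampedError
        (by positivity : 0 < U⁻¹)).1).1 (memLp_two_dampedError (by positivity))
      calc ∫ u in (0)..U, ((1 + u) * |moebiusLogError (Real.exp u)|) ^ 2
          ≤ ∫ u in (0)..U, Real.exp 2 * ‖dampedError U⁻¹ u‖ ^ 2 := by
            refine intervalIntegral.integral_mono_on_of_le_Ioo hU0.le
              (Continuous.intervalIntegrable (by fun_prop) _ _)
              (hsq.const_mul _).intervalIntegrable ?_
            intro u hu
            rw [norm_dampedError hu.1]
            have h2 : 1 ≤ Real.exp 2 * Real.exp (-(U⁻¹ * u)) ^ 2 := by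
              rw [← Real.exp_nat_mul, ← Real.exp_add, Real.one_le_exp_iff]
              have : U⁻¹ * u ≤ 1 := by
                rw [inv_mul_le_iff₀ hU0]
                linarith [hu.2]
              push_cast
              linarith
            calc ((1 + u) * |moebiusLogError (Real.exp u)|) ^ 2
                = ((1 + u) * |moebiusLogError (Real.exp u)|) ^ 2 * 1 := by ring
              _ ≤ ((1 + u) * |moebiusLogError (Real.exp u)|) ^ 2 *
                  (Real.exp 2 * Real.exp (-(U⁻¹ * u)) ^ 2) := by gcongr
              _ = _ := by ring
        _ = Real.exp 2 * ∫ u in (0)..U, ‖dampedError U⁻¹ u‖ ^ 2 :=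
            intervalIntegral.integral_const_mul _ _
        _ ≤ Real.exp 2 * ∫ u, ‖dampedError U⁻¹ u‖ ^ 2 := by
            gcongr
            rw [intervalIntegral.integral_of_le hU0.le]
            exact setIntegral_le_integral hsq (.of_forall fun u => by positivity)
        _ ≤ Real.exp 2 * K := by
            gcongr
            exact hK _ (by positivity) (inv_le_one_of_one_le₀ hU)
    have hpos : ∀ u ∈ Set.uIcc 0 U, 0 < 1 + u := by
      intro u hu
      rw [Set.uIcc_of_le hU0.le] at hu
      linarith [hu.1]
    have h3 : ∫ u in (0)..U, ((1 + u) ^ 2)⁻¹ ≤ 1 := by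
      have hd : ∀ u ∈ Set.uIcc 0 U, HasDerivAt (fun u : ℝ => -(1 + u)⁻¹) ((1 + u) ^ 2)⁻¹ u := by
        intro u hu
        have := (((hasDerivAt_id u).const_add 1).inv (hpos u hu).ne').neg
        refine this.congr_deriv ?_
        simp [neg_div]
      rw [intervalIntegral.integral_eq_sub_of_hasDerivAt hd]
      · have : 0 < (1 + U)⁻¹ := by positivity
        simp
        linarith
      · refine ContinuousOn.intervalIntegrable ?_
        refine ContinuousOn.inv₀ (by fun_prop) fun u hu => ?_
        have := hpos u hu
        positivity
    have hi1 : IntervalIntegrable (fun u : ℝ => ((1 + u) ^ 2)⁻¹) volume 0 U := by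
      refine ContinuousOn.intervalIntegrable ?_
      refine ContinuousOn.inv₀ (by fun_prop) fun u hu => ?_
      have := hpos u hu
      positivity
    have hi2 : IntervalIntegrable
        (fun u : ℝ => ((1 + u) * |moebiusLogError (Real.exp u)|) ^ 2) volume 0 U :=
      Continuous.intervalIntegrable (by fun_prop) _ _
    calc ∫ u in (0)..U, |moebiusLogError (Real.exp u)|
        ≤ ∫ u in (0)..U, (((1 + u) ^ 2)⁻¹ +
            ((1 + u) * |moebiusLogError (Real.exp u)|) ^ 2) * (1 / 2) := by
          refine intervalIntegral.integral_mono_on hU0.le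
            (Continuous.intervalIntegrable (by fun_prop) _ _) ((hi1.add hi2).mul_const _) ?_
          intro u hu
          have hp := hpos u (by rwa [Set.uIcc_of_le hU0.le])
          have h4 := two_mul_le_add_sq (1 + u)⁻¹ ((1 + u) * |moebiusLogError (Real.exp u)|)
          have h5 : 2 * (1 + u)⁻¹ * ((1 + u) * |moebiusLogError (Real.exp u)|)
              = 2 * |moebiusLogError (Real.exp u)| := by field_simp
          rw [h5, inv_pow] at h4
          linarith
      _ = ((∫ u in (0)..U, ((1 + u) ^ 2)⁻¹) +
            ∫ u in (0)..U, ((1 + u) * |moebiusLogError (Real.exp u)|) ^ 2) * (1 / 2) := by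
          rw [intervalIntegral.integral_mul_const, intervalIntegral.integral_add hi1 hi2]
      _ ≤ _ := by linarith
  refine ⟨(1 + Real.exp 2 * K) / 2, fun U hU => ?_⟩
  refine le_trans ?_ (hmain (max U 1) (le_max_right _ _))
  refine intervalIntegral.integral_mono_interval le_rfl hU (le_max_left _ _)
    (.of_forall fun u => abs_nonneg _) (Continuous.intervalIntegrable (by fun_prop) _ _)

/-! ### Pointwise bounds for the error and sums over integers with small squarefree divisors -/

/-- A function that is Lipschitz and integrable on the logarithmic scale is bounded. -/
theorem exists_abs_moebiusLogError_le : ∃ C : ℝ, 1 ≤ C ∧ ∀ x : ℝ, |moebiusLogError x| ≤ C := by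
  obtain ⟨C, hC⟩ := exists_integral_abs_moebiusLogError_le
  have hE := continuous_moebiusLogError_exp
  have hC0 : 0 ≤ C := by simpa using hC 0 le_rfl
  refine ⟨C + 1, by linarith, fun x => ?_⟩
  rcases lt_or_ge x 1 with hx | hx
  · rw [moebiusLogError_of_lt_one hx, abs_neg, abs_one]
    linarith
  · set u := Real.log x with hu
    have hu0 : 0 ≤ u := Real.log_nonneg hx
    have hxu : x = Real.exp u := (Real.exp_log (by linarith)).symm
    rw [hxu]
    have hint : ∀ a b : ℝ, IntervalIntegrable (fun v => |moebiusLogError (Real.exp v)|)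
        volume a b := fun a b => Continuous.intervalIntegrable (by fun_prop) _ _
    have h1 : ∫ v in u..(u + 1), (|moebiusLogError (Real.exp u)| - 1) ≤
        ∫ v in u..(u + 1), |moebiusLogError (Real.exp v)| := by
      refine intervalIntegral.integral_mono_on (by linarith) (by simp) (hint _ _) fun v hv => ?_
      have h2 := abs_moebiusLogError_exp_sub_le u v
      have h3 := abs_sub_abs_le_abs_sub (moebiusLogError (Real.exp u))
        (moebiusLogError (Real.exp v))
      have h4 : |u - v| ≤ 1 := by
        rw [abs_le]
        constructor <;> linarith [hv.1, hv.2]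
      linarith
    have h2 : ∫ v in u..(u + 1), |moebiusLogError (Real.exp v)| ≤
        ∫ v in (0)..(u + 1), |moebiusLogError (Real.exp v)| :=
      intervalIntegral.integral_mono_interval hu0 (by linarith) le_rfl
        (.of_forall fun u => abs_nonneg _) (hint _ _)
    have h3 := hC (u + 1) (by linarith)
    simp only [intervalIntegral.integral_const, add_sub_cancel_left, one_smul] at h1
    linarith

/-- The sum is compared with an integral: the term at `n = k + 1` with the integral of `|E(exp v)|`
over `[log (z / (k + 1)), log (z / k)]`, with an error of at most `1 / k²` as `E(exp v)` is
Lipschitz. -/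
theorem sum_inv_mul_abs_moebiusLogError_le {C : ℝ} (hC : ∀ x : ℝ, |moebiusLogError x| ≤ C)
    {z : ℝ} {N : ℕ} (hN : 1 ≤ N) (hz : (N : ℝ) ≤ z) :
    ∑ n ∈ Finset.Icc 1 N, (n : ℝ)⁻¹ * |moebiusLogError (z / n)| ≤
      C + (∫ v in (Real.log z - Real.log N)..(Real.log z), |moebiusLogError (Real.exp v)|)
        + ∑ k ∈ Finset.range N, ((k : ℝ) ^ 2)⁻¹ := by
  have hE := continuous_moebiusLogError_exp
  have hint : ∀ a b : ℝ, IntervalIntegrable (fun v => |moebiusLogError (Real.exp v)|)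
    volume a b := fun a b => Continuous.intervalIntegrable (by fun_prop) _ _
  have hN' : (1 : ℝ) ≤ N := by exact_mod_cast hN
  have hz0 : 0 < z := by linarith
  induction N, hN using Nat.le_induction with
  | base => simpa using hC z
  | succ k hk ih =>
    have hk0 : (0 : ℝ) < k := by exact_mod_cast hk
    push_cast at hz ⊢
    have ih := ih (by linarith) (by exact_mod_cast hk)
    rw [Finset.sum_Icc_succ_top (by omega), Finset.sum_range_succ]
    push_cast
    set x := Real.log z
    set a := x - Real.log ((k : ℝ) + 1) with ha
    set b := x - Real.log k with hb
    have hab : b - a ≤ (k : ℝ)⁻¹ := by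
      have h1 := Real.log_le_sub_one_of_pos (show (0 : ℝ) < ((k : ℝ) + 1) / k by positivity)
      rw [Real.log_div (by positivity) (by positivity)] at h1
      have h2 : ((k : ℝ) + 1) / k - 1 = (k : ℝ)⁻¹ := by field_simp; ring
      rw [ha, hb]
      linarith
    have hab' : ((k : ℝ) + 1)⁻¹ ≤ b - a := by
      have h1 := Real.log_le_sub_one_of_pos (show (0 : ℝ) < k / ((k : ℝ) + 1) by positivity)
      rw [Real.log_div (by positivity) (by positivity)] at h1
      have h2 : (k : ℝ) / (k + 1) - 1 = -((k : ℝ) + 1)⁻¹ := by field_simp; ring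
      rw [ha, hb]
      linarith
    have hab0 : 0 ≤ b - a := le_trans (by positivity) hab'
    have hza : z / ((k : ℝ) + 1) = Real.exp a := by
      rw [ha, Real.exp_sub, Real.exp_log hz0, Real.exp_log (by positivity)]
    have hstep : ((k : ℝ) + 1)⁻¹ * |moebiusLogError (z / ((k : ℝ) + 1))| ≤
        (∫ v in a..b, |moebiusLogError (Real.exp v)|) + ((k : ℝ) ^ 2)⁻¹ := by
      rw [hza]
      have h1 : ∫ v in a..b, (|moebiusLogError (Real.exp a)| - (b - a)) ≤
          ∫ v in a..b, |moebiusLogError (Real.exp v)| := by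
        refine intervalIntegral.integral_mono_on (by linarith) (by simp) (hint _ _) fun v hv => ?_
        have h2 := abs_moebiusLogError_exp_sub_le a v
        have h3 := abs_sub_abs_le_abs_sub (moebiusLogError (Real.exp a))
          (moebiusLogError (Real.exp v))
        have h4 : |a - v| ≤ b - a := by
          rw [abs_le]
          constructor <;> linarith [hv.1, hv.2]
        linarith
      rw [intervalIntegral.integral_const, smul_eq_mul] at h1
      have h2 : ((k : ℝ) + 1)⁻¹ * |moebiusLogError (Real.exp a)| ≤
          (b - a) * |moebiusLogError (Real.exp a)| := by gcongr
      have h3 : (b - a) * (b - a) ≤ ((k : ℝ) ^ 2)⁻¹ := by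
        rw [← inv_pow, sq]
        gcongr
      linarith
    have hsplit : (∫ v in a..x, |moebiusLogError (Real.exp v)|) =
        (∫ v in a..b, |moebiusLogError (Real.exp v)|) +
          ∫ v in b..x, |moebiusLogError (Real.exp v)| :=
      (intervalIntegral.integral_add_adjacent_intervals (hint _ _) (hint _ _)).symm
    rw [hsplit]
    linarith

theorem exists_sum_inv_mul_abs_moebiusLogError_le :
    ∃ C : ℝ, ∀ z : ℝ, 0 < z →
      ∑ n ∈ Finset.Icc 1 ⌊z⌋₊, (n : ℝ)⁻¹ * |moebiusLogError (z / n)| ≤ C := by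
  obtain ⟨C, hC1, hC⟩ := exists_abs_moebiusLogError_le
  obtain ⟨C', hC'⟩ := exists_integral_abs_moebiusLogError_le
  have hC'0 : 0 ≤ C' := by simpa using hC' 0 le_rfl
  have hE := continuous_moebiusLogError_exp
  have hs : Summable fun k : ℕ => ((k : ℝ) ^ 2)⁻¹ := Real.summable_nat_pow_inv.2 (by norm_num)
  have hs0 : 0 ≤ ∑' k : ℕ, ((k : ℝ) ^ 2)⁻¹ := tsum_nonneg fun k => by positivity
  refine ⟨C + C' + ∑' k : ℕ, ((k : ℝ) ^ 2)⁻¹, fun z hz => ?_⟩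
  rcases Nat.eq_zero_or_pos ⌊z⌋₊ with h0 | hN
  · rw [h0]
    simp
    linarith
  · have hNz : ((⌊z⌋₊ : ℕ) : ℝ) ≤ z := Nat.floor_le hz.le
    have hN' : (1 : ℝ) ≤ (⌊z⌋₊ : ℕ) := by exact_mod_cast hN
    refine (sum_inv_mul_abs_moebiusLogError_le hC hN hNz).trans ?_
    have h1 := hs.sum_le_tsum (Finset.range ⌊z⌋₊) (fun k _ => by positivity)
    have hlog : Real.log (⌊z⌋₊ : ℕ) ≤ Real.log z := Real.log_le_log (by linarith) hNz
    have h2 : (∫ v in (Real.log z - Real.log (⌊z⌋₊ : ℕ))..(Real.log z),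
        |moebiusLogError (Real.exp v)|) ≤
        ∫ v in (0)..(Real.log z), |moebiusLogError (Real.exp v)| :=
      intervalIntegral.integral_mono_interval (by linarith)
        (by linarith [Real.log_nonneg hN']) le_rfl
        (.of_forall fun u => abs_nonneg _) (Continuous.intervalIntegrable (by fun_prop) _ _)
    have h3 := hC' (Real.log z) (Real.log_nonneg (by linarith))
    linarith

theorem sum_inv_filter_lt_le {a : ℝ} (ha : 0 < a) (N : ℕ) (hN : a < N) :
    ∑ q ∈ (Finset.Icc 1 N).filter fun q : ℕ => a < (q : ℝ), (q : ℝ)⁻¹ ≤ 1 + Real.log (N / a) := by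
  induction N with
  | zero =>
    simp at hN
    linarith
  | succ k ih =>
    rw [Finset.sum_filter, Finset.sum_Icc_succ_top (by omega), if_pos hN, ← Finset.sum_filter]
    have hk1 : (0 : ℝ) < ((k + 1 : ℕ) : ℝ) := by positivity
    rcases lt_or_ge a k with h | h
    · have ih := ih h
      have hk0 : (0 : ℝ) < k := by linarith
      have h1 := Real.log_le_sub_one_of_pos (show (0 : ℝ) < k / ((k + 1 : ℕ) : ℝ) by positivity)
      rw [Real.log_div (by positivity) (by positivity)] at h1
      have h2 : (k : ℝ) / ((k + 1 : ℕ) : ℝ) - 1 = -(((k + 1 : ℕ) : ℝ))⁻¹ := by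
        push_cast
        field_simp
        ring
      rw [Real.log_div (by positivity) (by positivity)] at ih ⊢
      linarith
    · have h0 : ∑ q ∈ (Finset.Icc 1 k).filter fun q : ℕ => a < (q : ℝ), (q : ℝ)⁻¹ = 0 := by
        rw [Finset.filter_false_of_mem, Finset.sum_empty]
        intro q hq
        have : (q : ℝ) ≤ k := by exact_mod_cast (Finset.mem_Icc.1 hq).2
        linarith
      rw [h0, zero_add]
      have h1 : (((k + 1 : ℕ) : ℝ))⁻¹ ≤ 1 := inv_le_one_of_one_le₀ (by simp)
      have h2 : 0 ≤ Real.log (((k + 1 : ℕ) : ℝ) / a) :=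
        Real.log_nonneg ((one_le_div ha).2 hN.le)
      linarith

/-- The integers `n > z` all of whose squarefree divisors are at most `z`: write `n = q m²` with
`q` squarefree, so that `z / m² < q ≤ z`. -/
theorem exists_sum_inv_le_of_squarefree_le :
    ∃ C : ℝ, ∀ z : ℝ, 0 < z → ∀ F : Finset ℕ,
      (∀ n ∈ F, n ≠ 0 ∧ z < n ∧ ∀ q : ℕ, Squarefree q → q ∣ n → (q : ℝ) ≤ z) →
      ∑ n ∈ F, (n : ℝ)⁻¹ ≤ C := by
  have hs : Summable fun m : ℕ => 5 * (m : ℝ) ^ (-(3 / 2) : ℝ) :=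
    (Real.summable_nat_rpow.2 (by norm_num)).mul_left 5
  refine ⟨∑' m : ℕ, 5 * (m : ℝ) ^ (-(3 / 2) : ℝ), fun z hz F hF => ?_⟩
  choose q m hqm hq using fun n : ℕ => Nat.sq_mul_squarefree n
  set N := ⌊z⌋₊
  set M := F.sup m with hM
  set S : Finset (ℕ × ℕ) := (Finset.Icc 1 M ×ˢ Finset.Icc 1 N).filter
    fun p => z / (p.1 : ℝ) ^ 2 < (p.2 : ℝ) with hS
  have hinj : Set.InjOn (fun n => (m n, q n)) F := by
    intro n _ n' _ h
    simp only [Prod.mk.injEq] at h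
    rw [← hqm n, ← hqm n', h.1, h.2]
  have hpos : ∀ n ∈ F, 1 ≤ m n ∧ 1 ≤ q n := by
    intro n hn
    have h0 := (hF n hn).1
    rw [← hqm n] at h0
    constructor
    · by_contra h
      apply h0
      have : m n = 0 := by omega
      simp [this]
    · by_contra h
      apply h0
      have : q n = 0 := by omega
      simp [this]
  have hmem : F.image (fun n => (m n, q n)) ⊆ S := by
    intro p hp
    rw [Finset.mem_image] at hp
    obtain ⟨n, hn, rfl⟩ := hp
    obtain ⟨-, hzn, hsq⟩ := hF n hn
    have hm1 : (1 : ℝ) ≤ m n := by exact_mod_cast (hpos n hn).1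
    simp only [hS, Finset.mem_filter, Finset.mem_product, Finset.mem_Icc]
    refine ⟨⟨⟨(hpos n hn).1, Finset.le_sup hn⟩, (hpos n hn).2, Nat.le_floor
      (hsq (q n) (hq n) ⟨m n ^ 2, by rw [mul_comm, hqm]⟩)⟩, ?_⟩
    rw [div_lt_iff₀ (by positivity)]
    have : (n : ℝ) = (q n : ℝ) * (m n : ℝ) ^ 2 := by
      conv_lhs => rw [← hqm n]
      push_cast
      ring
    rwa [this] at hzn
  calc ∑ n ∈ F, (n : ℝ)⁻¹
      = ∑ n ∈ F, ((m n : ℝ) ^ 2)⁻¹ * (q n : ℝ)⁻¹ := by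
        refine Finset.sum_congr rfl fun n _ => ?_
        conv_lhs => rw [← hqm n]
        push_cast
        rw [mul_inv]
    _ = ∑ p ∈ F.image (fun n => (m n, q n)), ((p.1 : ℝ) ^ 2)⁻¹ * (p.2 : ℝ)⁻¹ := by
        rw [Finset.sum_image hinj]
    _ ≤ ∑ p ∈ S, ((p.1 : ℝ) ^ 2)⁻¹ * (p.2 : ℝ)⁻¹ :=
        Finset.sum_le_sum_of_subset_of_nonneg hmem fun p _ _ => by positivity
    _ = ∑ k ∈ Finset.Icc 1 M, ((k : ℝ) ^ 2)⁻¹ *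
          ∑ r ∈ (Finset.Icc 1 N).filter fun r : ℕ => z / (k : ℝ) ^ 2 < (r : ℝ), (r : ℝ)⁻¹ := by
        rw [hS, Finset.sum_filter, Finset.sum_product]
        refine Finset.sum_congr rfl fun k _ => ?_
        rw [← Finset.sum_filter, Finset.mul_sum]
    _ ≤ ∑ k ∈ Finset.Icc 1 M, 5 * (k : ℝ) ^ (-(3 / 2) : ℝ) := by
        refine Finset.sum_le_sum fun k hk => ?_
        have hk1 : (1 : ℝ) ≤ k := by exact_mod_cast (Finset.mem_Icc.1 hk).1
        have hk0 : (0 : ℝ) < k := by linarith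
        have hlogk := Real.log_nonneg hk1
        have h1 : ∑ r ∈ (Finset.Icc 1 N).filter fun r : ℕ => z / (k : ℝ) ^ 2 < (r : ℝ), (r : ℝ)⁻¹
            ≤ 1 + 2 * Real.log k := by
          rcases lt_or_ge (z / (k : ℝ) ^ 2) N with h | h
          · refine (sum_inv_filter_lt_le (by positivity) N h).trans ?_
            have h2 : (N : ℝ) / (z / (k : ℝ) ^ 2) ≤ (k : ℝ) ^ 2 := by
              have hNz : (N : ℝ) ≤ z := Nat.floor_le hz.le
              rw [div_div_eq_mul_div, div_le_iff₀ hz, mul_comm]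
              gcongr
            have h0 : (0 : ℝ) < N := lt_trans (by positivity) h
            have h3 := Real.log_le_log (by positivity) h2
            rw [Real.log_pow] at h3
            push_cast at h3
            linarith
          · rw [Finset.filter_false_of_mem, Finset.sum_empty]
            · positivity
            · intro r hr
              have : (r : ℝ) ≤ N := by exact_mod_cast (Finset.mem_Icc.1 hr).2
              linarith
        have h2 := Real.log_le_rpow_div hk0.le (by norm_num : (0 : ℝ) < 1 / 2)
        have h3 : (1 : ℝ) ≤ (k : ℝ) ^ (1 / 2 : ℝ) := Real.one_le_rpow hk1 (by norm_num)
        calc ((k : ℝ) ^ 2)⁻¹ *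
              ∑ r ∈ (Finset.Icc 1 N).filter fun r : ℕ => z / (k : ℝ) ^ 2 < (r : ℝ), (r : ℝ)⁻¹
            ≤ ((k : ℝ) ^ 2)⁻¹ * (5 * (k : ℝ) ^ (1 / 2 : ℝ)) := by
              gcongr
              refine h1.trans ?_
              linarith
          _ = 5 * (k : ℝ) ^ (-(3 / 2) : ℝ) := by
              have : (-(3 / 2) : ℝ) = -2 + 1 / 2 := by norm_num
              rw [this, Real.rpow_add hk0, Real.rpow_neg hk0.le]
              norm_num
              ring
    _ ≤ ∑' m : ℕ, 5 * (m : ℝ) ^ (-(3 / 2) : ℝ) :=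
        hs.sum_le_tsum _ fun k _ => by positivity

/-- The error terms summed over the integers whose squarefree divisors are bounded by `z`. Those
with `n > z` contribute `O(1)` in total by `exists_sum_inv_le_of_squarefree_le`. -/
theorem exists_sum_inv_mul_abs_moebiusLogError_of_squarefree_le :
    ∃ C : ℝ, 0 ≤ C ∧ ∀ z : ℝ, 0 < z → ∀ F : Finset ℕ,
      (∀ n ∈ F, n ≠ 0 ∧ ∀ q : ℕ, Squarefree q → q ∣ n → (q : ℝ) ≤ z) →
      ∑ n ∈ F, (n : ℝ)⁻¹ * |moebiusLogError (z / n)| ≤ C := by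
  obtain ⟨C₁, hC₁⟩ := exists_sum_inv_mul_abs_moebiusLogError_le
  obtain ⟨C₂, hC₂⟩ := exists_sum_inv_le_of_squarefree_le
  have h10 : 0 ≤ C₁ := (Finset.sum_nonneg fun n _ => by positivity).trans (hC₁ 1 one_pos)
  have h20 : 0 ≤ C₂ := by simpa using hC₂ 1 one_pos ∅ (by simp)
  refine ⟨C₁ + C₂, by positivity, fun z hz F hF => ?_⟩
  rw [← Finset.sum_filter_add_sum_filter_not F (fun n : ℕ => (n : ℝ) ≤ z)]
  refine add_le_add ?_ ?_
  · refine le_trans (Finset.sum_le_sum_of_subset_of_nonneg ?_ fun n _ _ => by positivity)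
      (hC₁ z hz)
    intro n hn
    rw [Finset.mem_filter] at hn
    have := (hF n hn.1).1
    exact Finset.mem_Icc.2 ⟨by omega, Nat.le_floor hn.2⟩
  · refine le_trans (le_of_eq ?_) (hC₂ z hz (F.filter fun n : ℕ => ¬ (n : ℝ) ≤ z) ?_)
    · refine Finset.sum_congr rfl fun n hn => ?_
      rw [Finset.mem_filter, not_le] at hn
      rw [moebiusLogError_of_lt_one ((div_lt_one (hz.trans hn.2)).2 hn.2)]
      simp
    · intro n hn
      rw [Finset.mem_filter, not_le] at hn
      exact ⟨(hF n hn.1).1, hn.2, (hF n hn.1).2⟩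

/-! ### Sums over integers coprime to a modulus -/

section

open ArithmeticFunction

/-- The indicator function of the integers coprime to `r`. -/
def coprimeIndicator (r : ℕ) : ArithmeticFunction ℤ :=
  ⟨fun n => if n ≠ 0 ∧ n.Coprime r then 1 else 0, by simp⟩

/-- The indicator function of the positive integers all of whose prime factors divide `r`. -/
def factoredIndicator (r : ℕ) : ArithmeticFunction ℤ :=
  ⟨fun n => if n ∈ Nat.factoredNumbers r.primeFactors then 1 else 0, by
    simp [Nat.mem_factoredNumbers]⟩

theorem coprimeIndicator_apply (r n : ℕ) :
    coprimeIndicator r n = if n ≠ 0 ∧ n.Coprime r then 1 else 0 := rfl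

theorem factoredIndicator_apply (r n : ℕ) :
    factoredIndicator r n = if n ∈ Nat.factoredNumbers r.primeFactors then 1 else 0 := rfl

theorem one_mem_factoredNumbers (s : Finset ℕ) : 1 ∈ Nat.factoredNumbers s := by
  simp [Nat.mem_factoredNumbers]

theorem isMultiplicative_coprimeIndicator (r : ℕ) : (coprimeIndicator r).IsMultiplicative := by
  rw [IsMultiplicative.iff_ne_zero]
  refine ⟨by simp [coprimeIndicator_apply], fun {m n} hm hn _ => ?_⟩
  have := mul_ne_zero hm hn
  simp only [coprimeIndicator_apply, Nat.coprime_mul_iff_left]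
  grind

theorem isMultiplicative_factoredIndicator (r : ℕ) : (factoredIndicator r).IsMultiplicative := by
  rw [IsMultiplicative.iff_ne_zero]
  refine ⟨by simp [factoredIndicator_apply, one_mem_factoredNumbers], fun {m n} hm hn _ => ?_⟩
  have h : m * n ∈ Nat.factoredNumbers r.primeFactors ↔
      m ∈ Nat.factoredNumbers r.primeFactors ∧ n ∈ Nat.factoredNumbers r.primeFactors :=
    ⟨fun h => ⟨Nat.mem_factoredNumbers_of_dvd h (dvd_mul_right _ _),
      Nat.mem_factoredNumbers_of_dvd h (dvd_mul_left _ _)⟩,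
      fun h => Nat.mul_mem_factoredNumbers h.1 h.2⟩
  simp only [factoredIndicator_apply, h]
  by_cases h1 : m ∈ Nat.factoredNumbers r.primeFactors <;>
    by_cases h2 : n ∈ Nat.factoredNumbers r.primeFactors <;> simp [h1, h2]

/-- Every positive integer is uniquely a product of an integer coprime to `r` and an integer
composed of the primes dividing `r`. -/
theorem coprimeIndicator_mul_factoredIndicator {r : ℕ} (hr : r ≠ 0) :
    coprimeIndicator r * factoredIndicator r = (zeta : ArithmeticFunction ℤ) := by
  rw [IsMultiplicative.eq_iff_eq_on_prime_powers _
    ((isMultiplicative_coprimeIndicator r).mul (isMultiplicative_factoredIndicator r)) _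
    isMultiplicative_zeta.natCast]
  intro p i hp
  have hpi : p ^ i ≠ 0 := pow_ne_zero _ hp.ne_zero
  have hprime : ∀ a b : ℕ, a * b = p ^ i → a ≠ 1 → p ∣ a := by
    intro a b hab ha
    obtain ⟨j, -, rfl⟩ := (Nat.dvd_prime_pow hp).1 (Dvd.intro _ hab)
    exact dvd_pow_self p (by rintro rfl; simp at ha)
  rw [natCoe_apply, zeta_apply_ne hpi, mul_apply]
  by_cases hpr : p ∣ r
  · rw [Finset.sum_eq_single_of_mem (1, p ^ i) (by simp [hp.ne_zero])]
    · have : p ^ i ∈ Nat.factoredNumbers r.primeFactors := by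
        rw [Nat.mem_factoredNumbers']
        intro q hq hqp
        have := (Nat.prime_dvd_prime_iff_eq hq hp).1 (hq.dvd_of_dvd_pow hqp)
        subst this
        exact Nat.mem_primeFactors.2 ⟨hq, hpr, hr⟩
      simp [coprimeIndicator_apply, factoredIndicator_apply, this]
    · rintro ⟨a, b⟩ hab hne
      rw [Nat.mem_divisorsAntidiagonal] at hab
      have ha : a ≠ 1 := by
        rintro rfl
        exact hne (by simpa using hab.1)
      have hpa := hprime a b hab.1 ha
      have : ¬ a.Coprime r := fun h => Nat.not_coprime_of_dvd_of_dvd hp.one_lt hpa hpr h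
      simp [coprimeIndicator_apply, this]
  · rw [Finset.sum_eq_single_of_mem (p ^ i, 1) (by simp [hp.ne_zero])]
    · have : (p ^ i).Coprime r := ((Nat.Prime.coprime_iff_not_dvd hp).2 hpr).pow_left i
      simp [coprimeIndicator_apply, factoredIndicator_apply, this, hp.ne_zero,
        one_mem_factoredNumbers]
    · rintro ⟨a, b⟩ hab hne
      rw [Nat.mem_divisorsAntidiagonal] at hab
      have hb : b ≠ 1 := by
        rintro rfl
        exact hne (by simpa using hab.1)
      have hpb := hprime b a (by rw [mul_comm]; exact hab.1) hb
      have : b ∉ Nat.factoredNumbers r.primeFactors := by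
        rw [Nat.mem_factoredNumbers']
        intro h
        exact hpr (Nat.dvd_of_mem_primeFactors (h p hp hpb))
      simp [factoredIndicator_apply, this]

/-- The Dirichlet inverse of a completely multiplicative function, here `coprimeIndicator r`, is its
product with the Möbius function. -/
theorem moebius_pmul_coprimeIndicator_mul (r : ℕ) :
    (pmul moebius (coprimeIndicator r)) * coprimeIndicator r = 1 := by
  ext n
  rcases eq_or_ne n 0 with rfl | hn
  · simp
  have h : ∀ p ∈ n.divisorsAntidiagonal,
      (pmul moebius (coprimeIndicator r)) p.1 * coprimeIndicator r p.2 =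
        (moebius p.1 * (zeta : ArithmeticFunction ℤ) p.2) * coprimeIndicator r n := by
    rintro ⟨a, b⟩ hab
    obtain ⟨rfl, hab0⟩ := Nat.mem_divisorsAntidiagonal.1 hab
    have ha : a ≠ 0 := left_ne_zero_of_mul hab0
    have hb : b ≠ 0 := right_ne_zero_of_mul hab0
    simp only [pmul_apply, coprimeIndicator_apply, natCoe_apply, zeta_apply_ne hb,
      Nat.coprime_mul_iff_left]
    grind [Nat.cast_one]
  rw [mul_apply, Finset.sum_congr rfl h, ← Finset.sum_mul, ← mul_apply, moebius_mul_coe_zeta]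
  rcases eq_or_ne n 1 with rfl | h1
  · simp [coprimeIndicator_apply]
  · simp [one_apply_ne h1]

theorem moebius_pmul_coprimeIndicator {r : ℕ} (hr : r ≠ 0) :
    pmul moebius (coprimeIndicator r) = factoredIndicator r * moebius := by
  calc pmul moebius (coprimeIndicator r)
      = pmul moebius (coprimeIndicator r) * ((zeta : ArithmeticFunction ℤ) * moebius) := by
        rw [coe_zeta_mul_moebius, mul_one]
    _ = (pmul moebius (coprimeIndicator r) * coprimeIndicator r) *
          (factoredIndicator r * moebius) := by
        rw [← coprimeIndicator_mul_factoredIndicator hr]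
        ring
    _ = _ := by rw [moebius_pmul_coprimeIndicator_mul, one_mul]

theorem sum_Ioc_mul_apply_mul (f g : ArithmeticFunction ℤ) (F : ℕ → ℝ) (N : ℕ)
    (hF : ∀ n, N < n → F n = 0) :
    ∑ n ∈ Finset.Ioc 0 N, ((f * g) n : ℝ) * F n =
      ∑ k ∈ Finset.Ioc 0 N, ∑ m ∈ Finset.Ioc 0 N, (f k : ℝ) * ((g m : ℝ) * F (k * m)) := by
  have h1 : ∀ n ∈ Finset.Ioc 0 N, ((f * g) n : ℝ) * F n =
      ∑ x ∈ Finset.Ioc 0 N ×ˢ Finset.Ioc 0 N,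
        if x.1 * x.2 = n then (f x.1 : ℝ) * ((g x.2 : ℝ) * F (x.1 * x.2)) else 0 := by
    intro n hn
    rw [Finset.mem_Ioc] at hn
    rw [mul_apply, Nat.divisorsAntidiagonal_eq_prod_filter_of_le hn.1.ne' hn.2, ← Finset.sum_filter,
      Int.cast_sum, Finset.sum_mul]
    refine Finset.sum_congr rfl fun x hx => ?_
    rw [(Finset.mem_filter.1 hx).2]
    push_cast
    ring
  rw [Finset.sum_congr rfl h1, Finset.sum_comm, Finset.sum_product]
  refine Finset.sum_congr rfl fun k hk => Finset.sum_congr rfl fun m hm => ?_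
  rw [Finset.mem_Ioc] at hk hm
  rw [Finset.sum_ite_eq]
  split_ifs with h
  · rfl
  · rw [hF, mul_zero, mul_zero]
    rw [Finset.mem_Ioc] at h
    exact not_le.1 fun h' => h ⟨Nat.mul_pos hk.1 hm.1, h'⟩

/-- The weight `1 / k` on the integers `k` composed of the primes dividing `r`. -/
noncomputable def factoredWeight (r k : ℕ) : ℝ := (factoredIndicator r k : ℝ) * (k : ℝ)⁻¹

theorem factoredWeight_nonneg (r k : ℕ) : 0 ≤ factoredWeight r k := by
  rw [factoredWeight, factoredIndicator_apply]
  split_ifs <;> simp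

theorem factoredWeight_of_mem {r k : ℕ} (h : k ∈ Nat.factoredNumbers r.primeFactors) :
    factoredWeight r k = (k : ℝ)⁻¹ := by
  simp [factoredWeight, factoredIndicator_apply, h]

theorem factoredWeight_of_notMem {r k : ℕ} (h : k ∉ Nat.factoredNumbers r.primeFactors) :
    factoredWeight r k = 0 := by
  simp [factoredWeight, factoredIndicator_apply, h]

theorem hasSum_factoredWeight {r : ℕ} (hr : r ≠ 0) :
    HasSum (factoredWeight r) ((r : ℝ) / r.totient) := by
  let f : ℕ →* ℝ :=
    { toFun := fun n => (n : ℝ)⁻¹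
      map_one' := by simp
      map_mul' := fun a b => by push_cast; rw [mul_inv] }
  have h := (EulerProduct.summable_and_hasSum_factoredNumbers_prod_filter_prime_geometric (f := f)
    (fun {p} hp => by
      change ‖(p : ℝ)⁻¹‖ < 1
      rw [norm_inv, Real.norm_natCast]
      exact inv_lt_one_of_one_lt₀ (by exact_mod_cast hp.one_lt)) r.primeFactors).2
  have h1 : ∏ p ∈ r.primeFactors with Nat.Prime p, (1 - f p)⁻¹ = (r : ℝ) / r.totient := by
    rw [Finset.filter_true_of_mem fun p hp => Nat.prime_of_mem_primeFactors hp,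
      Finset.prod_inv_distrib]
    have h2 := congrArg (Rat.cast : ℚ → ℝ) (Nat.totient_eq_mul_prod_factors r)
    push_cast at h2
    have h3 : (r : ℝ) ≠ 0 := by exact_mod_cast hr
    change (∏ p ∈ r.primeFactors, (1 - (p : ℝ)⁻¹))⁻¹ = _
    rw [h2, div_mul_eq_div_div, div_self h3, one_div]
  rw [h1] at h
  have h2 : factoredWeight r =
      (Nat.factoredNumbers r.primeFactors).indicator fun k : ℕ => (k : ℝ)⁻¹ := by
    ext k
    rw [Set.indicator_apply]
    split_ifs with hk
    · exact factoredWeight_of_mem hk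
    · exact factoredWeight_of_notMem hk
  rw [h2, ← hasSum_subtype_iff_indicator]
  exact h

/-- `∑_{m ≤ x, (m, r) = 1} μ(m) / m * log (x / m)`, expanded into values of `moebiusLogSum`. -/
noncomputable def coprimeLogSum (r : ℕ) (x : ℝ) : ℝ :=
  ∑' k, factoredWeight r k * moebiusLogSum (x / k)

theorem sum_coprime_moebius_posLog {r : ℕ} (hr : r ≠ 0) {x : ℝ} (hx : 0 ≤ x) {N : ℕ}
    (hN : x ≤ N) :
    ∑ m ∈ Finset.Icc 1 N, (if m.Coprime r then (moebius m : ℝ) else 0) / m * Real.posLog (x / m)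
      = coprimeLogSum r x := by
  have hI : Finset.Icc 1 N = Finset.Ioc 0 N := rfl
  have hzero : ∀ n : ℕ, N < n → Real.posLog (x / n) = 0 := by
    intro n hn
    have hn' : (N : ℝ) < n := by exact_mod_cast hn
    rw [(Real.posLog_eq_zero_iff _).2]
    rw [abs_of_nonneg (by positivity), div_le_one (by linarith)]
    linarith
  have h1 := sum_Ioc_mul_apply_mul (factoredIndicator r) moebius
    (fun n => (n : ℝ)⁻¹ * Real.posLog (x / n)) N (fun n hn => by simp [hzero n hn])
  rw [← moebius_pmul_coprimeIndicator hr] at h1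
  have h2 : ∑ m ∈ Finset.Icc 1 N,
      (if m.Coprime r then (moebius m : ℝ) else 0) / m * Real.posLog (x / m) =
      ∑ n ∈ Finset.Ioc 0 N, ((pmul moebius (coprimeIndicator r) n : ℤ) : ℝ) *
        ((n : ℝ)⁻¹ * Real.posLog (x / n)) := by
    rw [hI]
    refine Finset.sum_congr rfl fun n hn => ?_
    have hn0 : n ≠ 0 := by
      rw [Finset.mem_Ioc] at hn
      omega
    rw [pmul_apply, coprimeIndicator_apply]
    split_ifs with h3 h4 h4
    · push_cast
      ring
    · exact absurd ⟨hn0, h3⟩ h4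
    · exact absurd h4.2 h3
    · simp
  rw [h2, h1, coprimeLogSum, tsum_eq_sum (s := Finset.Ioc 0 N)]
  · refine Finset.sum_congr rfl fun k hk => ?_
    have hk0 : (0 : ℝ) < k := by
      rw [Finset.mem_Ioc] at hk
      exact_mod_cast hk.1
    have hk1 : (1 : ℝ) ≤ k := by
      rw [Finset.mem_Ioc] at hk
      exact_mod_cast hk.1
    have hfloor : ⌊x / k⌋₊ ≤ N := by
      refine Nat.floor_le_of_le ?_
      exact (div_le_self hx hk1).trans hN
    rw [moebiusLogSum_eq_sum_posLog (by positivity) hfloor, hI, Finset.mul_sum]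
    refine Finset.sum_congr rfl fun m hm => ?_
    rw [factoredWeight]
    push_cast
    rw [div_div]
    ring
  · intro k hk
    rw [Finset.mem_Ioc] at hk
    rcases Nat.eq_zero_or_pos k with rfl | hk0
    · simp [moebiusLogSum]
    · have hk' : (N : ℝ) < k := by exact_mod_cast (by omega : N < k)
      rw [moebiusLogSum_of_lt_one, mul_zero]
      rw [div_lt_one (by linarith)]
      linarith

theorem summable_factoredWeight_mul {r : ℕ} (hr : r ≠ 0) {f : ℕ → ℝ} {C : ℝ}
    (hf : ∀ k, |f k| ≤ C) : Summable fun k => factoredWeight r k * f k := by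
  refine Summable.of_norm_bounded ((hasSum_factoredWeight hr).summable.mul_right C) fun k => ?_
  rw [norm_mul, Real.norm_eq_abs, Real.norm_eq_abs, abs_of_nonneg (factoredWeight_nonneg r k)]
  exact mul_le_mul_of_nonneg_left (hf k) (factoredWeight_nonneg r k)

theorem abs_coprimeLogSum_sub_le {r : ℕ} (hr : r ≠ 0) (x : ℝ) :
    |coprimeLogSum r x - (r : ℝ) / r.totient|
      ≤ ∑' k, factoredWeight r k * |moebiusLogError (x / k)| := by
  obtain ⟨C, -, hC⟩ := exists_abs_moebiusLogError_le
  have h1 := (hasSum_factoredWeight hr).add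
    (summable_factoredWeight_mul hr (f := fun k : ℕ => moebiusLogError (x / k))
      fun k => hC _).hasSum
  have h2 : coprimeLogSum r x =
      (r : ℝ) / r.totient + ∑' k, factoredWeight r k * moebiusLogError (x / k) := by
    rw [← h1.tsum_eq, coprimeLogSum]
    refine tsum_congr fun k => ?_
    rw [moebiusLogError]
    ring
  rw [h2, add_sub_cancel_left]
  have h3 := summable_factoredWeight_mul hr (f := fun k : ℕ => |moebiusLogError (x / k)|)
      fun k => (abs_abs _).trans_le (hC _)
  have h4 : ∀ k, factoredWeight r k * |moebiusLogError (x / k)|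
      = ‖factoredWeight r k * moebiusLogError (x / k)‖ := by
    intro k
    rw [norm_mul, Real.norm_eq_abs, Real.norm_eq_abs, abs_of_nonneg (factoredWeight_nonneg r k)]
  simp_rw [h4] at h3 ⊢
  exact norm_tsum_le_tsum_norm h3

theorem exists_abs_coprimeLogSum_le :
    ∃ C : ℝ, 0 ≤ C ∧ ∀ r : ℕ, r ≠ 0 → ∀ x : ℝ,
      |coprimeLogSum r x| ≤ C * ((r : ℝ) / r.totient) := by
  obtain ⟨C, hC1, hC⟩ := exists_abs_moebiusLogError_le
  refine ⟨C + 1, by linarith, fun r hr x => ?_⟩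
  have h1 : ∀ k : ℕ, |moebiusLogSum (x / k)| ≤ C + 1 := by
    intro k
    have h2 := hC (x / k)
    have h3 : moebiusLogSum (x / k) = moebiusLogError (x / k) + 1 := by
      rw [moebiusLogError]
      ring
    rw [h3]
    refine (abs_add_le _ _).trans ?_
    rw [abs_one]
    linarith
  have h := tsum_of_norm_bounded (f := fun k => factoredWeight r k * moebiusLogSum (x / k))
    ((hasSum_factoredWeight hr).mul_left (C + 1)) (by
      intro k
      rw [norm_mul, Real.norm_eq_abs, Real.norm_eq_abs, abs_of_nonneg (factoredWeight_nonneg r k),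
        mul_comm]
      exact mul_le_mul_of_nonneg_right (h1 k) (factoredWeight_nonneg r k))
  exact h

/-! ### Summation over the modulus -/

theorem Squarefree.le_of_primeFactors_subset {q r : ℕ} (hq : Squarefree q) (hr : Squarefree r)
    (h : q.primeFactors ⊆ r.primeFactors) : q ≤ r := by
  rw [← Nat.prod_primeFactors_of_squarefree hq, ← Nat.prod_primeFactors_of_squarefree hr]
  refine Nat.le_of_dvd ?_ (Finset.prod_dvd_prod_of_subset _ _ _ h)
  exact Finset.prod_pos fun p hp => (Nat.prime_of_mem_primeFactors hp).pos

theorem primeFactors_mul_of_mem_factoredNumbers {r k : ℕ} (hr : r ≠ 0)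
    (hk : k ∈ Nat.factoredNumbers r.primeFactors) : (r * k).primeFactors = r.primeFactors := by
  rw [Nat.primeFactors_mul hr (Nat.ne_zero_of_mem_factoredNumbers hk), Finset.union_eq_left]
  exact Nat.primeFactors_subset_of_mem_factoredNumbers hk

/-- Pairs `(r, k)` with `r ≤ y` squarefree and `k` composed of the primes dividing `r` correspond to
the integers `n = r k` with radical at most `y`. -/
theorem sum_squarefree_tsum_factoredWeight_le {y : ℝ} (hy : 0 ≤ y) {f : ℕ → ℝ} (hf : ∀ n, 0 ≤ f n)
    {B : ℝ} (hfB : ∀ n, f n ≤ B) {C : ℝ}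
    (hC : ∀ F : Finset ℕ, (∀ n ∈ F, n ≠ 0 ∧ ∀ q : ℕ, Squarefree q → q ∣ n → (q : ℝ) ≤ y) →
      ∑ n ∈ F, (n : ℝ)⁻¹ * f n ≤ C) :
    ∑ r ∈ (Finset.Icc 1 ⌊y⌋₊).filter Squarefree,
      (r : ℝ)⁻¹ * ∑' k, factoredWeight r k * f (r * k) ≤ C := by
  set R := (Finset.Icc 1 ⌊y⌋₊).filter Squarefree with hR
  have hR0 : ∀ r ∈ R, r ≠ 0 := by
    intro r hr
    have := (Finset.mem_Icc.1 (Finset.mem_filter.1 hr).1).1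
    omega
  have hs : ∀ r ∈ R, Summable fun k => (r : ℝ)⁻¹ * (factoredWeight r k * f (r * k)) := by
    intro r hr
    refine (summable_factoredWeight_mul (hR0 r hr) (C := B) fun k => ?_).mul_left _
    rw [abs_of_nonneg (hf _)]
    exact hfB _
  simp_rw [← tsum_mul_left]
  rw [← Summable.tsum_finsetSum hs]
  refine Real.tsum_le_of_sum_le (fun k => Finset.sum_nonneg fun r _ =>
    mul_nonneg (by positivity) (mul_nonneg (factoredWeight_nonneg _ _) (hf _))) fun K => ?_
  set P := (R ×ˢ K).filter fun p => p.2 ∈ Nat.factoredNumbers p.1.primeFactors with hP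
  have hinj : Set.InjOn (fun p : ℕ × ℕ => p.1 * p.2) P := by
    rintro ⟨r, k⟩ h ⟨r', k'⟩ h' heq
    simp only [hP, Finset.coe_filter, Finset.mem_product, Set.mem_ofPred_eq] at h h'
    simp only at heq
    have hr := (Finset.mem_filter.1 h.1.1).2
    have hr' := (Finset.mem_filter.1 h'.1.1).2
    have e : r.primeFactors = r'.primeFactors := by
      rw [← primeFactors_mul_of_mem_factoredNumbers (hR0 r h.1.1) h.2, heq,
        primeFactors_mul_of_mem_factoredNumbers (hR0 r' h'.1.1) h'.2]
    have e2 : r = r' := by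
      rw [← Nat.prod_primeFactors_of_squarefree hr, e, Nat.prod_primeFactors_of_squarefree hr']
    subst e2
    rw [Nat.mul_right_inj (hR0 r h.1.1)] at heq
    rw [heq]
  calc ∑ k ∈ K, ∑ r ∈ R, (r : ℝ)⁻¹ * (factoredWeight r k * f (r * k))
      = ∑ p ∈ P, ((p.1 * p.2 : ℕ) : ℝ)⁻¹ * f (p.1 * p.2) := by
        rw [hP, Finset.sum_filter, Finset.sum_product, Finset.sum_comm]
        refine Finset.sum_congr rfl fun r _ => Finset.sum_congr rfl fun k _ => ?_
        split_ifs with hk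
        · rw [factoredWeight_of_mem hk]
          push_cast
          rw [mul_inv]
          ring
        · rw [factoredWeight_of_notMem hk]
          ring
    _ = ∑ n ∈ P.image (fun p : ℕ × ℕ => p.1 * p.2), (n : ℝ)⁻¹ * f n := by
        rw [Finset.sum_image hinj]
    _ ≤ C := by
        refine hC _ fun n hn => ?_
        obtain ⟨⟨r, k⟩, hp, rfl⟩ := Finset.mem_image.1 hn
        rw [hP, Finset.mem_filter, Finset.mem_product] at hp
        have hrR := Finset.mem_filter.1 hp.1.1
        have hr0 := hR0 r hp.1.1
        have hk0 := Nat.ne_zero_of_mem_factoredNumbers hp.2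
        refine ⟨mul_ne_zero hr0 hk0, fun q hq hqn => ?_⟩
        have h1 : q.primeFactors ⊆ r.primeFactors := by
          rw [← primeFactors_mul_of_mem_factoredNumbers hr0 hp.2]
          exact Nat.primeFactors_mono hqn (mul_ne_zero hr0 hk0)
        have h2 : q ≤ ⌊y⌋₊ :=
          (Squarefree.le_of_primeFactors_subset hq hrR.2 h1).trans (Finset.mem_Icc.1 hrR.1).2
        exact (Nat.le_floor_iff hy).1 h2

theorem exists_sum_squarefree_tsum_moebiusLogError_le :
    ∃ C : ℝ, 0 ≤ C ∧ ∀ y z : ℝ, 0 < y → y ≤ z →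
      ∑ r ∈ (Finset.Icc 1 ⌊y⌋₊).filter Squarefree,
        (r : ℝ)⁻¹ * ∑' k, factoredWeight r k * |moebiusLogError (z / r / k)| ≤ C := by
  obtain ⟨B, -, hB⟩ := exists_abs_moebiusLogError_le
  obtain ⟨C, hC0, hC⟩ := exists_sum_inv_mul_abs_moebiusLogError_of_squarefree_le
  refine ⟨C, hC0, fun y z hy hyz => ?_⟩
  have h := sum_squarefree_tsum_factoredWeight_le hy.le
    (f := fun n : ℕ => |moebiusLogError (z / n)|) (fun n => abs_nonneg _) (fun n => hB _)
    (fun F hF => hC z (by linarith) F fun n hn =>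
      ⟨(hF n hn).1, fun q hq hqn => ((hF n hn).2 q hq hqn).trans hyz⟩)
  refine le_of_eq_of_le (Finset.sum_congr rfl fun r _ => ?_) h
  congr 1
  refine tsum_congr fun k => ?_
  push_cast
  rw [div_div]

/-- `∑_{r ≤ y} μ(r)² / φ(r) = log y + O(1)`. -/
theorem exists_abs_sum_inv_totient_sub_log_le :
    ∃ C : ℝ, 0 ≤ C ∧ ∀ y : ℝ, 1 ≤ y →
      |∑ r ∈ (Finset.Icc 1 ⌊y⌋₊).filter Squarefree, (r.totient : ℝ)⁻¹ - Real.log y| ≤ C := by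
  obtain ⟨C, hC0, hC⟩ := exists_sum_inv_mul_abs_moebiusLogError_of_squarefree_le
  refine ⟨1 + C, by linarith, fun y hy => ?_⟩
  set R := (Finset.Icc 1 ⌊y⌋₊).filter Squarefree with hR
  have hy0 : 0 < y := by linarith
  have hR0 : ∀ r ∈ R, r ≠ 0 := by
    intro r hr
    have := (Finset.mem_Icc.1 (Finset.mem_filter.1 hr).1).1
    omega
  have hφ : ∀ r ∈ R, (r.totient : ℝ)⁻¹ = (r : ℝ)⁻¹ * ∑' k, factoredWeight r k := by
    intro r hr
    have hr0 : (r : ℝ) ≠ 0 := by exact_mod_cast hR0 r hr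
    rw [(hasSum_factoredWeight (hR0 r hr)).tsum_eq]
    field_simp
  rw [Finset.sum_congr rfl hφ]
  have hharm : ∀ N : ℕ, (harmonic N : ℝ) = ∑ n ∈ Finset.Icc 1 N, (n : ℝ)⁻¹ := by
    intro N
    rw [harmonic_eq_sum_Icc]
    push_cast
    rfl
  -- the integers `n ≤ y` give the harmonic sum, those with `n > y` a bounded amount
  have hupper : ∑ r ∈ R, (r : ℝ)⁻¹ * ∑' k, factoredWeight r k ≤ (1 + Real.log y) + C := by
    have h := sum_squarefree_tsum_factoredWeight_le hy0.le (f := fun _ => 1)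
      (C := (1 + Real.log y) + C) (fun _ => zero_le_one) (fun _ => le_rfl) (by
        intro F hF
        rw [← Finset.sum_filter_add_sum_filter_not F (fun n : ℕ => (n : ℝ) ≤ y)]
        refine add_le_add ?_ ?_
        · refine le_trans ?_ (harmonic_floor_le_one_add_log y hy)
          rw [hharm]
          simp only [mul_one]
          refine Finset.sum_le_sum_of_subset_of_nonneg ?_ fun n _ _ => by positivity
          intro n hn
          rw [Finset.mem_filter] at hn
          have := (hF n hn.1).1
          exact Finset.mem_Icc.2 ⟨by omega, Nat.le_floor hn.2⟩
        · refine le_of_eq_of_le ?_ (hC y hy0 (F.filter fun n : ℕ => ¬ (n : ℝ) ≤ y)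
            fun n hn => hF n (Finset.mem_filter.1 hn).1)
          refine Finset.sum_congr rfl fun n hn => ?_
          rw [Finset.mem_filter, not_le] at hn
          rw [moebiusLogError_of_lt_one ((div_lt_one (hy0.trans hn.2)).2 hn.2)]
          simp)
    simpa only [mul_one] using h
  -- every `n ≤ y` occurs, for `r` its radical
  have hlower : Real.log y ≤ ∑ r ∈ R, (r : ℝ)⁻¹ * ∑' k, factoredWeight r k := by
    refine (log_le_harmonic_floor y hy0.le).trans ?_
    rw [hharm]
    set rad : ℕ → ℕ := fun n => ∏ p ∈ n.primeFactors, p with hrad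
    have hmaps : ∀ n ∈ Finset.Icc 1 ⌊y⌋₊, rad n ∈ R := by
      intro n hn
      rw [Finset.mem_Icc] at hn
      refine Finset.mem_filter.2 ⟨Finset.mem_Icc.2 ⟨?_, ?_⟩, ?_⟩
      · exact Finset.prod_pos fun p hp => (Nat.prime_of_mem_primeFactors hp).pos
      · exact (Nat.le_of_dvd hn.1 (Nat.prod_primeFactors_dvd n)).trans hn.2
      · refine Finset.squarefree_prod_of_pairwise_isCoprime (fun p hp q hq hpq => ?_)
          fun p hp => (Nat.prime_of_mem_primeFactors hp).squarefree
        rw [Function.onFun, ← Nat.coprime_iff_isRelPrime]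
        exact (Nat.coprime_primes (Nat.prime_of_mem_primeFactors hp)
          (Nat.prime_of_mem_primeFactors hq)).2 hpq
    rw [← Finset.sum_fiberwise_of_maps_to hmaps]
    refine Finset.sum_le_sum fun r hr => ?_
    have hr0 := hR0 r hr
    set S := (Finset.Icc 1 ⌊y⌋₊).filter fun n => rad n = r with hS
    have hdvd : ∀ n ∈ S, r ∣ n := by
      intro n hn
      rw [← (Finset.mem_filter.1 hn).2]
      exact Nat.prod_primeFactors_dvd n
    have hinj : Set.InjOn (fun n => n / r) S := by
      intro n hn n' hn' h
      simp only at h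
      rw [← Nat.mul_div_cancel' (hdvd n hn), h, Nat.mul_div_cancel' (hdvd n' hn')]
    calc ∑ n ∈ S, (n : ℝ)⁻¹ = (r : ℝ)⁻¹ * ∑ n ∈ S, factoredWeight r (n / r) := by
          rw [Finset.mul_sum]
          refine Finset.sum_congr rfl fun n hn => ?_
          obtain ⟨k, rfl⟩ := hdvd n hn
          have hn1 := Finset.mem_filter.1 hn
          have hn0 : r * k ≠ 0 := by
            have := (Finset.mem_Icc.1 hn1.1).1
            omega
          rw [Nat.mul_div_cancel_left _ (Nat.pos_of_ne_zero hr0), factoredWeight_of_mem]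
          · push_cast
            rw [mul_inv]
          · rw [Nat.mem_factoredNumbers']
            intro p hp hpk
            have h1 : p ∣ r := by
              rw [← hn1.2]
              exact Finset.dvd_prod_of_mem _
                (Nat.mem_primeFactors.2 ⟨hp, hpk.mul_left r, hn0⟩)
            exact Nat.mem_primeFactors.2 ⟨hp, h1, hr0⟩
      _ = (r : ℝ)⁻¹ * ∑ k ∈ S.image (fun n => n / r), factoredWeight r k := by
          rw [Finset.sum_image hinj]
      _ ≤ (r : ℝ)⁻¹ * ∑' k, factoredWeight r k := by
          gcongr
          exact (hasSum_factoredWeight hr0).summable.sum_le_tsum _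
            fun k _ => factoredWeight_nonneg r k
  rw [abs_le]
  constructor <;> linarith

end

/-! ### The quadratic form with two logarithmic weights -/

theorem sum_dvd_moebius_posLog {r : ℕ} (hr : r ≠ 0) {y : ℝ} (hy : 0 ≤ y) {N : ℕ} (hN : y ≤ N) :
    ∑ d ∈ Finset.Icc 1 N, (if r ∣ d then
        (ArithmeticFunction.moebius d : ℝ) / d * Real.posLog (y / d) else 0) =
      (ArithmeticFunction.moebius r : ℝ) / r * coprimeLogSum r (y / r) := by
  have hr0 : (0 : ℝ) < r := by exact_mod_cast Nat.pos_of_ne_zero hr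
  have hr1 : (1 : ℝ) ≤ r := by exact_mod_cast Nat.pos_of_ne_zero hr
  set F : ℕ → ℝ := fun d => (ArithmeticFunction.moebius d : ℝ) / d * Real.posLog (y / d) with hF
  have hyr : y / r ≤ N := (div_le_self hy hr1).trans hN
  rw [← sum_coprime_moebius_posLog hr (div_nonneg hy hr0.le) hyr, Finset.mul_sum]
  have h1 : ∀ m ∈ Finset.Icc 1 N, (ArithmeticFunction.moebius r : ℝ) / r *
      ((if m.Coprime r then (ArithmeticFunction.moebius m : ℝ) else 0) / m *
        Real.posLog (y / r / m)) = F (r * m) := by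
    intro m _
    simp only [hF, Nat.cast_mul, div_div]
    split_ifs with hm
    · rw [ArithmeticFunction.isMultiplicative_moebius.map_mul_of_coprime hm.symm, Int.cast_mul]
      ring
    · have : ¬ Squarefree (r * m) := fun h =>
        hm (Nat.coprime_of_squarefree_mul h).symm
      rw [ArithmeticFunction.moebius_eq_zero_of_not_squarefree this]
      simp
  rw [Finset.sum_congr rfl h1, ← Finset.sum_filter,
    ← Finset.sum_image (f := F) (g := fun m => r * m)
      (fun a _ b _ h => Nat.eq_of_mul_eq_mul_left (Nat.pos_of_ne_zero hr) h)]
  refine Finset.sum_subset (fun d hd => ?_) fun d hd hd' => ?_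
  · obtain ⟨hd, m, rfl⟩ := Finset.mem_filter.1 hd
    rw [Finset.mem_Icc] at hd
    refine Finset.mem_image.2 ⟨m, Finset.mem_Icc.2 ⟨?_, ?_⟩, rfl⟩
    · exact Nat.pos_of_ne_zero fun h => by simp [h] at hd
    · exact (Nat.le_mul_of_pos_left m (Nat.pos_of_ne_zero hr)).trans hd.2
  · obtain ⟨m, hm, rfl⟩ := Finset.mem_image.1 hd
    rw [Finset.mem_Icc] at hm
    have hpos : 0 < r * m := Nat.mul_pos (Nat.pos_of_ne_zero hr) hm.1
    have hlt : N < r * m := by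
      by_contra hle
      exact hd' (Finset.mem_filter.2 ⟨Finset.mem_Icc.2 ⟨hpos, not_lt.1 hle⟩, dvd_mul_right _ _⟩)
    have hlt' : (N : ℝ) < (r * m : ℕ) := by exact_mod_cast hlt
    have hp' : (0 : ℝ) < (r * m : ℕ) := by exact_mod_cast hpos
    change _ * Real.posLog (y / (r * m : ℕ)) = 0
    rw [(Real.posLog_eq_zero_iff _).2, mul_zero]
    rw [abs_of_nonneg (div_nonneg hy hp'.le), div_le_one hp']
    linarith

/-- The quadratic form `∑ μ(d) μ(e) / [d, e] * a(d) b(e)` over `1 ≤ d, e ≤ N`. -/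
noncomputable def moebiusLcmForm (N : ℕ) (a b : ℕ → ℝ) : ℝ :=
  ∑ d ∈ Finset.Icc 1 N, ∑ e ∈ Finset.Icc 1 N,
    ((ArithmeticFunction.moebius d : ℝ) * ArithmeticFunction.moebius e) / (Nat.lcm d e : ℝ) *
      (a d * b e)

theorem moebiusLcmForm_comm (N : ℕ) (a b : ℕ → ℝ) :
    moebiusLcmForm N a b = moebiusLcmForm N b a := by
  rw [moebiusLcmForm, Finset.sum_comm]
  refine Finset.sum_congr rfl fun d _ => Finset.sum_congr rfl fun e _ => ?_
  rw [Nat.lcm_comm]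
  ring

theorem inv_lcm_eq_sum_totient {N d e : ℕ} (hd : d ∈ Finset.Icc 1 N) (he : e ∈ Finset.Icc 1 N) :
    ((Nat.lcm d e : ℕ) : ℝ)⁻¹ =
      ∑ r ∈ Finset.Icc 1 N, (r.totient : ℝ) *
        ((if r ∣ d then (d : ℝ)⁻¹ else 0) * if r ∣ e then (e : ℝ)⁻¹ else 0) := by
  rw [Finset.mem_Icc] at hd he
  have hd0 : (d : ℝ) ≠ 0 := by exact_mod_cast (show d ≠ 0 by omega)
  have he0 : (e : ℝ) ≠ 0 := by exact_mod_cast (show e ≠ 0 by omega)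
  have hg : 0 < d.gcd e := Nat.gcd_pos_of_pos_left _ hd.1
  have h1 : ∀ r ∈ Finset.Icc 1 N, (r.totient : ℝ) *
      ((if r ∣ d then (d : ℝ)⁻¹ else 0) * if r ∣ e then (e : ℝ)⁻¹ else 0) =
      if r ∣ d.gcd e then (r.totient : ℝ) * ((d : ℝ)⁻¹ * (e : ℝ)⁻¹) else 0 := by
    intro r _
    by_cases h1 : r ∣ d <;> by_cases h2 : r ∣ e <;> simp [h1, h2, Nat.dvd_gcd_iff]
  rw [Finset.sum_congr rfl h1, ← Finset.sum_filter, ← Finset.sum_mul]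
  have h2 : (Finset.Icc 1 N).filter (fun r => r ∣ d.gcd e) = (d.gcd e).divisors := by
    ext r
    simp only [Finset.mem_filter, Finset.mem_Icc, Nat.mem_divisors]
    refine ⟨fun h => ⟨h.2, hg.ne'⟩, fun h => ⟨⟨Nat.pos_of_dvd_of_pos h.1 hg, ?_⟩, h.1⟩⟩
    exact (Nat.le_of_dvd hg h.1).trans ((Nat.gcd_le_left _ hd.1).trans hd.2)
  rw [h2, ← Nat.cast_sum, Nat.sum_totient]
  have h3 : ((d.gcd e : ℕ) : ℝ) * (d.lcm e : ℕ) = d * e := by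
    exact_mod_cast Nat.gcd_mul_lcm d e
  have h4 : ((d.lcm e : ℕ) : ℝ) ≠ 0 := by
    exact_mod_cast Nat.lcm_ne_zero (by omega) (by omega)
  field_simp
  linarith

/-- Selberg's diagonalisation of the form, through `(d, e) = ∑_{r ∣ d, r ∣ e} φ(r)`. -/
theorem moebiusLcmForm_posLog_eq {y z : ℝ} (hy : 0 ≤ y) (hz : 0 ≤ z) {N : ℕ} (hyN : y ≤ N)
    (hzN : z ≤ N) :
    moebiusLcmForm N (fun d => Real.posLog (y / d)) (fun e => Real.posLog (z / e)) =
      ∑ r ∈ Finset.Icc 1 N, (r.totient : ℝ) *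
        (((ArithmeticFunction.moebius r : ℝ) / r * coprimeLogSum r (y / r)) *
          ((ArithmeticFunction.moebius r : ℝ) / r * coprimeLogSum r (z / r))) := by
  have h1 : ∀ r ∈ Finset.Icc 1 N, (r.totient : ℝ) *
        (((ArithmeticFunction.moebius r : ℝ) / r * coprimeLogSum r (y / r)) *
          ((ArithmeticFunction.moebius r : ℝ) / r * coprimeLogSum r (z / r))) =
      ∑ d ∈ Finset.Icc 1 N, ∑ e ∈ Finset.Icc 1 N, (r.totient : ℝ) *
        ((if r ∣ d then (ArithmeticFunction.moebius d : ℝ) / d * Real.posLog (y / d) else 0) *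
        (if r ∣ e then (ArithmeticFunction.moebius e : ℝ) / e * Real.posLog (z / e) else 0)) := by
    intro r hr
    have hr0 : r ≠ 0 := by
      rw [Finset.mem_Icc] at hr
      omega
    rw [← sum_dvd_moebius_posLog hr0 hy hyN, ← sum_dvd_moebius_posLog hr0 hz hzN,
      Finset.sum_mul_sum]
    simp only [Finset.mul_sum]
  rw [Finset.sum_congr rfl h1, Finset.sum_comm, moebiusLcmForm]
  refine Finset.sum_congr rfl fun d hd => ?_
  rw [Finset.sum_comm]
  refine Finset.sum_congr rfl fun e he => ?_
  rw [div_eq_mul_inv, inv_lcm_eq_sum_totient hd he, Finset.mul_sum, Finset.sum_mul]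
  refine Finset.sum_congr rfl fun r _ => ?_
  split_ifs <;> ring

/-- The form with weights `log⁺(y / d)` and `log⁺(z / e)` is `log (min y z) + O(1)`. -/
theorem exists_abs_moebiusLcmForm_posLog_sub_le :
    ∃ C : ℝ, 0 ≤ C ∧ ∀ y z : ℝ, 1 ≤ y → 1 ≤ z → ∀ N : ℕ, y ≤ N → z ≤ N →
      |moebiusLcmForm N (fun d => Real.posLog (y / d)) (fun e => Real.posLog (z / e)) -
        Real.log (min y z)| ≤ C := by
  obtain ⟨C₁, hC₁0, hC₁⟩ := exists_abs_coprimeLogSum_le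
  obtain ⟨C₂, hC₂0, hC₂⟩ := exists_sum_squarefree_tsum_moebiusLogError_le
  obtain ⟨C₃, hC₃0, hC₃⟩ := exists_abs_sum_inv_totient_sub_log_le
  suffices H : ∀ y z : ℝ, 1 ≤ y → y ≤ z → ∀ N : ℕ, z ≤ N →
      |moebiusLcmForm N (fun d => Real.posLog (y / d)) (fun e => Real.posLog (z / e)) -
        Real.log y| ≤ C₁ * C₂ + C₂ + C₃ by
    refine ⟨C₁ * C₂ + C₂ + C₃, by positivity, fun y z hy hz N hyN hzN => ?_⟩
    rcases le_total y z with h | h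
    · rw [min_eq_left h]
      exact H y z hy h N hzN
    · rw [min_eq_right h, moebiusLcmForm_comm]
      exact H z y hz h N hyN
  intro y z hy hyz N hzN
  have hy0 : 0 < y := by linarith
  have hz0 : 0 < z := by linarith
  set R := (Finset.Icc 1 ⌊y⌋₊).filter Squarefree with hR
  have hRsub : R ⊆ Finset.Icc 1 N := by
    refine (Finset.filter_subset _ _).trans (Finset.Icc_subset_Icc le_rfl ?_)
    exact Nat.floor_le_of_le (hyz.trans hzN)
  rw [moebiusLcmForm_posLog_eq hy0.le hz0.le (hyz.trans hzN) hzN,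
    ← Finset.sum_subset hRsub fun r hr hr' => ?_]
  swap
  · rw [Finset.mem_Icc] at hr
    by_cases hsq : Squarefree r
    · have hlt : ⌊y⌋₊ < r := by
        by_contra hle
        exact hr' (Finset.mem_filter.2 ⟨Finset.mem_Icc.2 ⟨hr.1, not_lt.1 hle⟩, hsq⟩)
      have hyr : y < r := (Nat.floor_lt hy0.le).1 hlt
      have hr0 : (0 : ℝ) < r := by linarith
      have : coprimeLogSum r (y / r) = 0 := by
        rw [coprimeLogSum]
        convert tsum_zero with k
        rw [moebiusLogSum_of_lt_one, mul_zero]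
        rcases Nat.eq_zero_or_pos k with rfl | hk
        · simp
        · have hk1 : (1 : ℝ) ≤ k := by exact_mod_cast hk
          exact (div_le_self (by positivity) hk1).trans_lt ((div_lt_one hr0).2 hyr)
      rw [this]
      ring
    · rw [ArithmeticFunction.moebius_eq_zero_of_not_squarefree hsq]
      simp
  set Ey : ℕ → ℝ := fun r => ∑' k, factoredWeight r k * |moebiusLogError (y / r / k)| with hEy
  set Ez : ℕ → ℝ := fun r => ∑' k, factoredWeight r k * |moebiusLogError (z / r / k)| with hEz
  have hterm : ∀ r ∈ R, |(r.totient : ℝ) *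
        (((ArithmeticFunction.moebius r : ℝ) / r * coprimeLogSum r (y / r)) *
          ((ArithmeticFunction.moebius r : ℝ) / r * coprimeLogSum r (z / r))) -
        (r.totient : ℝ)⁻¹| ≤ C₁ * ((r : ℝ)⁻¹ * Ez r) + (r : ℝ)⁻¹ * Ey r := by
    intro r hr
    obtain ⟨hr1, hsq⟩ := Finset.mem_filter.1 hr
    rw [Finset.mem_Icc] at hr1
    have hrne : r ≠ 0 := by omega
    have hr0 : (0 : ℝ) < r := by exact_mod_cast hr1.1
    have hφ : (0 : ℝ) < r.totient := by exact_mod_cast Nat.totient_pos.2 hr1.1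
    have hμ : (ArithmeticFunction.moebius r : ℝ) * ArithmeticFunction.moebius r = 1 := by
      have := ArithmeticFunction.moebius_sq_eq_one_of_squarefree hsq
      rw [← sq]
      exact_mod_cast this
    have hT := hC₁ r hrne (y / r)
    have h1 : |coprimeLogSum r (y / r) - (r : ℝ) / r.totient| ≤ Ey r :=
      abs_coprimeLogSum_sub_le hrne _
    have h2 : |coprimeLogSum r (z / r) - (r : ℝ) / r.totient| ≤ Ez r :=
      abs_coprimeLogSum_sub_le hrne _
    set T := coprimeLogSum r (y / r)
    set T' := coprimeLogSum r (z / r)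
    set t := (r : ℝ) / r.totient with ht
    have ht0 : 0 ≤ t := by positivity
    have h3 : (r.totient : ℝ) * (((ArithmeticFunction.moebius r : ℝ) / r * T) *
          ((ArithmeticFunction.moebius r : ℝ) / r * T')) - (r.totient : ℝ)⁻¹ =
        (r.totient : ℝ) / r ^ 2 * (T * (T' - t) + t * (T - t)) := by
      have : (r.totient : ℝ) * (((ArithmeticFunction.moebius r : ℝ) / r * T) *
          ((ArithmeticFunction.moebius r : ℝ) / r * T')) = (r.totient : ℝ) / r ^ 2 * (T * T') *
          ((ArithmeticFunction.moebius r : ℝ) * ArithmeticFunction.moebius r) := by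
        field_simp
      rw [this, hμ, ht]
      field_simp
      ring
    rw [h3, abs_mul, abs_of_nonneg (by positivity : (0 : ℝ) ≤ (r.totient : ℝ) / r ^ 2)]
    have h4 : |T * (T' - t) + t * (T - t)| ≤ C₁ * t * Ez r + t * Ey r := by
      refine (abs_add_le _ _).trans (add_le_add ?_ ?_)
      · rw [abs_mul]
        exact mul_le_mul hT h2 (abs_nonneg _) (by positivity)
      · rw [abs_mul, abs_of_nonneg ht0]
        exact mul_le_mul_of_nonneg_left h1 ht0
    refine (mul_le_mul_of_nonneg_left h4 (by positivity)).trans (le_of_eq ?_)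
    rw [ht]
    field_simp
  have hy2 := hC₂ y y hy0 le_rfl
  have hz2 := hC₂ y z hy0 hyz
  have h3 := hC₃ y hy
  have h5 : |∑ r ∈ R, (r.totient : ℝ) *
        (((ArithmeticFunction.moebius r : ℝ) / r * coprimeLogSum r (y / r)) *
          ((ArithmeticFunction.moebius r : ℝ) / r * coprimeLogSum r (z / r))) -
        ∑ r ∈ R, (r.totient : ℝ)⁻¹| ≤ C₁ * C₂ + C₂ := by
    rw [← Finset.sum_sub_distrib]
    refine (Finset.abs_sum_le_sum_abs _ _).trans ((Finset.sum_le_sum hterm).trans ?_)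
    rw [Finset.sum_add_distrib, ← Finset.mul_sum]
    exact add_le_add (mul_le_mul_of_nonneg_left hz2 hC₁0) hy2
  refine (abs_sub_le _ (∑ r ∈ R, (r.totient : ℝ)⁻¹) _).trans ?_
  exact add_le_add h5 h3

/-! ### Piecewise linear weights -/

theorem moebiusLcmForm_congr {N : ℕ} {a a' b b' : ℕ → ℝ} (ha : ∀ d ∈ Finset.Icc 1 N, a d = a' d)
    (hb : ∀ d ∈ Finset.Icc 1 N, b d = b' d) : moebiusLcmForm N a b = moebiusLcmForm N a' b' :=
  Finset.sum_congr rfl fun d hd => Finset.sum_congr rfl fun e he => by rw [ha d hd, hb e he]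

theorem moebiusLcmForm_mul_mul (N : ℕ) (c c' : ℝ) (a b : ℕ → ℝ) :
    moebiusLcmForm N (fun d => c * a d) (fun e => c' * b e) = c * c' * moebiusLcmForm N a b := by
  simp only [moebiusLcmForm, Finset.mul_sum]
  exact Finset.sum_congr rfl fun d _ => Finset.sum_congr rfl fun e _ => by ring

theorem moebiusLcmForm_add_left (N : ℕ) (a a' b : ℕ → ℝ) :
    moebiusLcmForm N (fun d => a d + a' d) b =
      moebiusLcmForm N a b + moebiusLcmForm N a' b := by
  simp only [moebiusLcmForm, ← Finset.sum_add_distrib]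
  exact Finset.sum_congr rfl fun d _ => Finset.sum_congr rfl fun e _ => by ring

theorem moebiusLcmForm_sum_left (N : ℕ) {ι : Type*} (I : Finset ι) (ν : ι → ℝ) (a : ι → ℕ → ℝ)
    (b : ℕ → ℝ) :
    moebiusLcmForm N (fun d => ∑ i ∈ I, ν i * a i d) b =
      ∑ i ∈ I, ν i * moebiusLcmForm N (a i) b := by
  classical
  induction I using Finset.induction_on with
  | empty => simp [moebiusLcmForm]
  | insert i I hi ih =>
    simp only [Finset.sum_insert hi]
    rw [moebiusLcmForm_add_left, ih]
    congr 1
    simpa using moebiusLcmForm_mul_mul N (ν i) 1 (a i) b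

theorem moebiusLcmForm_sum_sum (N : ℕ) {ι κ : Type*} (I : Finset ι) (J : Finset κ) (ν : ι → ℝ)
    (ν' : κ → ℝ) (a : ι → ℕ → ℝ) (b : κ → ℕ → ℝ) :
    moebiusLcmForm N (fun d => ∑ i ∈ I, ν i * a i d) (fun e => ∑ j ∈ J, ν' j * b j e) =
      ∑ i ∈ I, ∑ j ∈ J, ν i * ν' j * moebiusLcmForm N (a i) (b j) := by
  rw [moebiusLcmForm_sum_left]
  refine Finset.sum_congr rfl fun i _ => ?_
  rw [moebiusLcmForm_comm, moebiusLcmForm_sum_left, Finset.mul_sum]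
  refine Finset.sum_congr rfl fun j _ => ?_
  rw [moebiusLcmForm_comm, mul_assoc]

/-- The step function with jumps `ν i` at the points `s i`, for `i < n`. -/
noncomputable def stepFun (n : ℕ) (s ν : ℕ → ℝ) (x : ℝ) : ℝ :=
  ∑ i ∈ Finset.range n, if s i ≤ x then ν i else 0

/-- The piecewise linear function whose slope jumps by `ν i` at the points `s i`, for `i < n`. -/
noncomputable def rampFun (n : ℕ) (s ν : ℕ → ℝ) (x : ℝ) : ℝ :=
  ∑ i ∈ Finset.range n, ν i * max 0 (x - s i)

theorem integral_ite_le {s x : ℝ} (hs : 0 ≤ s) (hx : 0 ≤ x) (c : ℝ) :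
    ∫ t in (0 : ℝ)..x, (if s ≤ t then c else 0) = c * max 0 (x - s) := by
  have h1 : (fun t : ℝ => if s ≤ t then c else 0) = (Set.Ici s).indicator fun _ => c := by
    ext t
    simp [Set.indicator_apply]
  rw [intervalIntegral.integral_of_le hx, h1, integral_indicator_const _ measurableSet_Ici,
    measureReal_def, Measure.restrict_apply measurableSet_Ici, smul_eq_mul, mul_comm]
  congr 1
  rcases hs.eq_or_lt with rfl | hs
  · have : Set.Ici (0 : ℝ) ∩ Set.Ioc 0 x = Set.Ioc 0 x :=
      Set.inter_eq_right.2 fun t ht => ht.1.le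
    rw [this, Real.volume_Ioc, ENNReal.toReal_ofReal' , max_comm]
  · have : Set.Ici s ∩ Set.Ioc 0 x = Set.Icc s x := by
      ext t
      simp only [Set.mem_inter_iff, Set.mem_Ici, Set.mem_Ioc, Set.mem_Icc]
      exact ⟨fun h => ⟨h.1, h.2.2⟩, fun h => ⟨h.1, hs.trans_le h.1, h.2⟩⟩
    rw [this, Real.volume_Icc, ENNReal.toReal_ofReal', max_comm]

theorem intervalIntegrable_ite_le (s c a b : ℝ) :
    IntervalIntegrable (fun t => if s ≤ t then c else 0) volume a b := by
  have h : Monotone fun t : ℝ => if s ≤ t then (1 : ℝ) else 0 := by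
    intro t t' htt
    dsimp only
    split_ifs with h1 h2
    · exact le_rfl
    · exact absurd (h1.trans htt) h2
    · exact zero_le_one
    · exact le_rfl
  have := (h.intervalIntegrable (μ := volume) (a := a) (b := b)).const_mul c
  simpa using this

theorem integral_stepFun {n : ℕ} {s : ℕ → ℝ} (hs : ∀ i, 0 ≤ s i) (ν : ℕ → ℝ) {x : ℝ}
    (hx : 0 ≤ x) : ∫ t in (0 : ℝ)..x, stepFun n s ν t = rampFun n s ν x := by
  simp only [stepFun, rampFun]
  rw [intervalIntegral.integral_finsetSum fun i _ => intervalIntegrable_ite_le _ _ _ _]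
  exact Finset.sum_congr rfl fun i _ => integral_ite_le (hs i) hx _

theorem integral_stepFun_mul_stepFun {n m : ℕ} {s t : ℕ → ℝ} (hs : ∀ i, 0 ≤ s i)
    (hs1 : ∀ i < n, s i ≤ 1) (ht1 : ∀ j < m, t j ≤ 1) (ν ν' : ℕ → ℝ) :
    ∫ x in (0 : ℝ)..1, stepFun n s ν x * stepFun m t ν' x =
      ∑ i ∈ Finset.range n, ∑ j ∈ Finset.range m, ν i * ν' j * (1 - max (s i) (t j)) := by
  have h1 : ∀ x, stepFun n s ν x * stepFun m t ν' x =
      ∑ i ∈ Finset.range n, ∑ j ∈ Finset.range m,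
        if max (s i) (t j) ≤ x then ν i * ν' j else 0 := by
    intro x
    rw [stepFun, stepFun, Finset.sum_mul_sum]
    refine Finset.sum_congr rfl fun i _ => Finset.sum_congr rfl fun j _ => ?_
    by_cases h : s i ≤ x <;> by_cases h' : t j ≤ x <;> simp [h, h']
  simp only [h1]
  have h2 : ∀ i ∈ Finset.range n, IntervalIntegrable (fun x => ∑ j ∈ Finset.range m,
      if max (s i) (t j) ≤ x then ν i * ν' j else 0) volume 0 1 := by
    intro i _
    have := IntervalIntegrable.sum (μ := volume) (a := 0) (b := 1) (Finset.range m)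
      (f := fun j x => if max (s i) (t j) ≤ x then ν i * ν' j else 0)
      fun j _ => intervalIntegrable_ite_le _ _ _ _
    simpa only [Finset.sum_fn] using this
  rw [intervalIntegral.integral_finsetSum h2]
  refine Finset.sum_congr rfl fun i hi => ?_
  rw [intervalIntegral.integral_finsetSum fun j _ => intervalIntegrable_ite_le _ _ _ _]
  refine Finset.sum_congr rfl fun j hj => ?_
  rw [integral_ite_le ((hs i).trans (le_max_left _ _)) zero_le_one, max_eq_right]
  exact sub_nonneg.2 (max_le (hs1 i (Finset.mem_range.1 hi)) (ht1 j (Finset.mem_range.1 hj)))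

theorem abs_stepFun_le {n : ℕ} {s ν : ℕ → ℝ} {V : ℝ} (h : ∑ i ∈ Finset.range n, |ν i| ≤ V)
    (x : ℝ) : |stepFun n s ν x| ≤ V := by
  refine ((Finset.abs_sum_le_sum_abs _ _).trans (Finset.sum_le_sum fun i _ => ?_)).trans h
  split_ifs
  · exact le_rfl
  · simp

theorem measurable_stepFun (n : ℕ) (s ν : ℕ → ℝ) : Measurable (stepFun n s ν) :=
  Finset.measurable_fun_sum _ fun _ _ =>
    Measurable.ite measurableSet_Ici measurable_const measurable_const

theorem sieveWeight_ramp {D₁ D₂ : ℝ} (hD₁ : 1 ≤ D₁) (hD : D₁ < D₂) (s : ℝ) {d : ℕ} (hd : 1 ≤ d) :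
    sieveWeight D₁ D₂ (fun x => max 0 (x - s)) d =
      (Real.log (D₂ / D₁))⁻¹ *
        Real.posLog (Real.exp (Real.log D₂ - s * Real.log (D₂ / D₁)) / d) := by
  have hL : 0 < Real.log (D₂ / D₁) := Real.log_pos ((one_lt_div (by linarith)).2 hD)
  have hd0 : (0 : ℝ) < d := by exact_mod_cast hd
  rw [posLog_exp_div hd, sieveWeight, Real.log_div (by linarith) hd0.ne',
    ← mul_max_of_nonneg _ _ (inv_nonneg.2 hL.le) |>.symm, mul_zero]
  congr 1
  field_simp
  ring

/-- For the kinks `s, t ∈ [0, 1]` the form is, up to `O(1)`, the logarithm of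
`D₂ (D₁ / D₂) ^ max s t`, divided by `log² (D₂ / D₁)`. -/
theorem exists_abs_moebiusLcmForm_ramp_sub_le :
    ∃ C : ℝ, 0 ≤ C ∧ ∀ D₁ D₂ : ℝ, 1 ≤ D₁ → D₁ < D₂ → ∀ N : ℕ, D₂ ≤ N →
      ∀ s ∈ Set.Icc (0 : ℝ) 1, ∀ t ∈ Set.Icc (0 : ℝ) 1,
      |moebiusLcmForm N (fun d => sieveWeight D₁ D₂ (fun x => max 0 (x - s)) d)
          (fun e => sieveWeight D₁ D₂ (fun x => max 0 (x - t)) e) -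
        (Real.log D₂ - max s t * Real.log (D₂ / D₁)) / Real.log (D₂ / D₁) ^ 2| ≤
        C / Real.log (D₂ / D₁) ^ 2 := by
  obtain ⟨C, hC0, hC⟩ := exists_abs_moebiusLcmForm_posLog_sub_le
  refine ⟨C, hC0, fun D₁ D₂ hD₁ hD N hN s hs t ht => ?_⟩
  have hL : 0 < Real.log (D₂ / D₁) := Real.log_pos ((one_lt_div (by linarith)).2 hD)
  have hLe : Real.log (D₂ / D₁) ≤ Real.log D₂ := by
    rw [Real.log_div (by linarith) (by linarith)]
    linarith [Real.log_nonneg hD₁]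
  have hbd : ∀ u ∈ Set.Icc (0 : ℝ) 1,
      1 ≤ Real.exp (Real.log D₂ - u * Real.log (D₂ / D₁)) ∧
        Real.exp (Real.log D₂ - u * Real.log (D₂ / D₁)) ≤ N := by
    intro u hu
    constructor
    · rw [Real.one_le_exp_iff]
      nlinarith [hu.2]
    · calc _ ≤ Real.exp (Real.log D₂) := Real.exp_le_exp.2 (by nlinarith [hu.1])
        _ = D₂ := Real.exp_log (by linarith)
        _ ≤ N := hN
  have h := hC _ _ (hbd s hs).1 (hbd t ht).1 N (hbd s hs).2 (hbd t ht).2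
  have hmin : Real.log (min (Real.exp (Real.log D₂ - s * Real.log (D₂ / D₁)))
      (Real.exp (Real.log D₂ - t * Real.log (D₂ / D₁)))) =
      Real.log D₂ - max s t * Real.log (D₂ / D₁) := by
    rw [← Real.exp_monotone.map_min, Real.log_exp, max_mul_of_nonneg _ _ hL.le, min_sub_sub_left]
  rw [hmin] at h
  rw [moebiusLcmForm_congr (fun d hd => sieveWeight_ramp hD₁ hD s (Finset.mem_Icc.1 hd).1)
    (fun d hd => sieveWeight_ramp hD₁ hD t (Finset.mem_Icc.1 hd).1), moebiusLcmForm_mul_mul]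
  set L := Real.log (D₂ / D₁)
  rw [div_eq_inv_mul, ← sq, inv_pow, ← mul_sub, abs_mul, abs_of_pos (by positivity), div_eq_inv_mul]
  exact mul_le_mul_of_nonneg_left h (by positivity)

/-- The form on piecewise linear weights that are constant beyond `1`. Since the jumps of each slope
add up to `0`, the part `log D₂` of the kernel, which does not depend on the kinks, cancels. -/
theorem exists_abs_moebiusLcmForm_rampFun_sub_le :
    ∃ C : ℝ, 0 ≤ C ∧ ∀ D₁ D₂ : ℝ, 1 ≤ D₁ → D₁ < D₂ → ∀ N : ℕ, D₂ ≤ N →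
      ∀ (n m : ℕ) (s t ν ν' : ℕ → ℝ) (V V' : ℝ), (∀ i, 0 ≤ s i) → (∀ j, 0 ≤ t j) →
      (∀ i < n, s i ≤ 1) → (∀ j < m, t j ≤ 1) →
      ∑ i ∈ Finset.range n, ν i = 0 → ∑ j ∈ Finset.range m, ν' j = 0 →
      ∑ i ∈ Finset.range n, |ν i| ≤ V → ∑ j ∈ Finset.range m, |ν' j| ≤ V' →
      |moebiusLcmForm N (fun d => sieveWeight D₁ D₂ (rampFun n s ν) d)
          (fun e => sieveWeight D₁ D₂ (rampFun m t ν') e) -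
        (∫ x in (0 : ℝ)..1, stepFun n s ν x * stepFun m t ν' x) / Real.log (D₂ / D₁)| ≤
        C * (V * V') / Real.log (D₂ / D₁) ^ 2 := by
  obtain ⟨C, hC0, hC⟩ := exists_abs_moebiusLcmForm_ramp_sub_le
  refine ⟨C, hC0, fun D₁ D₂ hD₁ hD N hN n m s t ν ν' V V' hs ht hs1 ht1 hν hν' hV hV' => ?_⟩
  have hL : 0 < Real.log (D₂ / D₁) := Real.log_pos ((one_lt_div (by linarith)).2 hD)
  set L := Real.log (D₂ / D₁) with hLdef
  set K : ℕ → ℕ → ℝ := fun i j =>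
    moebiusLcmForm N (fun d => sieveWeight D₁ D₂ (fun x => max 0 (x - s i)) d)
      (fun e => sieveWeight D₁ D₂ (fun x => max 0 (x - t j)) e) with hK
  have h1 : moebiusLcmForm N (fun d => sieveWeight D₁ D₂ (rampFun n s ν) d)
      (fun e => sieveWeight D₁ D₂ (rampFun m t ν') e) =
      ∑ i ∈ Finset.range n, ∑ j ∈ Finset.range m, ν i * ν' j * K i j :=
    moebiusLcmForm_sum_sum N (Finset.range n) (Finset.range m) ν ν'
      (fun i d => sieveWeight D₁ D₂ (fun x => max 0 (x - s i)) d)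
      (fun j e => sieveWeight D₁ D₂ (fun x => max 0 (x - t j)) e)
  have h2 : ∑ i ∈ Finset.range n, ∑ j ∈ Finset.range m,
      ν i * ν' j * ((Real.log D₂ - L) / L ^ 2) = 0 := by
    simp only [← Finset.sum_mul, ← Finset.mul_sum, hν']
    simp
  rw [h1, integral_stepFun_mul_stepFun hs hs1 ht1,
    ← sub_zero (∑ i ∈ Finset.range n, ∑ j ∈ Finset.range m, ν i * ν' j * K i j), ← h2]
  simp only [Finset.sum_div, ← Finset.sum_sub_distrib]
  have h3 : ∀ i ∈ Finset.range n, ∀ j ∈ Finset.range m,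
      |ν i * ν' j * K i j - ν i * ν' j * ((Real.log D₂ - L) / L ^ 2) -
        ν i * ν' j * (1 - max (s i) (t j)) / L| ≤ |ν i| * |ν' j| * (C / L ^ 2) := by
    intro i hi j hj
    have h4 := hC D₁ D₂ hD₁ hD N hN (s i) ⟨hs i, hs1 i (Finset.mem_range.1 hi)⟩ (t j)
      ⟨ht j, ht1 j (Finset.mem_range.1 hj)⟩
    have h5 : ν i * ν' j * K i j - ν i * ν' j * ((Real.log D₂ - L) / L ^ 2) -
        ν i * ν' j * (1 - max (s i) (t j)) / L =
        ν i * ν' j * (K i j - (Real.log D₂ - max (s i) (t j) * L) / L ^ 2) := by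
      field_simp
      ring
    rw [h5, abs_mul, abs_mul]
    exact mul_le_mul_of_nonneg_left h4 (by positivity)
  refine (Finset.abs_sum_le_sum_abs _ _).trans ((Finset.sum_le_sum fun i hi =>
    (Finset.abs_sum_le_sum_abs _ _).trans (Finset.sum_le_sum fun j hj => h3 i hi j hj)).trans ?_)
  simp only [← Finset.sum_mul, ← Finset.mul_sum]
  have h0 : 0 ≤ ∑ j ∈ Finset.range m, |ν' j| := Finset.sum_nonneg fun _ _ => abs_nonneg _
  have h0' : 0 ≤ V := (Finset.sum_nonneg fun _ _ => abs_nonneg _).trans hV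
  calc _ ≤ V * V' * (C / L ^ 2) :=
        mul_le_mul_of_nonneg_right (mul_le_mul hV hV' h0 h0') (by positivity)
    _ = _ := by ring

/-! ### Approximation of a weight by piecewise linear ones -/

section

open Filter Topology

namespace IsSieveProfile

variable {c : ℝ} {h : ℝ → ℝ}

theorem deriv_of_neg (hh : IsSieveProfile c h) {x : ℝ} (hx : x < 0) : deriv h x = 0 := by
  have : h =ᶠ[𝓝 x] fun _ => 0 := by
    filter_upwards [Iio_mem_nhds hx] with y hy using hh.eq_zero y (le_of_lt hy)
  rw [this.deriv_eq, deriv_const]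

theorem deriv_of_one_lt (hh : IsSieveProfile c h) {x : ℝ} (hx : 1 < x) : deriv h x = 0 := by
  have : h =ᶠ[𝓝 x] fun _ => c := by
    filter_upwards [Ioi_mem_nhds hx] with y hy using hh.eq_const y (le_of_lt hy)
  rw [this.deriv_eq, deriv_const]

theorem integral_deriv (hh : IsSieveProfile c h) (x : ℝ) : ∫ t in (0 : ℝ)..x, deriv h t = h x := by
  rw [(hh.absCont 0 x).integral_deriv_eq_sub, hh.eq_zero 0 le_rfl, sub_zero]

/-- The slope `deriv h` is an almost everywhere limit of step functions on the meshes `i / (n + 1)`.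
Two points outside `[0, 1]` at which the representative of `deriv h` of almost minimal variation
vanishes are added to the mesh, so that the jumps add up to `0`. -/
theorem exists_stepFun_tendsto (hh : IsSieveProfile c h) {V : ℝ}
    (hV : essVariation (deriv h) < ENNReal.ofReal V) :
    ∃ ν : ℕ → ℕ → ℝ, (∀ n, ∑ i ∈ Finset.range (n + 2), ν n i = 0) ∧
      (∀ n, ∑ i ∈ Finset.range (n + 2), |ν n i| ≤ V) ∧
      ∀ᵐ t : ℝ, 0 < t → Tendsto
        (fun n : ℕ => stepFun (n + 2) (fun i => (i : ℝ) / (n + 1)) (ν n) t) atTop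
        (𝓝 (deriv h t)) := by
  obtain ⟨g, hg⟩ := iInf_lt_iff.1 hV
  obtain ⟨hgh, hgV⟩ := iInf_lt_iff.1 hg
  have hV0 : 0 < V := by
    by_contra hle
    rw [ENNReal.ofReal_of_nonpos (not_lt.1 hle)] at hgV
    exact not_lt_zero hgV
  obtain ⟨p, hp0, hp⟩ : ∃ p < 0, g p = 0 := by
    have : NeBot (ae (volume.restrict (Set.Iio (0 : ℝ)))) := by
      rw [ae_restrict_neBot]
      simp
    obtain ⟨p, hp1, hp2⟩ := ((ae_restrict_of_ae hgh).and
      (ae_restrict_mem (measurableSet_Iio : MeasurableSet (Set.Iio (0 : ℝ))))).exists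
    exact ⟨p, hp2, hp1.trans (hh.deriv_of_neg hp2)⟩
  obtain ⟨q, hq0, hq⟩ : ∃ q > 1, g q = 0 := by
    have : NeBot (ae (volume.restrict (Set.Ioi (1 : ℝ)))) := by
      rw [ae_restrict_neBot]
      simp
    obtain ⟨p, hp1, hp2⟩ := ((ae_restrict_of_ae hgh).and
      (ae_restrict_mem (measurableSet_Ioi : MeasurableSet (Set.Ioi (1 : ℝ))))).exists
    exact ⟨p, hp2, hp1.trans (hh.deriv_of_one_lt hp2)⟩
  set u : ℕ → ℕ → ℝ := fun n i =>
    if i = 0 then p else if i ≤ n + 1 then ((i - 1 : ℕ) : ℝ) / (n + 1) else q with hu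
  have hu0 : ∀ n, u n 0 = p := fun n => by simp [hu]
  have hu1 : ∀ n i, i ≤ n → u n (i + 1) = (i : ℝ) / (n + 1) := fun n i hi => by
    simp [hu, hi]
  have hu2 : ∀ n i, n < i → u n (i + 1) = q := fun n i hi => by
    simp [hu, not_le.2 hi]
  have hmono : ∀ n, Monotone (u n) := by
    intro n
    refine monotone_nat_of_le_succ fun i => ?_
    have hn : (0 : ℝ) < n + 1 := by positivity
    rcases i with _ | i
    · rw [hu0, hu1 n 0 (Nat.zero_le _)]
      simpa using hp0.le
    · rcases lt_trichotomy i n with hi | rfl | hi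
      · rw [hu1 n i hi.le, hu1 n (i + 1) hi]
        gcongr
        simp
      · rw [hu1 i i le_rfl, hu2 i (i + 1) (Nat.lt_succ_self _)]
        refine le_trans ?_ hq0.le
        rw [div_le_one hn]
        linarith
      · rw [hu2 n i hi, hu2 n (i + 1) (by omega)]
  set ν : ℕ → ℕ → ℝ := fun n i => g (u n (i + 1)) - g (u n i) with hν
  have hsum : ∀ n k, ∑ i ∈ Finset.range (k + 1), ν n i = g (u n (k + 1)) := by
    intro n k
    rw [Finset.sum_range_sub (fun i => g (u n i)), hu0, hp, sub_zero]
  have hsum0 : ∀ n, ∑ i ∈ Finset.range (n + 2), ν n i = 0 := by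
    intro n
    rw [hsum, hu2 n (n + 1) (Nat.lt_succ_self n), hq]
  refine ⟨ν, hsum0, fun n => ?_, ?_⟩
  · have h1 := (eVariationOn.sum_le (f := g) (n := n + 2) (hmono n)
      fun i => Set.mem_univ _).trans hgV.le
    simp only [edist_dist] at h1
    rw [← ENNReal.ofReal_sum_of_nonneg fun _ _ => dist_nonneg] at h1
    exact (ENNReal.ofReal_le_ofReal_iff hV0.le).1 h1
  · have hbv : BoundedVariationOn g Set.univ := (hgV.trans_le le_top).ne
    have hne : ∀ᵐ t : ℝ, t ≠ 1 := by simp [ae_iff, measure_singleton]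
    filter_upwards [hbv.locallyBoundedVariationOn.ae_differentiableAt, hgh, hne]
      with t ht hgt ht1 h0
    rcases lt_or_gt_of_ne ht1 with ht1 | ht1
    · have hlim : Tendsto (fun n : ℕ => ((⌊t * ((n : ℝ) + 1)⌋₊ : ℕ) : ℝ) / ((n : ℝ) + 1)) atTop
          (𝓝 t) := (tendsto_nat_floor_mul_div_atTop h0.le).comp
            (tendsto_atTop_add_const_right _ 1 tendsto_natCast_atTop_atTop)
      rw [← hgt]
      refine (ht.continuousAt.tendsto.comp hlim).congr fun n => ?_
      have hn : (0 : ℝ) < n + 1 := by positivity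
      have hk : ⌊t * ((n : ℝ) + 1)⌋₊ ≤ n := by
        refine Nat.lt_succ_iff.1 ((Nat.floor_lt (by positivity)).2 ?_)
        push_cast
        nlinarith
      rw [Function.comp_apply, ← hu1 n _ hk, ← hsum, stepFun, ← Finset.sum_filter]
      refine Finset.sum_congr ?_ fun _ _ => rfl
      ext i
      rw [Finset.mem_filter, Finset.mem_range, Finset.mem_range, div_le_iff₀ hn, Nat.lt_succ_iff,
        Nat.le_floor_iff (by positivity)]
      refine ⟨fun hi => ⟨?_, hi⟩, fun hi => hi.2⟩
      have := (Nat.le_floor_iff (by positivity)).2 hi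
      omega
    · rw [hh.deriv_of_one_lt ht1]
      refine tendsto_const_nhds.congr fun n => ?_
      rw [stepFun, ← hsum0 n]
      refine Finset.sum_congr rfl fun i hi => (if_pos ?_).symm
      have hn : (0 : ℝ) < n + 1 := by positivity
      rw [Finset.mem_range] at hi
      have : (i : ℝ) ≤ n + 1 := by exact_mod_cast Nat.lt_succ_iff.1 hi
      exact ((div_le_one hn).2 this).trans ht1.le

theorem ae_abs_deriv_le (hh : IsSieveProfile c h) {V : ℝ}
    (hV : essVariation (deriv h) < ENNReal.ofReal V) : ∀ᵐ t : ℝ, |deriv h t| ≤ V := by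
  obtain ⟨ν, -, hν, hlim⟩ := hh.exists_stepFun_tendsto hV
  have hV0 : 0 ≤ V := (Finset.sum_nonneg fun _ _ => abs_nonneg _).trans (hν 0)
  have hne : ∀ᵐ t : ℝ, t ≠ 0 := by simp [ae_iff, measure_singleton]
  filter_upwards [hlim, hne] with t ht h0
  rcases lt_or_gt_of_ne h0 with h0 | h0
  · rw [hh.deriv_of_neg h0, abs_zero]
    exact hV0
  · exact le_of_tendsto' (ht h0).abs fun n => abs_stepFun_le (hν n) t

theorem tendsto_rampFun (hh : IsSieveProfile c h) {V : ℝ} {ν : ℕ → ℕ → ℝ}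
    (hν : ∀ n, ∑ i ∈ Finset.range (n + 2), |ν n i| ≤ V)
    (hlim : ∀ᵐ t : ℝ, 0 < t → Tendsto
        (fun n : ℕ => stepFun (n + 2) (fun i => (i : ℝ) / (n + 1)) (ν n) t) atTop
        (𝓝 (deriv h t))) (x : ℝ) :
    Tendsto (fun n : ℕ => rampFun (n + 2) (fun i => (i : ℝ) / (n + 1)) (ν n) x) atTop
      (𝓝 (h x)) := by
  rcases le_total x 0 with hx | hx
  · rw [hh.eq_zero x hx]
    refine tendsto_const_nhds.congr fun n => (Finset.sum_eq_zero fun i _ => ?_).symm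
    have : (0 : ℝ) ≤ (i : ℝ) / (n + 1) := by positivity
    rw [max_eq_left (by linarith), mul_zero]
  · rw [← hh.integral_deriv x]
    have h1 : ∀ n : ℕ, rampFun (n + 2) (fun i => (i : ℝ) / (n + 1)) (ν n) x =
        ∫ t in (0 : ℝ)..x, stepFun (n + 2) (fun i => (i : ℝ) / (n + 1)) (ν n) t :=
      fun n => (integral_stepFun (fun i => by positivity) _ hx).symm
    simp only [h1]
    refine intervalIntegral.tendsto_integral_filter_of_dominated_convergence (fun _ => V)
      (.of_forall fun n => (measurable_stepFun _ _ _).aestronglyMeasurable)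
      (.of_forall fun n => .of_forall fun t _ => abs_stepFun_le (hν n) t)
      intervalIntegrable_const ?_
    filter_upwards [hlim] with t ht htx
    rw [Set.uIoc_of_le hx] at htx
    exact ht htx.1

end IsSieveProfile

theorem tendsto_moebiusLcmForm {N : ℕ} {a b : ℕ → ℕ → ℝ} {a' b' : ℕ → ℝ}
    (ha : ∀ d, Tendsto (fun n => a n d) atTop (𝓝 (a' d)))
    (hb : ∀ d, Tendsto (fun n => b n d) atTop (𝓝 (b' d))) :
    Tendsto (fun n => moebiusLcmForm N (a n) (b n)) atTop (𝓝 (moebiusLcmForm N a' b')) :=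
  tendsto_finsetSum _ fun d _ => tendsto_finsetSum _ fun e _ => ((ha d).mul (hb e)).const_mul _

/-- The asymptotic formula for the bilinear form attached to two weight profiles. -/
theorem exists_abs_moebiusLcmForm_sieveWeight_sub_le :
    ∃ C : ℝ, 0 ≤ C ∧ ∀ D₁ D₂ : ℝ, 1 ≤ D₁ → D₁ < D₂ → ∀ N : ℕ, D₂ ≤ N →
      ∀ (c c' : ℝ) (h k : ℝ → ℝ), IsSieveProfile c h → IsSieveProfile c' k →
      |moebiusLcmForm N (fun d => sieveWeight D₁ D₂ h d) (fun e => sieveWeight D₁ D₂ k e) -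
        (∫ x in (0 : ℝ)..1, deriv h x * deriv k x) / Real.log (D₂ / D₁)| ≤
        C * ((essVariation (deriv h)).toReal * (essVariation (deriv k)).toReal) /
          Real.log (D₂ / D₁) ^ 2 := by
  obtain ⟨C, hC0, hC⟩ := exists_abs_moebiusLcmForm_rampFun_sub_le
  refine ⟨C, hC0, fun D₁ D₂ hD₁ hD N hN c c' h k hh hk => ?_⟩
  have key : ∀ V V' : ℝ, essVariation (deriv h) < ENNReal.ofReal V →
      essVariation (deriv k) < ENNReal.ofReal V' →
      |moebiusLcmForm N (fun d => sieveWeight D₁ D₂ h d) (fun e => sieveWeight D₁ D₂ k e) -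
        (∫ x in (0 : ℝ)..1, deriv h x * deriv k x) / Real.log (D₂ / D₁)| ≤
        C * (V * V') / Real.log (D₂ / D₁) ^ 2 := by
    intro V V' hV hV'
    obtain ⟨ν, hν0, hν, hνlim⟩ := hh.exists_stepFun_tendsto hV
    obtain ⟨ν', hν0', hν', hνlim'⟩ := hk.exists_stepFun_tendsto hV'
    have h1 : Tendsto (fun n : ℕ => ∫ x in (0 : ℝ)..1,
        stepFun (n + 2) (fun i => (i : ℝ) / (n + 1)) (ν n) x *
          stepFun (n + 2) (fun i => (i : ℝ) / (n + 1)) (ν' n) x) atTop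
        (𝓝 (∫ x in (0 : ℝ)..1, deriv h x * deriv k x)) := by
      refine intervalIntegral.tendsto_integral_filter_of_dominated_convergence (fun _ => V * V')
        (.of_forall fun n => ((measurable_stepFun _ _ _).mul
          (measurable_stepFun _ _ _)).aestronglyMeasurable)
        (.of_forall fun n => .of_forall fun t _ => ?_) intervalIntegrable_const ?_
      · rw [Real.norm_eq_abs, abs_mul]
        have h2 := abs_stepFun_le (s := fun i => (i : ℝ) / (n + 1)) (hν n) t
        exact mul_le_mul h2 (abs_stepFun_le (hν' n) t) (abs_nonneg _) ((abs_nonneg _).trans h2)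
      · filter_upwards [hνlim, hνlim'] with t ht ht' htx
        rw [Set.uIoc_of_le zero_le_one] at htx
        exact (ht htx.1).mul (ht' htx.1)
    have h2 := tendsto_moebiusLcmForm (N := N)
      (a := fun n d => sieveWeight D₁ D₂ (rampFun (n + 2) (fun i => (i : ℝ) / (n + 1)) (ν n)) d)
      (b := fun n d => sieveWeight D₁ D₂ (rampFun (n + 2) (fun i => (i : ℝ) / (n + 1)) (ν' n)) d)
      (a' := fun d => sieveWeight D₁ D₂ h d) (b' := fun d => sieveWeight D₁ D₂ k d)
      (fun d => hh.tendsto_rampFun hν hνlim _) (fun d => hk.tendsto_rampFun hν' hνlim' _)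
    refine le_of_tendsto' (h2.sub (h1.div_const _)).abs fun n => ?_
    have hs1 : ∀ i < n + 2, (i : ℝ) / (n + 1) ≤ 1 := by
      intro i hi
      rw [div_le_one (by positivity)]
      exact_mod_cast Nat.lt_succ_iff.1 hi
    exact hC D₁ D₂ hD₁ hD N hN (n + 2) (n + 2) _ _ (ν n) (ν' n) V V'
      (fun i => by positivity) (fun i => by positivity) hs1 hs1 (hν0 n) (hν0' n) (hν n) (hν' n)
  have hlt : ∀ {f : ℝ → ℝ}, essVariation f < ⊤ → ∀ {ε : ℝ}, 0 < ε →
      essVariation f < ENNReal.ofReal ((essVariation f).toReal + ε) := by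
    intro f hf ε hε
    rw [ENNReal.lt_ofReal_iff_toReal_lt hf.ne]
    linarith
  have hcont : Tendsto (fun ε : ℝ => C * (((essVariation (deriv h)).toReal + ε) *
      ((essVariation (deriv k)).toReal + ε)) / Real.log (D₂ / D₁) ^ 2) (𝓝[>] 0)
      (𝓝 (C * (((essVariation (deriv h)).toReal + 0) *
        ((essVariation (deriv k)).toReal + 0)) / Real.log (D₂ / D₁) ^ 2)) := by
    refine Tendsto.mono_left (Continuous.tendsto ?_ 0) nhdsWithin_le_nhds
    fun_prop
  rw [add_zero, add_zero] at hcont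
  refine ge_of_tendsto hcont ?_
  filter_upwards [self_mem_nhdsWithin] with ε hε
  exact key _ _ (hlt hh.variation_lt_top hε) (hlt hk.variation_lt_top hε)

end

/-! ### The main term and the function `barbanVehov` -/

namespace IsSieveProfile

variable {c : ℝ} {h : ℝ → ℝ}

theorem essVariation_lt_ofReal (hh : IsSieveProfile c h) {ε : ℝ} (hε : 0 < ε) :
    essVariation (deriv h) < ENNReal.ofReal ((essVariation (deriv h)).toReal + ε) := by
  rw [ENNReal.lt_ofReal_iff_toReal_lt hh.variation_lt_top.ne]
  linarith

theorem indicator_deriv (hh : IsSieveProfile c h) :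
    (Set.Icc (0 : ℝ) 1).indicator (deriv h) = deriv h := by
  refine Set.indicator_eq_self.2 fun x hx => ?_
  by_contra hx'
  rw [Set.mem_Icc, not_and_or, not_le, not_le] at hx'
  exact hx (hx'.elim hh.deriv_of_neg hh.deriv_of_one_lt)

theorem memLp_deriv (hh : IsSieveProfile c h) : MemLp (deriv h) 2 volume := by
  rw [← hh.indicator_deriv, memLp_indicator_iff_restrict measurableSet_Icc]
  refine MemLp.of_bound (measurable_deriv h).aestronglyMeasurable
    ((essVariation (deriv h)).toReal + 1) (ae_restrict_of_ae ?_)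
  exact hh.ae_abs_deriv_le (hh.essVariation_lt_ofReal one_pos)

theorem l2Norm_deriv_sq (hh : IsSieveProfile c h) :
    l2Norm (deriv h) ^ 2 = ∫ x in (0 : ℝ)..1, deriv h x * deriv h x := by
  have h1 : ∫ x in (0 : ℝ)..1, deriv h x * deriv h x = ∫ x, ‖deriv h x‖ ^ 2 := by
    rw [intervalIntegral.integral_of_le zero_le_one, ← integral_Icc_eq_integral_Ioc,
      ← integral_indicator measurableSet_Icc]
    congr 1 with x
    have := congrFun hh.indicator_deriv x
    rw [Set.indicator_apply] at this ⊢
    split_ifs at this ⊢ with hx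
    · rw [Real.norm_eq_abs, sq_abs, sq]
    · rw [← this]
      simp
  rw [h1, l2Norm, hh.memLp_deriv.eLpNorm_eq_integral_rpow_norm (by norm_num) (by norm_num),
    ENNReal.toReal_ofReal (by positivity), ← Real.rpow_natCast, ← Real.rpow_mul (by positivity)]
  norm_num

theorem intervalIntegrable_deriv_mul_deriv (hh : IsSieveProfile c h) {c' : ℝ} {k : ℝ → ℝ}
    (hk : IsSieveProfile c' k) (a b : ℝ) :
    IntervalIntegrable (fun x => deriv h x * deriv k x) volume a b :=
  (hh.memLp_deriv.integrable_mul hk.memLp_deriv).intervalIntegrable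

theorem l2Norm_deriv_le (hh : IsSieveProfile c h) :
    l2Norm (deriv h) ≤ (essVariation (deriv h)).toReal := by
  refine le_of_forall_pos_le_add fun ε hε => ?_
  have hV : 0 ≤ (essVariation (deriv h)).toReal + ε := by positivity
  refine abs_le_of_sq_le_sq' ?_ hV |>.2
  rw [hh.l2Norm_deriv_sq]
  have h1 := intervalIntegral.integral_mono_ae (μ := volume) zero_le_one
    (hh.intervalIntegrable_deriv_mul_deriv hh 0 1)
    (intervalIntegrable_const (c := ((essVariation (deriv h)).toReal + ε) ^ 2)) ?_
  · simpa using h1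
  · filter_upwards [hh.ae_abs_deriv_le (hh.essVariation_lt_ofReal hε)] with x hx
    rw [← sq, ← sq_abs]
    gcongr

theorem eq_mul_of_deriv_ae_eq (hh : IsSieveProfile c h) {a : ℝ}
    (ha : ∀ᵐ x : ℝ, x ∈ Set.Ioc (0 : ℝ) 1 → deriv h x = a) {x : ℝ} (hx : x ∈ Set.Icc (0 : ℝ) 1) :
    h x = a * x := by
  rw [← hh.integral_deriv x, intervalIntegral.integral_congr_ae (g := fun _ => a)]
  · simp [mul_comm]
  · filter_upwards [ha] with t ht htx
    rw [Set.uIoc_of_le hx.1] at htx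
    exact ht ⟨htx.1, htx.2.trans hx.2⟩

/-- `∫ (h' - a)² = |h'|² - 2 a c + a²` over `[0, 1]`, where `c = ∫ h'`. -/
theorem integral_deriv_sub_const_sq (hh : IsSieveProfile c h) (a : ℝ) :
    ∫ x in (0 : ℝ)..1, (deriv h x - a) ^ 2 = l2Norm (deriv h) ^ 2 - 2 * a * c + a ^ 2 := by
  have h0 : IntervalIntegrable (deriv h) volume 0 1 := (hh.absCont 0 1).intervalIntegrable_deriv
  have h1 : ∀ x, (deriv h x - a) ^ 2 = deriv h x * deriv h x - 2 * a * deriv h x + a ^ 2 :=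
    fun x => by ring
  simp only [h1]
  rw [intervalIntegral.integral_add ((hh.intervalIntegrable_deriv_mul_deriv hh 0 1).sub
      (h0.const_mul _)) intervalIntegrable_const,
    intervalIntegral.integral_sub (hh.intervalIntegrable_deriv_mul_deriv hh 0 1) (h0.const_mul _),
    intervalIntegral.integral_const_mul, hh.integral_deriv, hh.eq_const 1 le_rfl,
    hh.l2Norm_deriv_sq]
  simp

theorem deriv_ae_eq_of_integral_eq_zero (hh : IsSieveProfile c h) {a : ℝ}
    (ha : ∫ x in (0 : ℝ)..1, (deriv h x - a) ^ 2 = 0) :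
    ∀ᵐ x : ℝ, x ∈ Set.Ioc (0 : ℝ) 1 → deriv h x = a := by
  have hint : IntervalIntegrable (fun x => (deriv h x - a) ^ 2) volume 0 1 := by
    have h0 : IntervalIntegrable (deriv h) volume 0 1 := (hh.absCont 0 1).intervalIntegrable_deriv
    have h1 : ∀ x, (deriv h x - a) ^ 2 = deriv h x * deriv h x - 2 * a * deriv h x + a ^ 2 :=
      fun x => by ring
    simp only [h1]
    exact ((hh.intervalIntegrable_deriv_mul_deriv hh 0 1).sub (h0.const_mul _)).add
      intervalIntegrable_const
  have h1 := (intervalIntegral.integral_eq_zero_iff_of_le_of_nonneg_ae zero_le_one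
    (Filter.Eventually.of_forall fun x => sq_nonneg _) hint).1 ha
  filter_upwards [ae_imp_of_ae_restrict h1] with x hx hx'
  have := hx hx'
  simp only [Pi.zero_apply] at this
  nlinarith [pow_eq_zero_iff (two_ne_zero) |>.1 this]

/-- A profile with `h' = 0` almost everywhere vanishes. -/
theorem eq_zero_of_l2Norm_eq_zero (hh : IsSieveProfile 0 h) (h0 : l2Norm (deriv h) = 0) :
    h = 0 := by
  have h1 := hh.integral_deriv_sub_const_sq 0
  rw [h0] at h1
  have h2 := hh.deriv_ae_eq_of_integral_eq_zero (a := 0) (by simpa using h1)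
  ext x
  rcases le_total x 0 with hx | hx
  · exact hh.eq_zero x hx
  · rcases le_total x 1 with hx1 | hx1
    · rw [hh.eq_mul_of_deriv_ae_eq h2 ⟨hx, hx1⟩]
      simp
    · exact hh.eq_const x hx1

end IsSieveProfile

theorem barbanVehov_eq (x : ℝ) : barbanVehov x = max 0 (min x 1) := by
  rw [barbanVehov]
  split_ifs with h1 h2
  · rw [max_eq_left ((min_le_left _ _).trans h1.le)]
  · rw [min_eq_left h2, max_eq_right (not_lt.1 h1)]
  · rw [min_eq_right (not_le.1 h2).le, max_eq_right zero_le_one]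

theorem lipschitzWith_barbanVehov : LipschitzWith 1 barbanVehov := by
  have : barbanVehov = fun x => max 0 (min x 1) := funext barbanVehov_eq
  rw [this]
  exact (LipschitzWith.id.min_const 1).const_max 0

theorem deriv_barbanVehov_of_mem {x : ℝ} (hx : x ∈ Set.Ioo (0 : ℝ) 1) :
    deriv barbanVehov x = 1 := by
  have : barbanVehov =ᶠ[nhds x] id := by
    filter_upwards [Ioo_mem_nhds hx.1 hx.2] with y hy
    rw [barbanVehov_eq, min_eq_left hy.2.le, max_eq_right hy.1.le, id]
  rw [this.deriv_eq, deriv_id]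

/-- The indicator function of `[0, 1]` is a version of the derivative of `barbanVehov` of bounded
variation. -/
theorem essVariation_deriv_barbanVehov_lt_top : essVariation (deriv barbanVehov) < ⊤ := by
  set g : ℝ → ℝ := (Set.Icc (0 : ℝ) 1).indicator fun _ => 1 with hg
  have hg1 : ∀ x, |g x| ≤ 1 := by
    intro x
    rw [hg, Set.indicator_apply]
    split_ifs <;> simp
  have hl : BoundedVariationOn g (Set.Iic 1) := by
    refine MonotoneOn.boundedVariationOn (C := 1) (fun x hx y hy hxy => ?_) fun x _ => hg1 x
    rw [Set.mem_Iic] at hx hy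
    simp only [hg, Set.indicator_apply, Set.mem_Icc, hx, hy, and_true]
    split_ifs <;> linarith
  have hr : BoundedVariationOn g (Set.Ici 1) := by
    have h1 : BoundedVariationOn (fun x => -g x) (Set.Ici 1) := by
      refine MonotoneOn.boundedVariationOn (C := 1) (fun x hx y hy hxy => ?_) fun x _ => by
        rw [abs_neg]
        exact hg1 x
      rw [Set.mem_Ici] at hx hy
      have hx0 : 0 ≤ x := by linarith
      have hy0 : 0 ≤ y := by linarith
      simp only [hg, Set.indicator_apply, Set.mem_Icc, hx0, hy0, true_and]
      split_ifs <;> linarith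
    have h2 := (LipschitzWith.id (α := ℝ)).neg.comp_boundedVariationOn h1
    have h3 : (fun x : ℝ => -id x) ∘ (fun x => -g x) = g := by
      ext x
      simp
    exact h3 ▸ h2
  have huniv : eVariationOn g Set.univ < ⊤ := by
    rw [← Set.Iic_union_Ici (a := (1 : ℝ)), eVariationOn.union g isGreatest_Iic isLeast_Ici]
    exact ENNReal.add_lt_top.2 ⟨hl.lt_top, hr.lt_top⟩
  have hae : g =ᵐ[volume] deriv barbanVehov := by
    filter_upwards [volume.ae_ne (0 : ℝ), volume.ae_ne (1 : ℝ)] with x hx0 hx1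
    rcases lt_or_gt_of_ne hx0 with hx0 | hx0
    · have : barbanVehov =ᶠ[nhds x] fun _ => 0 := by
        filter_upwards [Iio_mem_nhds hx0] with y hy
        rw [barbanVehov_eq, max_eq_left ((min_le_left _ _).trans (le_of_lt hy))]
      rw [this.deriv_eq, deriv_const, hg, Set.indicator_of_notMem fun h => not_lt.2 h.1 hx0]
    · rcases lt_or_gt_of_ne hx1 with hx1 | hx1
      · rw [deriv_barbanVehov_of_mem ⟨hx0, hx1⟩, hg,
          Set.indicator_of_mem (Set.mem_Icc.2 ⟨hx0.le, hx1.le⟩)]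
      · have : barbanVehov =ᶠ[nhds x] fun _ => 1 := by
          filter_upwards [Ioi_mem_nhds hx1] with y hy
          rw [barbanVehov_eq, min_eq_right (le_of_lt hy), max_eq_right zero_le_one]
        rw [this.deriv_eq, deriv_const, hg, Set.indicator_of_notMem fun h => not_lt.2 h.2 hx1]
  exact (iInf₂_le g hae).trans_lt huniv

theorem isSieveProfile_barbanVehov : IsSieveProfile 1 barbanVehov where
  absCont _ _ := lipschitzWith_barbanVehov.lipschitzOnWith.absolutelyContinuousOnInterval
  eq_zero x hx := by rw [barbanVehov_eq, max_eq_left ((min_le_left _ _).trans hx)]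
  eq_const x hx := by rw [barbanVehov_eq, min_eq_right hx, max_eq_right zero_le_one]
  variation_lt_top := essVariation_deriv_barbanVehov_lt_top

theorem IsSieveProfile.integral_deriv_barbanVehov_mul {c : ℝ} {h : ℝ → ℝ}
    (hh : IsSieveProfile c h) : ∫ x in (0 : ℝ)..1, deriv barbanVehov x * deriv h x = c := by
  rw [intervalIntegral.integral_congr_Ioo_of_le (g := deriv h) zero_le_one fun x hx => by
    simp only [deriv_barbanVehov_of_mem hx, one_mul], hh.integral_deriv, hh.eq_const 1 le_rfl]

theorem l2Norm_deriv_barbanVehov : l2Norm (deriv barbanVehov) = 1 := by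
  have h := isSieveProfile_barbanVehov.l2Norm_deriv_sq
  rw [isSieveProfile_barbanVehov.integral_deriv_barbanVehov_mul] at h
  exact (pow_eq_one_iff_of_nonneg ENNReal.toReal_nonneg two_ne_zero).1 h

theorem IsSieveProfile.one_le_l2Norm_deriv {h : ℝ → ℝ} (hh : IsSieveProfile 1 h) :
    1 ≤ l2Norm (deriv h) := by
  have h1 := hh.integral_deriv_sub_const_sq 1
  have h2 : 0 ≤ ∫ x in (0 : ℝ)..1, (deriv h x - 1) ^ 2 :=
    intervalIntegral.integral_nonneg zero_le_one fun x _ => sq_nonneg _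
  have h3 : 0 ≤ l2Norm (deriv h) := ENNReal.toReal_nonneg
  nlinarith

theorem IsSieveProfile.eq_barbanVehov_of_l2Norm_deriv_eq_one {h : ℝ → ℝ}
    (hh : IsSieveProfile 1 h) (h1 : l2Norm (deriv h) = 1) : h = barbanVehov := by
  have h2 := hh.deriv_ae_eq_of_integral_eq_zero (a := 1) (by
    rw [hh.integral_deriv_sub_const_sq, h1]
    norm_num)
  ext x
  rcases le_total x 0 with hx | hx
  · rw [hh.eq_zero x hx, isSieveProfile_barbanVehov.eq_zero x hx]
  · rcases le_total x 1 with hx1 | hx1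
    · rw [hh.eq_mul_of_deriv_ae_eq h2 ⟨hx, hx1⟩, barbanVehov_eq, min_eq_left hx1,
        max_eq_right hx, one_mul]
    · rw [hh.eq_const x hx1, isSieveProfile_barbanVehov.eq_const x hx1]

/-! ### The asymptotic formulas -/

theorem sieveM_eq_moebiusLcmForm {D₁ D₂ : ℝ} (hD₁ : 1 ≤ D₁) (hD : D₁ < D₂) {h : ℝ → ℝ}
    (h0 : ∀ x : ℝ, x ≤ 0 → h x = 0) {N : ℕ} (hN : D₂ ≤ N) :
    sieveM D₁ D₂ h =
      moebiusLcmForm N (fun d => sieveWeight D₁ D₂ h d) (fun e => sieveWeight D₁ D₂ h e) := by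
  have hw : ∀ d : ℕ, N < d → sieveWeight D₁ D₂ h d = 0 := by
    intro d hd
    have hd' : (N : ℝ) < d := by exact_mod_cast hd
    refine h0 _ (div_nonpos_of_nonpos_of_nonneg ?_ ?_)
    · refine Real.log_nonpos (div_nonneg (by linarith) (by linarith)) ?_
      exact (div_le_one (by linarith)).2 (by linarith)
    · exact Real.log_nonneg ((one_le_div (by linarith)).2 hD.le)
  set f : ℕ × ℕ → ℝ := fun p => ((ArithmeticFunction.moebius p.1 : ℝ) *
    ArithmeticFunction.moebius p.2) / (Nat.lcm p.1 p.2 : ℝ) *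
      (sieveWeight D₁ D₂ h p.1 * sieveWeight D₁ D₂ h p.2) with hf
  have hinj : Function.Injective fun d : ℕ+ × ℕ+ => ((d.1 : ℕ), (d.2 : ℕ)) := by
    intro a b hab
    exact Prod.ext (PNat.coe_injective (Prod.ext_iff.1 hab).1)
      (PNat.coe_injective (Prod.ext_iff.1 hab).2)
  have hsupp : Function.support f ⊆ Set.range fun d : ℕ+ × ℕ+ => ((d.1 : ℕ), (d.2 : ℕ)) := by
    rintro ⟨a, b⟩ hab
    have ha : a ≠ 0 := by
      rintro rfl
      simp [hf] at hab
    have hb : b ≠ 0 := by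
      rintro rfl
      simp [hf] at hab
    exact ⟨(⟨a, Nat.pos_of_ne_zero ha⟩, ⟨b, Nat.pos_of_ne_zero hb⟩), rfl⟩
  have h1 : sieveM D₁ D₂ h = ∑' p, f p := hinj.tsum_eq hsupp
  rw [h1, tsum_eq_sum (s := Finset.Icc 1 N ×ˢ Finset.Icc 1 N), Finset.sum_product, moebiusLcmForm]
  rintro ⟨a, b⟩ hab
  rw [Finset.mem_product, Finset.mem_Icc, Finset.mem_Icc] at hab
  simp only [hf]
  rcases Nat.eq_zero_or_pos a with rfl | ha
  · simp
  rcases Nat.eq_zero_or_pos b with rfl | hb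
  · simp
  by_cases haN : a ≤ N
  · rw [hw b (by omega)]
    simp
  · rw [hw a (by omega)]
    simp

theorem exists_abs_sieveM_sub_le :
    ∃ C : ℝ, 0 ≤ C ∧ ∀ D₁ D₂ : ℝ, 1 ≤ D₁ → D₁ < D₂ → ∀ (c : ℝ) (h : ℝ → ℝ), IsSieveProfile c h →
      |sieveM D₁ D₂ h - l2Norm (deriv h) ^ 2 / Real.log (D₂ / D₁)| ≤
        C * ((essVariation (deriv h)).toReal ^ 2 / Real.log (D₂ / D₁) ^ 2) := by
  obtain ⟨C, hC0, hC⟩ := exists_abs_moebiusLcmForm_sieveWeight_sub_le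
  refine ⟨C, hC0, fun D₁ D₂ hD₁ hD c h hh => ?_⟩
  rw [sieveM_eq_moebiusLcmForm hD₁ hD hh.eq_zero (Nat.le_ceil D₂), hh.l2Norm_deriv_sq,
    ← mul_div_assoc, sq (essVariation (deriv h)).toReal]
  exact hC D₁ D₂ hD₁ hD _ (Nat.le_ceil D₂) c c h h hh hh

/-- In `M(h₀ + α h₁)` the cross term is of lower order, since `∫ h₀' h₁' = h₁ 1 = 0`. -/
theorem exists_abs_sieveM_barbanVehov_add_sub_le :
    ∃ C : ℝ, 0 ≤ C ∧ ∀ D₁ D₂ : ℝ, 1 ≤ D₁ → D₁ < D₂ → ∀ h₁ : ℝ → ℝ, IsSieveProfile 0 h₁ →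
      ∀ g : ℝ, 1 ≤ g →
      |sieveM D₁ D₂ (fun x => barbanVehov x + 1 / g * h₁ x) -
          (sieveM D₁ D₂ barbanVehov +
            l2Norm (deriv h₁) ^ 2 / (g ^ 2 * Real.log (D₂ / D₁)))| ≤
        C * (((essVariation (deriv h₁)).toReal + (essVariation (deriv h₁)).toReal ^ 2) /
          (g * Real.log (D₂ / D₁) ^ 2)) := by
  obtain ⟨C, hC0, hC⟩ := exists_abs_moebiusLcmForm_sieveWeight_sub_le
  set K := (essVariation (deriv barbanVehov)).toReal with hK
  have hK0 : 0 ≤ K := ENNReal.toReal_nonneg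
  refine ⟨2 * C * K + C, by positivity, fun D₁ D₂ hD₁ hD h₁ hh g hg => ?_⟩
  have hg0 : 0 < g := by linarith
  have hL : 0 < Real.log (D₂ / D₁) := Real.log_pos ((one_lt_div (by linarith)).2 hD)
  have hN := Nat.le_ceil D₂
  have hbv := isSieveProfile_barbanVehov
  set N := ⌈D₂⌉₊
  have hcross := hC D₁ D₂ hD₁ hD N hN 1 0 _ _ hbv hh
  have hsquare := hC D₁ D₂ hD₁ hD N hN 0 0 _ _ hh hh
  rw [hh.integral_deriv_barbanVehov_mul, zero_div, sub_zero] at hcross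
  rw [← hh.l2Norm_deriv_sq] at hsquare
  rw [sieveM_eq_moebiusLcmForm hD₁ hD (fun x hx => by
      rw [hbv.eq_zero x hx, hh.eq_zero x hx, mul_zero, add_zero]) hN,
    sieveM_eq_moebiusLcmForm hD₁ hD hbv.eq_zero hN]
  set V := (essVariation (deriv h₁)).toReal with hV
  have hV0 : 0 ≤ V := ENNReal.toReal_nonneg
  set L := Real.log (D₂ / D₁)
  set a : ℕ → ℝ := fun d => sieveWeight D₁ D₂ barbanVehov d with ha
  set b : ℕ → ℝ := fun d => sieveWeight D₁ D₂ h₁ d with hb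
  have hexp : moebiusLcmForm N
      (fun d => sieveWeight D₁ D₂ (fun x => barbanVehov x + 1 / g * h₁ x) d)
      (fun e => sieveWeight D₁ D₂ (fun x => barbanVehov x + 1 / g * h₁ x) e) =
      moebiusLcmForm N a a + 2 / g * moebiusLcmForm N a b + 1 / g ^ 2 * moebiusLcmForm N b b := by
    change moebiusLcmForm N (fun d => a d + 1 / g * b d) (fun d => a d + 1 / g * b d) = _
    have h1 : ∀ u : ℕ → ℝ, moebiusLcmForm N (fun d => a d + 1 / g * b d) u =
        moebiusLcmForm N a u + 1 / g * moebiusLcmForm N b u := by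
      intro u
      rw [moebiusLcmForm_add_left]
      congr 1
      simpa using moebiusLcmForm_mul_mul N (1 / g) 1 b u
    rw [h1, moebiusLcmForm_comm N a, moebiusLcmForm_comm N b, h1, h1, moebiusLcmForm_comm N b a]
    ring
  have hsplit : moebiusLcmForm N a a + 2 / g * moebiusLcmForm N a b +
      1 / g ^ 2 * moebiusLcmForm N b b -
        (moebiusLcmForm N a a + l2Norm (deriv h₁) ^ 2 / (g ^ 2 * L)) =
      2 / g * moebiusLcmForm N a b +
        1 / g ^ 2 * (moebiusLcmForm N b b - l2Norm (deriv h₁) ^ 2 / L) := by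
    field_simp
    ring
  rw [hexp, hsplit]
  refine (abs_add_le _ _).trans ?_
  rw [abs_mul, abs_mul, abs_of_pos (by positivity : 0 < 2 / g),
    abs_of_pos (by positivity : 0 < 1 / g ^ 2)]
  have hgg : 1 / g ^ 2 ≤ 1 / g := one_div_le_one_div_of_le hg0 (by nlinarith)
  calc 2 / g * |moebiusLcmForm N a b| +
        1 / g ^ 2 * |moebiusLcmForm N b b - l2Norm (deriv h₁) ^ 2 / L|
      ≤ 2 / g * (C * (K * V) / L ^ 2) + 1 / g * (C * (V * V) / L ^ 2) := by gcongr
    _ = (2 * C * K * V + C * V ^ 2) / (g * L ^ 2) := by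
        field_simp
    _ ≤ ((2 * C * K + C) * (V + V ^ 2)) / (g * L ^ 2) := by
        gcongr
        have : 0 ≤ 2 * C * K * V ^ 2 + C * V := by positivity
        linarith
    _ = _ := by ring

theorem corollary1 :
    -- (i) the asymptotic formula, with an absolute implied constant
    (∃ C : ℝ, ∀ D₁ D₂ : ℝ, 1 ≤ D₁ → D₁ < D₂ → ∀ h : ℝ → ℝ, IsSieveProfile 1 h →
      MemLp (deriv h) 2 volume ∧
      |sieveM D₁ D₂ h - l2Norm (deriv h) ^ 2 / Real.log (D₂ / D₁)| ≤
        C * ((essVariation (deriv h)).toReal ^ 2 / Real.log (D₂ / D₁) ^ 2)) ∧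
    -- (i) the function `h₀` is the unique minimizer of the main term
    (IsSieveProfile 1 barbanVehov ∧ l2Norm (deriv barbanVehov) = 1 ∧
      ∀ h : ℝ → ℝ, IsSieveProfile 1 h →
        1 ≤ l2Norm (deriv h) ∧ (l2Norm (deriv h) = 1 ↔ h = barbanVehov)) ∧
    -- (ii) perturbations of `h₀`, with an absolute implied constant
    (∃ C : ℝ, ∀ D₁ D₂ : ℝ, 1 ≤ D₁ → D₁ < D₂ → ∀ h₁ : ℝ → ℝ, IsSieveProfile 0 h₁ →
      ∀ g : ℝ → ℝ, 1 ≤ g (Real.log (D₂ / D₁)) →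
      MemLp (deriv h₁) 2 volume ∧
      |sieveM D₁ D₂ (fun x => barbanVehov x + 1 / g (Real.log (D₂ / D₁)) * h₁ x) -
          (sieveM D₁ D₂ barbanVehov +
            l2Norm (deriv h₁) ^ 2 / (g (Real.log (D₂ / D₁)) ^ 2 * Real.log (D₂ / D₁)))| ≤
        C * (((essVariation (deriv h₁)).toReal + (essVariation (deriv h₁)).toReal ^ 2) /
          (g (Real.log (D₂ / D₁)) * Real.log (D₂ / D₁) ^ 2))) ∧
    -- (ii) second-order optimality: `M(h) > M(h₀)` unless `g(t) ≫ |h₁'|² t / (V + V²)` at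
    -- `t = log (D₂ / D₁)`
    (∃ c : ℝ, 0 < c ∧ ∀ D₁ D₂ : ℝ, 1 ≤ D₁ → D₁ < D₂ → ∀ h₁ : ℝ → ℝ, IsSieveProfile 0 h₁ →
      ∀ g : ℝ → ℝ, 1 ≤ g (Real.log (D₂ / D₁)) →
      g (Real.log (D₂ / D₁)) <
        c * (l2Norm (deriv h₁) ^ 2 /
          ((essVariation (deriv h₁)).toReal + (essVariation (deriv h₁)).toReal ^ 2) *
          Real.log (D₂ / D₁)) →
      sieveM D₁ D₂ barbanVehov <
        sieveM D₁ D₂ (fun x => barbanVehov x + 1 / g (Real.log (D₂ / D₁)) * h₁ x)) ∧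
    -- (ii) and in the remaining case the two values differ by a third-order term at most
    (∀ c : ℝ, 0 < c → ∃ C : ℝ, ∀ D₁ D₂ : ℝ, 1 ≤ D₁ → D₁ < D₂ →
      ∀ h₁ : ℝ → ℝ, IsSieveProfile 0 h₁ →
      ∀ g : ℝ → ℝ, 1 ≤ g (Real.log (D₂ / D₁)) →
      c * (l2Norm (deriv h₁) ^ 2 /
          ((essVariation (deriv h₁)).toReal + (essVariation (deriv h₁)).toReal ^ 2) *
          Real.log (D₂ / D₁)) ≤ g (Real.log (D₂ / D₁)) →
      |sieveM D₁ D₂ (fun x => barbanVehov x + 1 / g (Real.log (D₂ / D₁)) * h₁ x) -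
          sieveM D₁ D₂ barbanVehov| ≤
        C * (((essVariation (deriv h₁)).toReal + (essVariation (deriv h₁)).toReal ^ 2) ^ 2 /
          l2Norm (deriv h₁) ^ 2 / Real.log (D₂ / D₁) ^ 3)) := by
  obtain ⟨C₁, -, hC₁⟩ := exists_abs_sieveM_sub_le
  obtain ⟨C₂, hC₂0, hC₂⟩ := exists_abs_sieveM_barbanVehov_add_sub_le
  refine ⟨⟨C₁, fun D₁ D₂ hD₁ hD h hh => ⟨hh.memLp_deriv, hC₁ D₁ D₂ hD₁ hD 1 h hh⟩⟩,
    ⟨isSieveProfile_barbanVehov, l2Norm_deriv_barbanVehov, fun h hh =>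
      ⟨hh.one_le_l2Norm_deriv, hh.eq_barbanVehov_of_l2Norm_deriv_eq_one, ?_⟩⟩,
    ⟨C₂, fun D₁ D₂ hD₁ hD h₁ hh g hg => ⟨hh.memLp_deriv, hC₂ D₁ D₂ hD₁ hD h₁ hh _ hg⟩⟩,
    ⟨1 / (C₂ + 1), by positivity, fun D₁ D₂ hD₁ hD h₁ hh g hg hlt => ?_⟩,
    fun c hc => ⟨1 / c ^ 2 + C₂ / c, fun D₁ D₂ hD₁ hD h₁ hh g hg hle => ?_⟩⟩
  · rintro rfl
    exact l2Norm_deriv_barbanVehov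
  · have hL : 0 < Real.log (D₂ / D₁) := Real.log_pos ((one_lt_div (by linarith)).2 hD)
    have h1 := (abs_le.1 (hC₂ D₁ D₂ hD₁ hD h₁ hh _ hg)).1
    set L := Real.log (D₂ / D₁)
    set γ := g L
    set W := (essVariation (deriv h₁)).toReal + (essVariation (deriv h₁)).toReal ^ 2 with hW
    have hγ : 0 < γ := by linarith
    have hW0 : 0 ≤ W := by
      have : 0 ≤ (essVariation (deriv h₁)).toReal := ENNReal.toReal_nonneg
      positivity
    -- for `W = 0` the right side of the hypothesis on `g` is `0`
    rcases hW0.eq_or_lt with hW0 | hW0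
    · rw [← hW0, div_zero, zero_mul, mul_zero] at hlt
      linarith
    have h2 : C₂ * (W / (γ * L ^ 2)) < l2Norm (deriv h₁) ^ 2 / (γ ^ 2 * L) := by
      have h3 : γ * ((C₂ + 1) * W) < l2Norm (deriv h₁) ^ 2 * L := by
        have : 1 / (C₂ + 1) * (l2Norm (deriv h₁) ^ 2 / W * L) =
            l2Norm (deriv h₁) ^ 2 * L / ((C₂ + 1) * W) := by
          field_simp
        rw [this, lt_div_iff₀ (by positivity)] at hlt
        exact hlt
      have h4 : C₂ * W * γ < l2Norm (deriv h₁) ^ 2 * L := by nlinarith [mul_pos hγ hW0]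
      rw [← mul_div_assoc, div_lt_div_iff₀ (by positivity) (by positivity)]
      calc C₂ * W * (γ ^ 2 * L) = C₂ * W * γ * (γ * L) := by ring
        _ < l2Norm (deriv h₁) ^ 2 * L * (γ * L) := by gcongr
        _ = l2Norm (deriv h₁) ^ 2 * (γ * L ^ 2) := by ring
    linarith
  · have hL : 0 < Real.log (D₂ / D₁) := Real.log_pos ((one_lt_div (by linarith)).2 hD)
    have h1 := hC₂ D₁ D₂ hD₁ hD h₁ hh _ hg
    have hNV := hh.l2Norm_deriv_le
    have hN0 : 0 ≤ l2Norm (deriv h₁) := ENNReal.toReal_nonneg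
    rcases hN0.eq_or_lt with hN0 | hN0
    -- the right side is then a quotient by `0`, but `h₁` vanishes
    · have h2 := hh.eq_zero_of_l2Norm_eq_zero hN0.symm
      subst h2
      simp only [Pi.zero_apply, mul_zero, add_zero, sub_self, abs_zero]
      positivity
    set L := Real.log (D₂ / D₁)
    set γ := g L
    have hγ : 0 < γ := by linarith
    have hW0 : 0 < (essVariation (deriv h₁)).toReal + (essVariation (deriv h₁)).toReal ^ 2 := by
      have : 0 < (essVariation (deriv h₁)).toReal := hN0.trans_le hNV
      positivity
    set W := (essVariation (deriv h₁)).toReal + (essVariation (deriv h₁)).toReal ^ 2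
    set n := l2Norm (deriv h₁)
    have h2 : 1 / γ ≤ W / (c * n ^ 2 * L) := by
      rw [div_le_div_iff₀ hγ (by positivity)]
      have : c * (n ^ 2 / W * L) = c * n ^ 2 * L / W := by field_simp
      rw [this, div_le_iff₀ hW0] at hle
      linarith
    have h3 : sieveM D₁ D₂ (fun x => barbanVehov x + 1 / γ * h₁ x) - sieveM D₁ D₂ barbanVehov =
        (sieveM D₁ D₂ (fun x => barbanVehov x + 1 / γ * h₁ x) -
          (sieveM D₁ D₂ barbanVehov + n ^ 2 / (γ ^ 2 * L))) + n ^ 2 / (γ ^ 2 * L) := by ring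
    rw [h3]
    refine (abs_add_le _ _).trans ?_
    rw [abs_of_pos (by positivity : 0 < n ^ 2 / (γ ^ 2 * L))]
    calc _ ≤ C₂ * (W / (γ * L ^ 2)) + n ^ 2 / (γ ^ 2 * L) := by gcongr
      _ = C₂ * W / L ^ 2 * (1 / γ) + n ^ 2 / L * (1 / γ) ^ 2 := by
          field_simp
      _ ≤ C₂ * W / L ^ 2 * (W / (c * n ^ 2 * L)) + n ^ 2 / L * (W / (c * n ^ 2 * L)) ^ 2 := by
          gcongr
      _ = (1 / c ^ 2 + C₂ / c) * (W ^ 2 / n ^ 2 / L ^ 3) := by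
          field_simp
          ring
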